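/- **Setting.** Let $s\in(0,1)$, $N\in\mathbb N$ with $N>2s$, and $2^*_s=\frac{2N}{N-2s}$. For a Schwartz function $\varphi$ and $t\in(0,1)$, $$(-\Delta)^{t}\varphi(x)=-\tfrac12 C(N,t)\int_{\mathbb R^N}\frac{\varphi(x+y)+\varphi(x-y)-2\varphi(x)}{|y|^{N+2t}}\,dy,\qquad C(N,t)=\Big(\int_{\mathbb R^N}\frac{1-\cos x_1}{|x|^{N+2t}}\,dx\Big)^{-1}.$$ For real functions $u$, $(-\Delta)^{s/2}u\in L^2(\mathbb R^N)$ is understood in the sense of distributions. Let $\dot H^s(\mathbb R^N)$ (resp. $H^s(\mathbb R^N)$) be the space of $u\in L^{2^*_s}(\mathbb R^N)$ (resp. $u\in L^2(\mathbb R^N)$) with $(-\Delta)^{s/2}u\in L^2(\mathbb R^N)$; $\dot H^s$ carries the inner product $\int_{\mathbb R^N}(-\Delta)^{s/2}u\,(-\Delta)^{s/2}\varphi\,dx$. Let $K\in C^2([0,\infty)^2,\mathbb R)$ satisfy, for all $u,v\ge0$: $K(tu,tv)=t^{2^*_s}K(u,v)$ for $t>0$; the function $G$ on $[0,\infty)^2$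 given by $G(u^{2^*_s},v^{2^*_s})=K(u,v)$ is concave; $|K_u(u,v)|+|K_v(u,v)|\le c(u^{2^*_s-1}+v^{2^*_s-1})$ for some $c>0$; $K_u(0,1)=K_v(1,0)=0$; $K_u(1,0)=K_v(0,1)=0$; $K(u,v)>0$ if $u,v>0$; $K_u(u,v),K_v(u,v)\ge0$. Extend $K$ to $\mathbb R^2$ by $K(u,v)=0$ if $u\le0$ or $v\le0$, and set $$\widetilde S_K=\inf\Big\{\int_{\mathbb R^N}|(-\Delta)^{s/2}u|^2+|(-\Delta)^{s/2}v|^2\,dx:\ u,v\in H^s(\mathbb R^N),\ \int_{\mathbb R^N}K(u^+,v^+)\,dx=1\Big\}.$$ **Lemma 4.2.** Let $(u_n,v_n)$ be a bounded sequence in $\dot H^s(\mathbb R^N)\times\dot H^s(\mathbb R^N)$ that is tight, i.e. for every $\delta>0$ there is $R>0$ with $\int_{\mathbb R^N\setminus B_R}|(-\Delta)^{s/2}u_n|^2+|(-\Delta)^{s/2}v_n|^2\,dx\le\delta$ for all $n$, and let $(u_n,v_n)\rightharpoonup(u,v)$ weakly in $\dot H^s(\mathbb R^N)\times\dot H^s(\mathbb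 R^N)$. Assume that $$|(-\Delta)^{s/2}u_n|^2\,dx\rightharpoonup\mu,\qquad |(-\Delta)^{s/2}v_n|^2\,dx\rightharpoonup\sigma,\qquad K(u_n,v_n)\,dx\rightharpoonup\nu$$ in the sense of measures (tested against continuous functions with compact support), where $\mu,\sigma,\nu$ are finite non-negative Borel measures on $\mathbb R^N$. Then there are an at most countable set $I$, distinct points $\{x_i\}_{i\in I}\subset\mathbb R^N$ and numbers $\{\mu_i\}_{i\in I},\{\sigma_i\}_{i\in I},\{\nu_i\}_{i\in I}\subset(0,\infty)$ such that $$\nu=K(u,v)\,dx+\sum_{i\in I}\nu_i\delta_{x_i},\qquad \mu\ge|(-\Delta)^{s/2}u|^2\,dx+\sum_{i\in I}\mu_i\delta_{x_i},\qquad \sigma\ge|(-\Delta)^{s/2}v|^2\,dx+\sum_{i\in I}\sigma_i\delta_{x_i},$$ and $\mu_i+\sigma_i\ge\widetilde S_K\,\nu_i^{2/2^*_s}$ for every $i\in I$. -/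

import Mathlib

open MeasureTheory Filter Topology Set
open scoped SchwartzMap

namespace FracCC

/-- The Euclidean space `ℝ^N`. -/
abbrev RN (N : ℕ) : Type := EuclideanSpace ℝ (Fin N)

/-- The fractional critical Sobolev exponent `2*_s = 2N / (N - 2s)`. -/
noncomputable def critExp (N : ℕ) (s : ℝ) : ℝ := 2 * (N : ℝ) / ((N : ℝ) - 2 * s)

/-- The constant `C(N, t) = (∫ (1 - cos x₁) / |x|^(N + 2t) dx)⁻¹`. -/
noncomputable def fracConst (N : ℕ) [NeZero N] (t : ℝ) : ℝ :=
  (∫ x : RN N, (1 - Real.cos (x 0)) / ‖x‖ ^ ((N : ℝ) + 2 * t))⁻¹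

/-- The fractional Laplacian `(-Δ)^t φ` of a Schwartz function, for `0 < t < 1`. -/
noncomputable def fracLaplacian {N : ℕ} [NeZero N] (t : ℝ) (φ : 𝓢(RN N, ℝ)) (x : RN N) : ℝ :=
  -(1 / 2) * fracConst N t *
    ∫ y : RN N, (φ (x + y) + φ (x - y) - 2 * φ x) / ‖y‖ ^ ((N : ℝ) + 2 * t)

/-- `w` is an `L²` function that equals `(-Δ)^(s/2) u` in the sense of distributions. -/
def IsHalfLap {N : ℕ} [NeZero N] (s : ℝ) (u w : RN N → ℝ) : Prop :=
  MemLp w 2 volume ∧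
    ∀ φ : 𝓢(RN N, ℝ), ∫ x, u x * fracLaplacian (s / 2) φ x = ∫ x, w x * φ x

open Classical in
/-- The function `(-Δ)^(s/2) u ∈ L²(ℝ^N)`, which is determined up to a null set
(and set to `0` if there is no such function). -/
noncomputable def halfLap {N : ℕ} [NeZero N] (s : ℝ) (u : RN N → ℝ) : RN N → ℝ :=
  if h : ∃ w, IsHalfLap s u w then h.choose else 0

/-- The homogeneous space `Ḣ^s(ℝ^N)`: functions `u ∈ L^{2*_s}` with `(-Δ)^(s/2) u ∈ L²`. -/
def MemHdot {N : ℕ} [NeZero N] (s : ℝ) (u : RN N → ℝ) : Prop :=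
  MemLp u (ENNReal.ofReal (critExp N s)) volume ∧ ∃ w, IsHalfLap s u w

/-- The space `H^s(ℝ^N)`: functions `u ∈ L²` with `(-Δ)^(s/2) u ∈ L²`. -/
def MemHs {N : ℕ} [NeZero N] (s : ℝ) (u : RN N → ℝ) : Prop :=
  MemLp u 2 volume ∧ ∃ w, IsHalfLap s u w

/-- The energy density `|(-Δ)^(s/2) u|² + |(-Δ)^(s/2) v|²` of a pair. -/
noncomputable def energyDensity {N : ℕ} [NeZero N] (s : ℝ) (u v : RN N → ℝ) (x : RN N) : ℝ :=
  halfLap s u x ^ 2 + halfLap s v x ^ 2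

/-- Boundedness of `(u_n, v_n)` in `Ḣ^s × Ḣ^s`, with norm
`‖(u, v)‖² = ∫ |(-Δ)^(s/2) u|² + |(-Δ)^(s/2) v|²`. -/
def BoundedSeq {N : ℕ} [NeZero N] (s : ℝ) (u v : ℕ → RN N → ℝ) : Prop :=
  ∃ C : ℝ, ∀ n, ∫ x, energyDensity s (u n) (v n) x ≤ C

/-- Tightness of `(u_n, v_n)` in `Ḣ^s × Ḣ^s`. -/
def TightSeq {N : ℕ} [NeZero N] (s : ℝ) (u v : ℕ → RN N → ℝ) : Prop :=
  ∀ δ : ℝ, 0 < δ → ∃ R : ℝ, 0 < R ∧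
    ∀ n, ∫ x in (Metric.ball (0 : RN N) R)ᶜ, energyDensity s (u n) (v n) x ≤ δ

/-- Weak convergence in the Hilbert space `Ḣ^s`, whose inner product is
`⟨u, φ⟩ = ∫ (-Δ)^(s/2) u (-Δ)^(s/2) φ`. -/
def WeakTendsto {N : ℕ} [NeZero N] (s : ℝ) (u : ℕ → RN N → ℝ) (u₀ : RN N → ℝ) : Prop :=
  ∀ φ : RN N → ℝ, MemHdot s φ →
    Tendsto (fun n => ∫ x, halfLap s (u n) x * halfLap s φ x) atTop
      (𝓝 (∫ x, halfLap s u₀ x * halfLap s φ x))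

/-- Convergence `f_n dx ⇀ μ` in the sense of measures, tested against `C_c(ℝ^N)`. -/
def MeasTendsto {N : ℕ} (f : ℕ → RN N → ℝ) (μ : Measure (RN N)) : Prop :=
  ∀ g : RN N → ℝ, Continuous g → HasCompactSupport g →
    Tendsto (fun n => ∫ x, g x * f n x) atTop (𝓝 (∫ x, g x ∂μ))

/-- The closed quadrant `[0, ∞) × [0, ∞)`. -/
def quadrant : Set (ℝ × ℝ) := Ici 0 ×ˢ Ici 0

/-- The partial derivative `K_u` on the closed quadrant (one-sided at `u = 0`). -/
noncomputable def partialU (K : ℝ × ℝ → ℝ) (u v : ℝ) : ℝ :=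
  derivWithin (fun t => K (t, v)) (Ici 0) u

/-- The partial derivative `K_v` on the closed quadrant (one-sided at `v = 0`). -/
noncomputable def partialV (K : ℝ × ℝ → ℝ) (u v : ℝ) : ℝ :=
  derivWithin (fun t => K (u, t)) (Ici 0) v

/-- The structural assumptions on the `q`-homogeneous nonlinearity `K ∈ C²([0, ∞)²)`;
only the values of `K` on the closed quadrant matter. -/
structure IsCriticalK (q : ℝ) (K : ℝ × ℝ → ℝ) : Prop where
  contDiffOn : ContDiffOn ℝ 2 K quadrant
  homogeneous : ∀ t u v : ℝ, 0 < t → 0 ≤ u → 0 ≤ v → K (t * u, t * v) = t ^ q * K (u, v)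
  concave : ∃ G : ℝ × ℝ → ℝ, ConcaveOn ℝ quadrant G ∧
    ∀ u v : ℝ, 0 ≤ u → 0 ≤ v → G (u ^ q, v ^ q) = K (u, v)
  growth : ∃ c : ℝ, 0 < c ∧ ∀ u v : ℝ, 0 ≤ u → 0 ≤ v →
    |partialU K u v| + |partialV K u v| ≤ c * (u ^ (q - 1) + v ^ (q - 1))
  cross_zero : partialU K 0 1 = 0 ∧ partialV K 1 0 = 0
  axis_zero : partialU K 1 0 = 0 ∧ partialV K 0 1 = 0
  pos : ∀ u v : ℝ, 0 < u → 0 < v → 0 < K (u, v)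
  mono : ∀ u v : ℝ, 0 ≤ u → 0 ≤ v → 0 ≤ partialU K u v ∧ 0 ≤ partialV K u v

/-- The extension of `K` to `ℝ²` by `K(u, v) = 0` if `u ≤ 0` or `v ≤ 0`. -/
noncomputable def extendK (K : ℝ × ℝ → ℝ) (u v : ℝ) : ℝ :=
  if u ≤ 0 ∨ v ≤ 0 then 0 else K (u, v)

/-- The constant `S̃_K`: the infimum of `∫ |(-Δ)^(s/2) u|² + |(-Δ)^(s/2) v|²` over
`u, v ∈ H^s(ℝ^N)` with `∫ K(u⁺, v⁺) = 1`. -/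
noncomputable def sobolevK (N : ℕ) [NeZero N] (s : ℝ) (K : ℝ × ℝ → ℝ) : ℝ :=
  sInf {e : ℝ | ∃ u v : RN N → ℝ, MemHs s u ∧ MemHs s v ∧
    ∫ x, extendK K (max (u x) 0) (max (v x) 0) = 1 ∧
    e = ∫ x, energyDensity s u v x}

/-- The measure `f dx` for a non-negative density `f`. -/
noncomputable def densityMeasure {N : ℕ} (f : RN N → ℝ) : Measure (RN N) :=
  (volume : Measure (RN N)).withDensity (fun x => ENNReal.ofReal (f x))

/-- The atomic measure `∑ a_i δ_{x_i}` for `a_i ≥ 0`. -/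
noncomputable def atomicMeasure {N : ℕ} {I : Type} (x : I → RN N) (a : I → ℝ) :
    Measure (RN N) :=
  Measure.sum (fun i => ENNReal.ofReal (a i) • Measure.dirac (x i))

end FracCC

/-! Write q for the critical exponent. The differences θ_n = u_n - u and η_n = v_n - v are bounded
and weakly null in Ḣ^s, and everything comes from testing the functional inequalities on ψθ_n and
ψη_n, where ψ ≥ 0 is smooth with compact support.

Three facts govern these products. (1) Leibniz rule (`IsHalfLap.cutoff_mul`): (-Δ)^(s/2)(ψθ) is
ψ(-Δ)^(s/2)θ minus a commutator, whose kernel is dominated by the integrable function min(1,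
|y|/R)/|y|^(N+s). (2) Local compactness (`IsWeaklyNull.tendsto_eLpNorm_cutoff`): θ_n tends to 0 in
L² on balls. Hence the commutators tend to 0 in L², and the energy of ψθ_n tends to ∫ψ² dμ -
∫ψ²|(-Δ)^(s/2)u|². (3) A Brezis-Lieb splitting for homogeneous functions: ∫K(ψθ_n, ψη_n) tends to
∫ψ^q dν - ∫ψ^q K(u,v).

The limits in (2) and (3) are non-negative, so the densities split off and leave finite defect
measures μ', σ', ν' (`exists_add_densityMeasure`). Letting ψ decrease to the indicator of a compact
set T, the definition of S̃_K gives S̃_K ν'(T)^(2/q) ≤ μ'(T) + σ'(T). Since K vanishes on both axes,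
K(a,b) ≤ ε|b|^q + C_ε|a|^q, and symmetrically; the Sobolev inequality then gives ν'(T) ≤ ε
σ'(T)^(q/2) + C_ε μ'(T)^(q/2), and symmetrically. As q/2 > 1, ν' is purely atomic, and as ε is
arbitrary, each of its atoms is an atom of both μ' and σ' (`exists_countable_atoms`).

The Sobolev inequality is proved on H^s by cutting frequencies at a threshold that depends on the
level of |u|, with the symbol |2πξ|^s computed from the singular integral. It passes to Ḣ^s by wide
cutoffs. It makes (-Δ)^(s/2) injective with closed range, so that weak convergence in Ḣ^s implies
weak convergence in L^q. -/

set_option linter.unusedSectionVars false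

namespace FracCC

open scoped ENNReal NNReal

/-! ### Young's convolution inequality for non-negative functions -/

section Young

/-- Jensen's inequality for the measure `k dμ`, without normalisation. -/
theorem rpow_lintegral_mul_le {α : Type*} [MeasurableSpace α] {μ : Measure α} {k f : α → ℝ≥0∞}
    (hk : AEMeasurable k μ) (hf : AEMeasurable f μ) {p : ℝ} (hp : 1 ≤ p) :
    (∫⁻ x, k x * f x ∂μ) ^ p ≤ (∫⁻ x, k x * f x ^ p ∂μ) * (∫⁻ x, k x ∂μ) ^ (p - 1) := by
  have hp0 : 0 < p := by linarith
  have hac : μ.withDensity k ≪ μ := withDensity_absolutelyContinuous _ _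
  have h := eLpNorm'_le_eLpNorm'_mul_rpow_measure_univ (μ := μ.withDensity k) (f := f)
    zero_lt_one hp (hf.mono_ac hac).aestronglyMeasurable
  simp only [eLpNorm', enorm_eq_self, ENNReal.rpow_one, div_one] at h
  rw [lintegral_withDensity_eq_lintegral_mul₀ hk hf,
    lintegral_withDensity_eq_lintegral_mul₀ hk (hf.pow_const p), withDensity_apply _ .univ,
    Measure.restrict_univ] at h
  have h2 := ENNReal.rpow_le_rpow h hp0.le
  rw [ENNReal.mul_rpow_of_nonneg _ _ hp0.le, ← ENNReal.rpow_mul, ← ENNReal.rpow_mul,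
    one_div_mul_cancel hp0.ne', ENNReal.rpow_one] at h2
  refine h2.trans_eq ?_
  simp only [Pi.mul_apply]
  congr 2
  field_simp

variable {E : Type*} [NormedAddCommGroup E] [MeasurableSpace E] [BorelSpace E]
  [SecondCountableTopology E] {μ : Measure E} [SFinite μ] [μ.IsAddLeftInvariant]
  [μ.IsNegInvariant]

/-- Young's inequality `‖k * f‖_p ≤ ‖k‖_1 ‖f‖_p` for non-negative functions. -/
theorem eLpNorm_lintegral_sub_mul_le {k f : E → ℝ≥0∞} (hk : Measurable k)
    (hf : AEMeasurable f μ) {p : ℝ≥0∞} (hp : 1 ≤ p) (hp' : p ≠ ∞) (hk' : ∫⁻ y, k y ∂μ ≠ ∞) :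
    eLpNorm (fun z => ∫⁻ x, k (x - z) * f x ∂μ) p μ ≤ (∫⁻ y, k y ∂μ) * eLpNorm f p μ := by
  have hp0 : p ≠ 0 := (zero_lt_one.trans_le hp).ne'
  set r := p.toReal with hr
  have hr1 : 1 ≤ r := by
    simpa using (ENNReal.toReal_le_toReal ENNReal.one_ne_top hp').2 hp
  have hr0 : 0 < r := by linarith
  rw [eLpNorm_eq_lintegral_rpow_enorm_toReal hp0 hp', eLpNorm_eq_lintegral_rpow_enorm_toReal hp0 hp']
  simp only [enorm_eq_self, ← hr]
  rw [← ENNReal.rpow_le_rpow_iff hr0, ENNReal.mul_rpow_of_nonneg _ _ hr0.le, ← ENNReal.rpow_mul,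
    ← ENNReal.rpow_mul, one_div_mul_cancel hr0.ne', ENNReal.rpow_one, ENNReal.rpow_one]
  have hker : ∀ z, ∫⁻ x, k (x - z) ∂μ = ∫⁻ y, k y ∂μ := fun z => lintegral_sub_right_eq_self k z
  have hker' : ∀ x, ∫⁻ z, k (x - z) ∂μ = ∫⁻ y, k y ∂μ := fun x => lintegral_sub_left_eq_self k x
  -- Jensen moves the power r inside, against a kernel whose mass does not depend on z. Tonelli then
  -- integrates z out; the factors ‖k‖₁^(r-1) and ‖k‖₁ combine to ‖k‖₁^r.
  calc ∫⁻ z, (∫⁻ x, k (x - z) * f x ∂μ) ^ r ∂μ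
      ≤ ∫⁻ z, (∫⁻ x, k (x - z) * f x ^ r ∂μ) * (∫⁻ y, k y ∂μ) ^ (r - 1) ∂μ := by
        refine lintegral_mono fun z => ?_
        have := rpow_lintegral_mul_le (μ := μ) (k := fun x => k (x - z)) (f := f)
          (hk.comp (measurable_id.sub_const z)).aemeasurable hf hr1
        rwa [hker] at this
    _ = (∫⁻ z, ∫⁻ x, k (x - z) * f x ^ r ∂μ ∂μ) * (∫⁻ y, k y ∂μ) ^ (r - 1) := by
        rw [lintegral_mul_const']
        exact ENNReal.rpow_ne_top_of_nonneg (by linarith) hk'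
    _ = (∫⁻ x, ∫⁻ z, k (x - z) * f x ^ r ∂μ ∂μ) * (∫⁻ y, k y ∂μ) ^ (r - 1) := by
        rw [lintegral_lintegral_swap]
        refine AEMeasurable.mul ?_ ?_
        · exact (hk.comp (measurable_snd.sub measurable_fst)).aemeasurable
        · exact (hf.pow_const r).comp_snd
    _ = (∫⁻ x, (∫⁻ y, k y ∂μ) * f x ^ r ∂μ) * (∫⁻ y, k y ∂μ) ^ (r - 1) := by
        congr 2
        ext x
        rw [lintegral_mul_const, hker']
        exact hk.comp (measurable_const.sub measurable_id)
    _ = (∫⁻ y, k y ∂μ) ^ r * ∫⁻ x, f x ^ r ∂μ := by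
        rw [lintegral_const_mul' _ _ hk', mul_right_comm]
        congr 1
        nth_rewrite 1 [← ENNReal.rpow_one (∫⁻ y, k y ∂μ)]
        rw [← ENNReal.rpow_add_of_nonneg _ _ zero_le_one (by linarith)]
        congr 1; ring

end Young

/-! ### The truncated singular kernel and its scaling -/

section Kernel

variable {N : ℕ} {s R : ℝ}

/-- The truncated kernel `min(1, |y| / R) / |y|^(N + s)`. -/
noncomputable def kern (N : ℕ) (s R : ℝ) (y : RN N) : ℝ :=
  min 1 (‖y‖ / R) / ‖y‖ ^ ((N : ℝ) + s)

theorem kern_nonneg (hR : 0 < R) (y : RN N) : 0 ≤ kern N s R y := by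
  unfold kern; positivity

theorem measurable_kern : Measurable (kern N s R) := by
  unfold kern; fun_prop

/-- In polar coordinates the radial density is r^(-s) on (0,1] and r^(-1-s) beyond: s < 1 serves the
origin and s > 0 serves infinity. -/
theorem integrable_kern_one [NeZero N] (hs0 : 0 < s) (hs1 : s < 1) :
    Integrable (kern N s 1) volume := by
  have hN : (0 : ℝ) < N := by exact_mod_cast Nat.pos_of_ne_zero (NeZero.ne N)
  have key := (integrable_fun_norm_addHaar (volume : Measure (RN N))
    (f := fun r : ℝ => min 1 (r / 1) / r ^ ((N : ℝ) + s))).2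
  refine key ?_
  have hpow : ∀ y : ℝ, 0 < y → y ^ (N - 1) = y ^ ((N : ℝ) - 1) := fun y hy => by
    rw [← Real.rpow_natCast, Nat.cast_sub (Nat.one_le_iff_ne_zero.2 (NeZero.ne N))]; simp
  rw [← Ioc_union_Ioi_eq_Ioi zero_le_one]
  refine IntegrableOn.union ?_ ?_
  · have h1 : IntegrableOn (fun y : ℝ => y ^ (-s)) (Ioc 0 1) := by
      rw [integrableOn_Ioc_iff_integrableOn_Ioo, intervalIntegral.integrableOn_Ioo_rpow_iff one_pos]
      linarith
    refine h1.congr_fun (fun y hy => ?_) measurableSet_Ioc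
    simp only [finrank_euclideanSpace, Fintype.card_fin, div_one, smul_eq_mul]
    rw [min_eq_right hy.2, hpow y hy.1, mul_div_assoc', eq_div_iff (Real.rpow_pos_of_pos hy.1 _).ne',
      ← Real.rpow_add hy.1]
    nth_rewrite 3 [← Real.rpow_one y]
    rw [← Real.rpow_add hy.1]
    congr 1; ring
  · have h1 : IntegrableOn (fun y : ℝ => y ^ (-1 - s)) (Ioi 1) :=
      integrableOn_Ioi_rpow_of_lt (by linarith) one_pos
    refine h1.congr_fun (fun y hy => ?_) measurableSet_Ioi
    have hy0 : 0 < y := zero_lt_one.trans hy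
    simp only [finrank_euclideanSpace, Fintype.card_fin, div_one, smul_eq_mul]
    rw [min_eq_left (le_of_lt hy), hpow y hy0, mul_div_assoc', eq_div_iff (Real.rpow_pos_of_pos hy0 _).ne',
      ← Real.rpow_add hy0, mul_one]
    congr 1; ring

theorem kern_eq_smul (hR : 0 < R) (y : RN N) :
    kern N s R y = R ^ (-((N : ℝ) + s)) * kern N s 1 (R⁻¹ • y) := by
  unfold kern
  rw [norm_smul, Real.norm_of_nonneg (by positivity), Real.mul_rpow (by positivity) (by positivity),
    Real.inv_rpow hR.le, Real.rpow_neg hR.le, div_one]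
  have := (Real.rpow_pos_of_pos hR ((N : ℝ) + s)).ne'
  rw [show ‖y‖ / R = R⁻¹ * ‖y‖ by field_simp]
  -- A vanishing denominator makes both sides 0 under the convention x / 0 = 0.
  by_cases h : ‖y‖ ^ ((N : ℝ) + s) = 0
  · simp [h]
  · field_simp

theorem integrable_kern [NeZero N] (hs0 : 0 < s) (hs1 : s < 1) (hR : 0 < R) :
    Integrable (kern N s R) volume := by
  rw [show kern N s R = fun y => R ^ (-((N : ℝ) + s)) * kern N s 1 (R⁻¹ • y) from
    funext fun y => kern_eq_smul hR y]
  exact ((integrable_kern_one hs0 hs1).comp_smul (by positivity)).const_mul _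

/-- Change of variables. The gain R^(-s) is what makes commutators with wide cutoffs small. -/
theorem integral_kern (hR : 0 < R) :
    ∫ y, kern N s R y = R ^ (-s) * ∫ y, kern N s 1 y := by
  rw [show kern N s R = fun y => R ^ (-((N : ℝ) + s)) * kern N s 1 (R⁻¹ • y) from
    funext fun y => kern_eq_smul hR y, integral_const_mul, Measure.integral_comp_smul]
  simp only [finrank_euclideanSpace, Fintype.card_fin, smul_eq_mul]
  rw [abs_of_pos (by positivity), ← mul_assoc]
  congr 1
  rw [inv_pow, inv_inv, ← Real.rpow_natCast, ← Real.rpow_add hR]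
  congr 1; ring

/-- The kernel as a non-negative extended function. -/
noncomputable def ekern (N : ℕ) (s R : ℝ) (y : RN N) : ℝ≥0∞ := ENNReal.ofReal (kern N s R y)

theorem measurable_ekern : Measurable (ekern N s R) := measurable_kern.ennreal_ofReal

theorem lintegral_ekern [NeZero N] (hs0 : 0 < s) (hs1 : s < 1) (hR : 0 < R) :
    ∫⁻ y, ekern N s R y = ENNReal.ofReal (R ^ (-s)) * ∫⁻ y, ekern N s 1 y := by
  unfold ekern
  rw [← ofReal_integral_eq_lintegral_ofReal (integrable_kern hs0 hs1 hR)
    (Eventually.of_forall fun y => kern_nonneg hR y),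
    ← ofReal_integral_eq_lintegral_ofReal (integrable_kern hs0 hs1 one_pos)
    (Eventually.of_forall fun y => kern_nonneg one_pos y), ← ENNReal.ofReal_mul (by positivity),
    integral_kern hR]

theorem lintegral_ekern_ne_top [NeZero N] (hs0 : 0 < s) (hs1 : s < 1) (hR : 0 < R) :
    ∫⁻ y, ekern N s R y ≠ ∞ := by
  unfold ekern
  rw [← ofReal_integral_eq_lintegral_ofReal (integrable_kern hs0 hs1 hR)
    (Eventually.of_forall fun y => kern_nonneg hR y)]
  exact ENNReal.ofReal_ne_top

end Kernel
end FracCC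

namespace FracCC

open scoped ENNReal NNReal

/-! ### The fractional Laplacian of a Schwartz function lies in every L^p with 1 ≤ p < ∞ -/

section Schwartz

variable {N : ℕ} {s : ℝ}

/-- The reference decay profile `(1 + |x|)^(-(N + 1))`. -/
noncomputable def decay (x : RN N) : ℝ := (1 + ‖x‖) ^ (-((N : ℝ) + 1))

theorem decay_pos (x : RN N) : 0 < decay x := by unfold decay; positivity

theorem measurable_decay : Measurable (decay (N := N)) := by unfold decay; fun_prop

theorem decay_le_one (x : RN N) : decay x ≤ 1 :=
  Real.rpow_le_one_of_one_le_of_nonpos (by linarith [norm_nonneg x])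
    (by linarith [(Nat.cast_nonneg N : (0 : ℝ) ≤ N)])

theorem integrable_decay : Integrable (decay (N := N)) volume :=
  integrable_one_add_norm (by simp)

theorem memLp_decay {p : ℝ≥0∞} (hp : 1 ≤ p) (hp' : p ≠ ∞) : MemLp (decay (N := N)) p volume := by
  refine (integrable_norm_rpow_iff measurable_decay.aestronglyMeasurable
    (zero_lt_one.trans_le hp).ne' hp').1 (integrable_decay.mono' ?_ ?_)
  · exact (measurable_decay.norm.pow_const _).aestronglyMeasurable
  · refine Eventually.of_forall fun x => ?_
    rw [Real.norm_of_nonneg (by positivity), Real.norm_of_nonneg (decay_pos x).le]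
    have h1 : 1 ≤ p.toReal := by simpa using (ENNReal.toReal_le_toReal ENNReal.one_ne_top hp').2 hp
    simpa using Real.rpow_le_rpow_of_exponent_ge (decay_pos x) (decay_le_one x) h1

theorem decay_le_of_norm_le {x z : RN N} (h : ‖x‖ ≤ ‖z‖ + 1) :
    decay z ≤ 2 ^ ((N : ℝ) + 1) * decay x := by
  have hN : (0 : ℝ) ≤ (N : ℝ) + 1 := by positivity
  unfold decay
  rw [Real.rpow_neg (by positivity), Real.rpow_neg (by positivity), ← div_eq_mul_inv,
    ← one_div, div_le_div_iff₀ (by positivity) (by positivity), one_mul,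
    ← Real.mul_rpow (by positivity) (by positivity)]
  refine Real.rpow_le_rpow (by positivity) ?_ hN
  nlinarith [norm_nonneg z]

theorem norm_sub_div_le_kern {F : Type*} [NormedAddCommGroup F] {D : ℝ} {φ : RN N → F}
    (h : ∀ x y, ‖φ x - φ (x + y)‖ ≤ D * (min 1 ‖y‖ * (decay x + decay (x + y)))) (x y : RN N) :
    ‖φ x - φ (x + y)‖ / ‖y‖ ^ ((N : ℝ) + s) ≤
      D * (kern N s 1 y * decay x + kern N s 1 y * decay (x + y)) := by
  unfold kern
  rw [div_one, ← mul_add, div_mul_eq_mul_div, mul_div_assoc']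
  gcongr
  exact h x y

variable {F : Type*} [NormedAddCommGroup F] [NormedSpace ℝ F]

theorem exists_norm_iteratedFDeriv_le_decay (φ : 𝓢(RN N, F)) (n : ℕ) :
    ∃ D : ℝ, 0 ≤ D ∧ ∀ x, ‖iteratedFDeriv ℝ n φ x‖ ≤ D * decay x := by
  refine ⟨2 ^ (N + 1) * ((Finset.Iic (N + 1, n)).sup fun m => SchwartzMap.seminorm ℝ m.1 m.2) φ,
    mul_nonneg (by positivity) (apply_nonneg _ _), fun x => ?_⟩
  have h := SchwartzMap.one_add_le_sup_seminorm_apply (𝕜 := ℝ) (m := (N + 1, n)) le_rfl le_rfl φ x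
  unfold decay
  rw [Real.rpow_neg (by positivity), ← div_eq_mul_inv, le_div_iff₀ (by positivity), mul_comm]
  refine le_trans (le_of_eq ?_) h
  congr 1
  rw [← Real.rpow_natCast]; simp

/-- For |y| ≥ 1 the triangle inequality suffices. For |y| ≤ 1 the mean value inequality is used on
the segment from x to x + y, along which the decay profile stays within a factor 2^(N+1) of its
value at x. The factor min(1,|y|) is the numerator of `kern` at R = 1. -/
theorem exists_norm_sub_le_decay (φ : 𝓢(RN N, F)) :
    ∃ D : ℝ, 0 ≤ D ∧ (∀ x, ‖φ x‖ ≤ D * decay x) ∧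
      ∀ x y, ‖φ x - φ (x + y)‖ ≤ D * (min 1 ‖y‖ * (decay x + decay (x + y))) := by
  obtain ⟨D₀, hD₀, h₀⟩ := exists_norm_iteratedFDeriv_le_decay φ 0
  obtain ⟨D₁, hD₁, h₁⟩ := exists_norm_iteratedFDeriv_le_decay φ 1
  simp only [norm_iteratedFDeriv_zero] at h₀
  simp only [norm_iteratedFDeriv_one] at h₁
  refine ⟨D₀ + D₁ * 2 ^ ((N : ℝ) + 1), by positivity, fun x => ?_, fun x y => ?_⟩
  · refine (h₀ x).trans ?_
    have := decay_pos x
    gcongr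
    have : 0 ≤ D₁ * 2 ^ ((N : ℝ) + 1) := by positivity
    linarith
  have dx := decay_pos x
  have dy := decay_pos (x + y)
  rcases le_total 1 ‖y‖ with hy | hy
  · rw [min_eq_left hy, one_mul]
    calc ‖φ x - φ (x + y)‖ ≤ ‖φ x‖ + ‖φ (x + y)‖ := norm_sub_le _ _
      _ ≤ D₀ * decay x + D₀ * decay (x + y) := add_le_add (h₀ _) (h₀ _)
      _ = D₀ * (decay x + decay (x + y)) := by ring
      _ ≤ _ := by
        gcongr
        have : 0 ≤ D₁ * 2 ^ ((N : ℝ) + 1) := by positivity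
        linarith
  · rw [min_eq_right hy]
    have hb : ∀ z ∈ segment ℝ x (x + y), ‖fderiv ℝ φ z‖ ≤ D₁ * (2 ^ ((N : ℝ) + 1) * decay x) := by
      intro z hz
      refine (h₁ z).trans ?_
      gcongr
      apply decay_le_of_norm_le
      obtain ⟨θ, ⟨hθ0, hθ1⟩, rfl⟩ := (segment_eq_image' ℝ x (x + y)) ▸ hz
      simp only [add_sub_cancel_left]
      have h3 : ‖x‖ ≤ ‖x + θ • y‖ + ‖θ • y‖ := by
        simpa using norm_sub_le (x + θ • y) (θ • y)
      have h4 : ‖θ • y‖ ≤ 1 := by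
        rw [norm_smul, Real.norm_of_nonneg hθ0]; nlinarith [norm_nonneg y]
      linarith
    have h5 := Convex.norm_image_sub_le_of_norm_fderiv_le (𝕜 := ℝ) (f := φ)
      (fun z _ => φ.differentiableAt) hb (convex_segment x (x + y))
      (left_mem_segment ℝ _ _) (right_mem_segment ℝ _ _)
    rw [norm_sub_rev, add_sub_cancel_left] at h5
    refine h5.trans ?_
    calc D₁ * (2 ^ ((N : ℝ) + 1) * decay x) * ‖y‖ = D₁ * 2 ^ ((N : ℝ) + 1) * (‖y‖ * decay x) := by ring
      _ ≤ _ := by gcongr <;> linarith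

theorem integrable_schwartz_sub_div [NeZero N] (hs0 : 0 < s) (hs1 : s < 1) (φ : 𝓢(RN N, F))
    (x : RN N) :
    Integrable (fun y : RN N => (‖y‖ ^ ((N : ℝ) + s))⁻¹ • (φ x - φ (x + y))) volume := by
  obtain ⟨D, hD, -, h⟩ := exists_norm_sub_le_decay φ
  refine ((integrable_kern_one (N := N) hs0 hs1).const_mul (2 * D)).mono' ?_ ?_
  · refine AEStronglyMeasurable.smul ?_ ?_
    · exact Measurable.aestronglyMeasurable (by fun_prop)
    · exact Continuous.aestronglyMeasurable (by fun_prop)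
  · refine Eventually.of_forall fun y => ?_
    rw [norm_smul, norm_inv, Real.norm_of_nonneg (by positivity), inv_mul_eq_div]
    refine (norm_sub_div_le_kern h x y).trans ?_
    have hk := kern_nonneg (s := s) one_pos y
    have h1 := mul_le_mul_of_nonneg_left (decay_le_one x) hk
    have h2 := mul_le_mul_of_nonneg_left (decay_le_one (x + y)) hk
    nlinarith

/-- For `s < 1` the symmetrised integral is an absolutely convergent one. -/
theorem fracLaplacian_eq [NeZero N] (hs0 : 0 < s) (hs1 : s < 1) (φ : 𝓢(RN N, ℝ)) (x : RN N) :
    fracLaplacian (s / 2) φ x =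
      fracConst N (s / 2) * ∫ y : RN N, (‖y‖ ^ ((N : ℝ) + s))⁻¹ * (φ x - φ (x + y)) := by
  unfold fracLaplacian
  have hi := integrable_schwartz_sub_div hs0 hs1 φ x
  simp only [smul_eq_mul] at hi
  have hi' := hi.comp_neg
  have h2 : ∫ y : RN N, (φ (x + y) + φ (x - y) - 2 * φ x) / ‖y‖ ^ ((N : ℝ) + 2 * (s / 2)) =
      -2 * ∫ y : RN N, (‖y‖ ^ ((N : ℝ) + s))⁻¹ * (φ x - φ (x + y)) := by
    -- The second difference is the sum of the first differences in the directions y and -y. Each is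
    -- integrable separately, and the reflection y ↦ -y identifies their integrals.
    calc _ = ∫ y : RN N, -((‖y‖ ^ ((N : ℝ) + s))⁻¹ * (φ x - φ (x + y)) +
            (‖-y‖ ^ ((N : ℝ) + s))⁻¹ * (φ x - φ (x + -y))) := by
          congr 1; ext y
          rw [norm_neg, ← sub_eq_add_neg, show 2 * (s / 2) = s by ring, div_eq_inv_mul]
          ring
      _ = _ := by
          rw [integral_neg, integral_add hi hi',
            integral_neg_eq_self (fun y : RN N => (‖y‖ ^ ((N : ℝ) + s))⁻¹ * (φ x - φ (x + y))) volume]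
          ring
  rw [h2]; ring

theorem measurable_fracLaplacian [NeZero N] (hs0 : 0 < s) (hs1 : s < 1) (φ : 𝓢(RN N, ℝ)) :
    StronglyMeasurable (fracLaplacian (s / 2) φ) := by
  have : fracLaplacian (s / 2) φ = fun x => fracConst N (s / 2) *
      ∫ y : RN N, (‖y‖ ^ ((N : ℝ) + s))⁻¹ * (φ x - φ (x + y)) :=
    funext fun x => fracLaplacian_eq hs0 hs1 φ x
  rw [this]
  refine StronglyMeasurable.const_mul ?_ _
  refine StronglyMeasurable.integral_prod_right (f := fun x y : RN N =>
    (‖y‖ ^ ((N : ℝ) + s))⁻¹ * (φ x - φ (x + y))) ?_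
  refine Measurable.stronglyMeasurable ?_
  have h1 : Measurable φ := φ.continuous.measurable
  have : Measurable fun p : RN N × RN N => φ p.1 - φ (p.1 + p.2) :=
    (h1.comp measurable_fst).sub (h1.comp (measurable_fst.add measurable_snd))
  exact Measurable.mul (by fun_prop) this

/-- Pointwise the function is bounded by the decay profile plus its convolution with the integrable
kernel; Young's inequality puts the latter in L^p. This lets distributions in any L^p with p > 1 be
tested against (-Δ)^(s/2)φ. -/
theorem memLp_fracLaplacian [NeZero N] (hs0 : 0 < s) (hs1 : s < 1) (φ : 𝓢(RN N, ℝ))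
    {p : ℝ≥0∞} (hp : 1 ≤ p) (hp' : p ≠ ∞) : MemLp (fracLaplacian (s / 2) φ) p volume := by
  obtain ⟨D, hD, -, h⟩ := exists_norm_sub_le_decay φ
  refine ⟨(measurable_fracLaplacian hs0 hs1 φ).aestronglyMeasurable, ?_⟩
  set d : RN N → ℝ≥0∞ := fun x => ENNReal.ofReal (decay x) with hd
  have hdm : Measurable d := measurable_decay.ennreal_ofReal
  set C := ‖fracConst N (s / 2)‖ₑ * ENNReal.ofReal D with hC
  have hCtop : C ≠ ∞ := ENNReal.mul_ne_top enorm_ne_top ENNReal.ofReal_ne_top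
  set κ := ∫⁻ y, ekern N s 1 y with hκ
  have hκtop : κ ≠ ∞ := lintegral_ekern_ne_top hs0 hs1 one_pos
  have hbound : ∀ x, ‖fracLaplacian (s / 2) φ x‖ₑ ≤
      C * (κ * d x + ∫⁻ z, ekern N s 1 (z - x) * d z) := by
    intro x
    rw [fracLaplacian_eq hs0 hs1, enorm_mul, hC, mul_assoc]
    gcongr
    refine (enorm_integral_le_lintegral_enorm _).trans ?_
    calc ∫⁻ y, ‖(‖y‖ ^ ((N : ℝ) + s))⁻¹ * (φ x - φ (x + y))‖ₑ
        ≤ ∫⁻ y, ENNReal.ofReal D * (ekern N s 1 y * d x + ekern N s 1 y * d (x + y)) := by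
          refine lintegral_mono fun y => ?_
          have hk := kern_nonneg (N := N) (s := s) one_pos y
          simp only [ekern, hd]
          rw [← ENNReal.ofReal_mul hk, ← ENNReal.ofReal_mul hk, ← ENNReal.ofReal_add
            (mul_nonneg hk (decay_pos _).le) (mul_nonneg hk (decay_pos _).le),
            ← ENNReal.ofReal_mul hD, ← ofReal_norm, norm_mul, norm_inv,
            Real.norm_of_nonneg (by positivity : 0 ≤ ‖y‖ ^ ((N : ℝ) + s)), inv_mul_eq_div]
          exact ENNReal.ofReal_le_ofReal (norm_sub_div_le_kern h x y)
      _ = _ := by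
          rw [lintegral_const_mul _ (by
            exact (measurable_ekern.mul_const _).add
              (measurable_ekern.mul (hdm.comp (measurable_const.add measurable_id)))),
            lintegral_add_left (measurable_ekern.mul_const _), lintegral_mul_const _ measurable_ekern]
          congr 2
          rw [← lintegral_add_left_eq_self (fun z => ekern N s 1 (z - x) * d z) x]
          simp
  have hmeas : Measurable fun x => ∫⁻ z, ekern N s 1 (z - x) * d z := by
    refine Measurable.lintegral_prod_right' (f := fun q : RN N × RN N =>
      ekern N s 1 (q.2 - q.1) * d q.2) ?_
    exact (measurable_ekern.comp (measurable_snd.sub measurable_fst)).mul (hdm.comp measurable_snd)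
  have hdfin : eLpNorm d p volume ≠ ∞ := by
    have : eLpNorm d p volume = eLpNorm (decay (N := N)) p volume := by
      refine eLpNorm_congr_enorm_ae (Eventually.of_forall fun x => ?_)
      simp only [hd, enorm_eq_self]
      rw [Real.enorm_of_nonneg (decay_pos x).le]
    rw [this]
    exact (memLp_decay hp hp').eLpNorm_ne_top
  calc eLpNorm (fracLaplacian (s / 2) φ) p volume
      ≤ eLpNorm (fun x => C.toNNReal * (κ * d x + ∫⁻ z, ekern N s 1 (z - x) * d z) : RN N → ℝ≥0∞) p volume := by
        refine eLpNorm_mono_enorm fun x => ?_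
        rw [ENNReal.coe_toNNReal hCtop, enorm_eq_self]
        exact hbound x
    _ < ∞ := by
        have hA : MemLp (fun x => κ * d x) p volume := by
          refine ⟨(hdm.const_mul κ).aestronglyMeasurable, ?_⟩
          refine (eLpNorm_le_mul_eLpNorm_of_ae_le_mul'' p (c := κ.toNNReal) (g := d)
            hdm.aestronglyMeasurable (Eventually.of_forall fun x => ?_)).trans_lt
            (ENNReal.mul_lt_top ENNReal.coe_lt_top hdfin.lt_top)
          simp [ENNReal.coe_toNNReal hκtop]
        have hB : MemLp (fun x => ∫⁻ z, ekern N s 1 (z - x) * d z) p volume := by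
          refine ⟨hmeas.aestronglyMeasurable, ?_⟩
          exact (eLpNorm_lintegral_sub_mul_le measurable_ekern hdm.aemeasurable hp hp' hκtop).trans_lt
            (ENNReal.mul_lt_top hκtop.lt_top hdfin.lt_top)
        have hAB := hA.add hB
        refine (eLpNorm_le_mul_eLpNorm_of_ae_le_mul'' p (c := C.toNNReal) (g := fun x => κ * d x + ∫⁻ z, ekern N s 1 (z - x) * d z)
            hAB.1 (Eventually.of_forall fun x => ?_)).trans_lt
            (ENNReal.mul_lt_top ENNReal.coe_lt_top hAB.2)
        simp

end Schwartz
end FracCC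

namespace FracCC

open scoped ENNReal NNReal

/-! ### Uniqueness and linearity of the distributional (-Δ)^(s/2) -/

section HalfLap

variable {N : ℕ} [NeZero N] {s : ℝ} {u u' w w' : RN N → ℝ} {p : ℝ≥0∞}

/-- Hölder's inequality; p > 1 keeps the conjugate exponent finite, as `memLp_fracLaplacian`
requires. -/
theorem integrable_mul_fracLaplacian (hs0 : 0 < s) (hs1 : s < 1) (hu : MemLp u p volume)
    (hp : 1 < p) (φ : 𝓢(RN N, ℝ)) :
    Integrable (fun x => u x * fracLaplacian (s / 2) φ x) volume := by
  have : Fact (1 ≤ p) := ⟨hp.le⟩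
  have hc : ENNReal.HolderConjugate p (ENNReal.conjExponent p) := .conjExponent hp.le
  have h1 : 1 ≤ ENNReal.conjExponent p := ENNReal.HolderConjugate.one_le _ p
  have h2 : ENNReal.conjExponent p ≠ ∞ := by
    rw [Ne, ENNReal.HolderConjugate.eq_top_iff_eq_one (ENNReal.conjExponent p) p]
    exact hp.ne'
  exact hu.integrable_mul (memLp_fracLaplacian hs0 hs1 φ h1 h2)

theorem IsHalfLap.integrable_mul (h : IsHalfLap s u w) (φ : 𝓢(RN N, ℝ)) :
    Integrable (fun x => w x * φ x) volume :=
  MemLp.integrable_mul h.1 (φ.memLp 2 volume)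

theorem IsHalfLap.ae_unique (h : IsHalfLap s u w) (h' : IsHalfLap s u w') : w =ᵐ[volume] w' := by
  have hm : MemLp (w - w') 2 volume := h.1.sub h'.1
  have hz : ∀ᵐ x, (w - w') x = 0 := by
    refine ae_eq_zero_of_integral_contDiff_smul_eq_zero (hm.locallyIntegrable (by norm_num)) ?_
    intro g hg hgc
    have e1 := h.2 (hgc.toSchwartzMap hg)
    have e2 := h'.2 (hgc.toSchwartzMap hg)
    have hi := integral_sub (h.integrable_mul (hgc.toSchwartzMap hg))
      (h'.integrable_mul (hgc.toSchwartzMap hg))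
    rw [← e1, ← e2, sub_self] at hi
    rw [← hi]
    congr 1; ext x
    simp only [Pi.sub_apply, smul_eq_mul, HasCompactSupport.toSchwartzMap_toFun]
    ring
  filter_upwards [hz] with x hx
  simpa [sub_eq_zero] using hx

theorem isHalfLap_halfLap (h : ∃ w, IsHalfLap s u w) : IsHalfLap s u (halfLap s u) := by
  unfold halfLap
  rw [dif_pos h]
  exact h.choose_spec

/-- Makes the choice in `halfLap` harmless: any representative may replace it under an integral. -/
theorem IsHalfLap.ae_eq (h : IsHalfLap s u w) : halfLap s u =ᵐ[volume] w :=
  (isHalfLap_halfLap ⟨w, h⟩).ae_unique h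

theorem IsHalfLap.congr_right (h : IsHalfLap s u w) (hw : w =ᵐ[volume] w') : IsHalfLap s u w' :=
  ⟨(memLp_congr_ae hw).1 h.1, fun φ => (h.2 φ).trans <|
    integral_congr_ae (hw.mono fun x hx => by simp only [hx])⟩

theorem IsHalfLap.sub (hs0 : 0 < s) (hs1 : s < 1) (hp : 1 < p) (hu : MemLp u p volume)
    (hu' : MemLp u' p volume) (h : IsHalfLap s u w) (h' : IsHalfLap s u' w') :
    IsHalfLap s (u - u') (w - w') := by
  refine ⟨h.1.sub h'.1, fun φ => ?_⟩
  simp only [Pi.sub_apply, sub_mul]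
  rw [integral_sub (integrable_mul_fracLaplacian hs0 hs1 hu hp φ)
    (integrable_mul_fracLaplacian hs0 hs1 hu' hp φ),
    integral_sub (h.integrable_mul φ) (h'.integrable_mul φ), h.2, h'.2]

theorem IsHalfLap.add (hs0 : 0 < s) (hs1 : s < 1) (hp : 1 < p) (hu : MemLp u p volume)
    (hu' : MemLp u' p volume) (h : IsHalfLap s u w) (h' : IsHalfLap s u' w') :
    IsHalfLap s (u + u') (w + w') := by
  refine ⟨h.1.add h'.1, fun φ => ?_⟩
  simp only [Pi.add_apply, add_mul]
  rw [integral_add (integrable_mul_fracLaplacian hs0 hs1 hu hp φ)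
    (integrable_mul_fracLaplacian hs0 hs1 hu' hp φ),
    integral_add (h.integrable_mul φ) (h'.integrable_mul φ), h.2, h'.2]

theorem IsHalfLap.const_smul (h : IsHalfLap s u w) (c : ℝ) :
    IsHalfLap s (c • u) (c • w) := by
  refine ⟨h.1.const_smul c, fun φ => ?_⟩
  simp only [Pi.smul_apply, smul_eq_mul, mul_assoc]
  rw [integral_const_mul, integral_const_mul, h.2]

end HalfLap

/-! ### Cutoffs and pointwise and L² bounds for the commutator integrand -/

section Commutator

variable {N : ℕ} {s : ℝ}

/-- A smooth function supported in the ball `B_R`, with oscillation controlled at scale `R`. -/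
structure IsCutoff (ψ : RN N → ℝ) (A R : ℝ) : Prop where
  contDiff : ContDiff ℝ (⊤ : ℕ∞) ψ
  pos : 0 < R
  nonneg : 0 ≤ A
  zero : ∀ x, x ∉ Metric.ball (0 : RN N) R → ψ x = 0
  lip : ∀ x z, |ψ x - ψ z| ≤ A * min 1 (‖x - z‖ / R)

namespace IsCutoff

variable {ψ : RN N → ℝ} {A R : ℝ}

theorem hasCompactSupport (h : IsCutoff ψ A R) : HasCompactSupport ψ :=
  HasCompactSupport.intro (isCompact_closedBall (0 : RN N) R) fun x hx =>
    h.zero x fun hx' => hx (Metric.ball_subset_closedBall hx')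

theorem hasTemperateGrowth (h : IsCutoff ψ A R) : ψ.HasTemperateGrowth :=
  h.hasCompactSupport.hasTemperateGrowth h.contDiff

end IsCutoff

theorem exists_isCutoff {ψ : RN N → ℝ} (h : ContDiff ℝ (⊤ : ℕ∞) ψ) (hc : HasCompactSupport ψ) :
    ∃ A R, IsCutoff ψ A R := by
  obtain ⟨R, hR, hsub⟩ := hc.isCompact.isBounded.subset_ball_lt 0 (0 : RN N)
  obtain ⟨M, hM⟩ := (hc.isCompact_range h.continuous).isBounded.exists_norm_le
  have hM' : ∀ x, |ψ x| ≤ M := fun x => hM _ ⟨x, rfl⟩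
  have hM0 : 0 ≤ M := (abs_nonneg _).trans (hM' 0)
  obtain ⟨L, hL⟩ := h.lipschitzWith_of_hasCompactSupport hc (by simp)
  -- 2M bounds the oscillation by the supremum, and L * R is the Lipschitz constant measured at
  -- scale R.
  refine ⟨2 * M + L * R, R, h, hR, by positivity, fun x hx => ?_, fun x z => ?_⟩
  · by_contra h0
    exact hx (hsub (subset_tsupport _ h0))
  · rw [mul_min_of_nonneg _ _ (by positivity), mul_one]
    refine le_min ?_ ?_
    · have := abs_sub (ψ x) (ψ z)
      have h3 : 0 ≤ (L : ℝ) * R := by positivity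
      linarith [hM' x, hM' z]
    · have := hL.dist_le_mul x z
      rw [Real.dist_eq, dist_eq_norm] at this
      refine this.trans ?_
      calc (L : ℝ) * ‖x - z‖ = L * R * (‖x - z‖ / R) := by field_simp
        _ ≤ _ := by gcongr; linarith

/-- Measuring the Lipschitz bound relative to the radius keeps A unchanged under dilation, so a
family of widening cutoffs has uniform commutator bounds. -/
theorem IsCutoff.comp_smul {ψ : RN N → ℝ} {A R : ℝ} (h : IsCutoff ψ A R) {r : ℝ} (hr : 0 < r) :
    IsCutoff (fun x => ψ (r⁻¹ • x)) A (r * R) := by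
  refine ⟨h.contDiff.comp (contDiff_const_smul _), mul_pos hr h.pos, h.nonneg, fun x hx => ?_, fun x z => ?_⟩
  · refine h.zero _ fun hx' => hx ?_
    simp only [Metric.mem_ball, dist_zero_right, norm_smul, norm_inv, Real.norm_of_nonneg hr.le] at hx' ⊢
    rwa [inv_mul_lt_iff₀ hr] at hx'
  · refine (h.lip _ _).trans (le_of_eq ?_)
    rw [← smul_sub, norm_smul, norm_inv, Real.norm_of_nonneg hr.le]
    congr 2
    have := h.pos
    field_simp

/-- The integrand of the commutator of `(-Δ)^(s/2)` with multiplication by `ψ`. -/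
noncomputable def commIntegrand (s : ℝ) (ψ u : RN N → ℝ) (x z : RN N) : ℝ :=
  (‖x - z‖ ^ ((N : ℝ) + s))⁻¹ * (ψ x - ψ z) * u x

/-- The commutator `ψ (-Δ)^(s/2) u - (-Δ)^(s/2) (ψ u)`. -/
noncomputable def commutator [NeZero N] (s : ℝ) (ψ u : RN N → ℝ) (z : RN N) : ℝ :=
  fracConst N (s / 2) * ∫ x, commIntegrand s ψ u x z

variable {ψ u : RN N → ℝ} {A R ρ : ℝ}

theorem IsCutoff.inv_mul_abs_sub_le (h : IsCutoff ψ A R) (x z : RN N) :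
    (‖x - z‖ ^ ((N : ℝ) + s))⁻¹ * |ψ x - ψ z| ≤ A * kern N s R (x - z) := by
  unfold kern
  rw [inv_mul_eq_div, mul_div_assoc']
  gcongr
  exact h.lip x z

/-- The kernel restricted to `|y| ≥ r`. -/
noncomputable def ekernTail (N : ℕ) (s R r : ℝ) : RN N → ℝ≥0∞ :=
  {y | r ≤ ‖y‖}.indicator (ekern N s R)

theorem measurable_ekernTail {r : ℝ} : Measurable (ekernTail N s R r) :=
  measurable_ekern.indicator (measurableSet_le measurable_const measurable_norm)

theorem ekernTail_le (r : ℝ) (y : RN N) : ekernTail N s R r y ≤ ekern N s R y :=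
  indicator_le_self _ _ _

/-- The integrand vanishes when x and z both lie outside B_R. If |x| ≥ ρ, then z must lie in B_R, so
|x - z| ≥ ρ - R and only the tail of the kernel acts. The factor 2 is slack. -/
theorem IsCutoff.enorm_commIntegrand_le (h : IsCutoff ψ A R) (hρ : R ≤ ρ) (x z : RN N) :
    ‖commIntegrand s ψ u x z‖ₑ ≤ ENNReal.ofReal A *
      (2 * (ekern N s R (x - z) * ‖(Metric.ball (0 : RN N) ρ).indicator u x‖ₑ) +
        (Metric.ball (0 : RN N) R).indicator (fun _ => (1 : ℝ≥0∞)) z *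
        (ekernTail N s R (ρ - R) (x - z) * ‖((Metric.ball (0 : RN N) ρ)ᶜ).indicator u x‖ₑ)) := by
  have key : ‖commIntegrand s ψ u x z‖ₑ ≤ ENNReal.ofReal A * (ekern N s R (x - z) * ‖u x‖ₑ) := by
    rw [commIntegrand, enorm_mul, ← mul_assoc, ekern, ← ENNReal.ofReal_mul h.nonneg, ← ofReal_norm,
      norm_mul, norm_inv, Real.norm_of_nonneg (by positivity), Real.norm_eq_abs]
    exact mul_le_mul' (ENNReal.ofReal_le_ofReal (h.inv_mul_abs_sub_le x z)) le_rfl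
  by_cases hx : x ∈ Metric.ball (0 : RN N) ρ
  · refine key.trans ?_
    rw [indicator_of_mem hx]
    gcongr
    refine le_add_right ?_
    rw [two_mul]
    exact le_add_right le_rfl
  · by_cases hz : z ∈ Metric.ball (0 : RN N) R
    · refine key.trans ?_
      have hmem : x - z ∈ {y : RN N | ρ - R ≤ ‖y‖} := by
        simp only [Metric.mem_ball, dist_zero_right, not_lt] at hx hz
        have := norm_sub_norm_le x z
        change ρ - R ≤ ‖x - z‖
        linarith
      rw [indicator_of_mem hz, indicator_of_mem (mem_compl hx), one_mul, ekernTail,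
        indicator_of_mem hmem]
      gcongr
      exact le_add_self
    · have hx' : x ∉ Metric.ball (0 : RN N) R := fun h' => hx (Metric.ball_subset_ball hρ h')
      simp [commIntegrand, h.zero x hx', h.zero z hz]

theorem eLpNorm_two_indicator_le {f : RN N → ℝ≥0∞} (hf : AEMeasurable f volume) {S : Set (RN N)}
    (hS : MeasurableSet S) {p : ℝ≥0∞} (hp : 2 ≤ p) :
    eLpNorm (S.indicator f) 2 volume ≤
      eLpNorm f p volume * volume S ^ (1 / (2 : ℝ) - 1 / p.toReal) := by
  rw [eLpNorm_indicator_eq_eLpNorm_restrict hS]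
  refine (eLpNorm_le_eLpNorm_mul_rpow_measure_univ hp hf.restrict.aestronglyMeasurable).trans ?_
  rw [Measure.restrict_apply_univ]
  simp only [ENNReal.toReal_ofNat]
  gcongr
  exact Measure.restrict_le_self

/-- The near part of u is treated by Young's inequality in L². The far part is only known in L^p:
Young is applied there, and Hölder on B_R brings the result back to L². -/
theorem IsCutoff.eLpNorm_lintegral_commIntegrand_le [NeZero N] (hs0 : 0 < s) (hs1 : s < 1)
    (h : IsCutoff ψ A R)
    (hρ : R ≤ ρ) (hu : AEStronglyMeasurable u volume) {p : ℝ≥0∞} (hp : 2 ≤ p) (hp' : p ≠ ∞) :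
    eLpNorm (fun z => ∫⁻ x, ‖commIntegrand s ψ u x z‖ₑ) 2 volume ≤ ENNReal.ofReal A *
      (2 * (∫⁻ y, ekern N s R y) * eLpNorm ((Metric.ball (0 : RN N) ρ).indicator u) 2 volume +
        volume (Metric.ball (0 : RN N) R) ^ (1 / (2 : ℝ) - 1 / p.toReal) *
        (∫⁻ y, ekernTail N s R (ρ - R) y) *
        eLpNorm (((Metric.ball (0 : RN N) ρ)ᶜ).indicator u) p volume) := by
  set u₁ : RN N → ℝ≥0∞ := fun x => ‖(Metric.ball (0 : RN N) ρ).indicator u x‖ₑ with hu₁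
  set u₂ : RN N → ℝ≥0∞ := fun x => ‖((Metric.ball (0 : RN N) ρ)ᶜ).indicator u x‖ₑ with hu₂
  have hm₁ : AEMeasurable u₁ volume := (hu.indicator Metric.isOpen_ball.measurableSet).enorm
  have hm₂ : AEMeasurable u₂ volume :=
    (hu.indicator Metric.isOpen_ball.measurableSet.compl).enorm
  have hκ := lintegral_ekern_ne_top (N := N) hs0 hs1 h.pos
  have hτ : ∫⁻ y, ekernTail N s R (ρ - R) y ≠ ∞ :=
    ((lintegral_mono (ekernTail_le _)).trans_lt hκ.lt_top).ne
  have hk₁ : ∀ z, AEMeasurable (fun x => ekern N s R (x - z) * u₁ x) volume := fun z =>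
    (measurable_ekern.comp (measurable_id.sub_const z)).aemeasurable.mul hm₁
  have hk₂ : ∀ z, AEMeasurable (fun x => ekernTail N s R (ρ - R) (x - z) * u₂ x) volume := fun z =>
    (measurable_ekernTail.comp (measurable_id.sub_const z)).aemeasurable.mul hm₂
  set g₁ : RN N → ℝ≥0∞ := fun z => ∫⁻ x, ekern N s R (x - z) * u₁ x with hg₁
  set g₂ : RN N → ℝ≥0∞ := fun z => ∫⁻ x, ekernTail N s R (ρ - R) (x - z) * u₂ x with hg₂
  have hgm₁ : AEMeasurable g₁ volume := by
    refine AEMeasurable.lintegral_prod_right' (f := fun q : RN N × RN N =>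
      ekern N s R (q.2 - q.1) * u₁ q.2) ?_
    exact (measurable_ekern.comp (measurable_snd.sub measurable_fst)).aemeasurable.mul hm₁.comp_snd
  have hgm₂ : AEMeasurable g₂ volume := by
    refine AEMeasurable.lintegral_prod_right' (f := fun q : RN N × RN N =>
      ekernTail N s R (ρ - R) (q.2 - q.1) * u₂ q.2) ?_
    exact (measurable_ekernTail.comp (measurable_snd.sub measurable_fst)).aemeasurable.mul
      hm₂.comp_snd
  have hpt : ∀ z, ∫⁻ x, ‖commIntegrand s ψ u x z‖ₑ ≤ ENNReal.ofReal A *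
      (g₁ + g₁ + (Metric.ball (0 : RN N) R).indicator g₂) z := by
    intro z
    refine (lintegral_mono fun x => h.enorm_commIntegrand_le hρ x z).trans ?_
    rw [lintegral_const_mul' _ _ ENNReal.ofReal_ne_top, lintegral_add_left' ((hk₁ z).const_mul 2),
      lintegral_const_mul' _ _ (by norm_num), lintegral_const_mul' _ _ (by
        by_cases hz : z ∈ Metric.ball (0 : RN N) R <;> simp [hz])]
    simp only [Pi.add_apply, two_mul]
    gcongr
    by_cases hz : z ∈ Metric.ball (0 : RN N) R <;> simp [hz, hg₂, hu₂]
  have hp1 : 1 ≤ p := le_trans (by norm_num) hp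
  have e₁ : eLpNorm u₁ 2 volume = eLpNorm ((Metric.ball (0 : RN N) ρ).indicator u) 2 volume :=
    eLpNorm_congr_enorm_ae (Eventually.of_forall fun x => by simp [hu₁])
  have e₂ : eLpNorm u₂ p volume = eLpNorm (((Metric.ball (0 : RN N) ρ)ᶜ).indicator u) p volume :=
    eLpNorm_congr_enorm_ae (Eventually.of_forall fun x => by simp [hu₂])
  have y₁ : eLpNorm g₁ 2 volume ≤ _ :=
    eLpNorm_lintegral_sub_mul_le measurable_ekern hm₁ (by norm_num) (by norm_num) hκ
  have y₂ : eLpNorm g₂ p volume ≤ _ :=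
    eLpNorm_lintegral_sub_mul_le measurable_ekernTail hm₂ hp1 hp' hτ
  have hBm : MeasurableSet (Metric.ball (0 : RN N) R) := Metric.isOpen_ball.measurableSet
  refine (eLpNorm_le_mul_eLpNorm_of_ae_le_mul'' 2 (c := ENNReal.ofReal A)
    (((hgm₁.add hgm₁).add (hgm₂.indicator hBm)).aestronglyMeasurable)
    (Eventually.of_forall fun z => by simpa only [enorm_eq_self] using hpt z)).trans ?_
  gcongr
  refine (eLpNorm_add_le (hgm₁.add hgm₁).aestronglyMeasurable
    (hgm₂.indicator hBm).aestronglyMeasurable (by norm_num)).trans ?_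
  refine add_le_add ?_ ?_
  · refine (eLpNorm_add_le hgm₁.aestronglyMeasurable hgm₁.aestronglyMeasurable (by norm_num)).trans ?_
    rw [← two_mul, mul_assoc, ← e₁]
    gcongr
  · refine (eLpNorm_two_indicator_le hgm₂ hBm hp).trans ?_
    rw [mul_comm, mul_assoc, ← e₂]
    gcongr

end Commutator
end FracCC

namespace FracCC

open scoped ENNReal NNReal

/-! ### L² bounds for the commutator and the Leibniz rule -/

section Commutator

variable {N : ℕ} [NeZero N] {s : ℝ} {ψ u w : RN N → ℝ} {A R ρ : ℝ} {p : ℝ≥0∞}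

theorem aestronglyMeasurable_commIntegrand (h : IsCutoff ψ A R)
    (hu : AEStronglyMeasurable u volume) :
    AEStronglyMeasurable (fun q : RN N × RN N => commIntegrand s ψ u q.1 q.2)
      (volume.prod volume) := by
  have hψ : Measurable ψ := h.contDiff.continuous.measurable
  unfold commIntegrand
  refine AEStronglyMeasurable.mul ?_ hu.comp_fst
  refine Measurable.aestronglyMeasurable ?_
  exact Measurable.mul (by fun_prop) ((hψ.comp measurable_fst).sub (hψ.comp measurable_snd))

theorem aestronglyMeasurable_commutator (h : IsCutoff ψ A R)
    (hu : AEStronglyMeasurable u volume) : AEStronglyMeasurable (commutator s ψ u) volume := by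
  have h1 := (aestronglyMeasurable_commIntegrand (s := s) h hu).prod_swap
  exact (AEStronglyMeasurable.integral_prod_right' (f := fun q : RN N × RN N =>
    commIntegrand s ψ u q.2 q.1) h1).const_mul _

theorem enorm_commutator_le (z : RN N) : ‖commutator s ψ u z‖ₑ ≤
    ‖fracConst N (s / 2)‖ₑ * ∫⁻ x, ‖commIntegrand s ψ u x z‖ₑ := by
  rw [commutator, enorm_mul]
  gcongr
  exact enorm_integral_le_lintegral_enorm _

theorem aemeasurable_lintegral_commIntegrand (h : IsCutoff ψ A R)
    (hu : AEStronglyMeasurable u volume) :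
    AEMeasurable (fun z => ∫⁻ x, ‖commIntegrand s ψ u x z‖ₑ) volume :=
  AEMeasurable.lintegral_prod_right' (f := fun q : RN N × RN N => ‖commIntegrand s ψ u q.2 q.1‖ₑ)
    (aestronglyMeasurable_commIntegrand (s := s) h hu).prod_swap.enorm

theorem IsCutoff.eLpNorm_commutator_le (hs0 : 0 < s) (hs1 : s < 1) (h : IsCutoff ψ A R)
    (hρ : R ≤ ρ) (hu : AEStronglyMeasurable u volume) (hp : 2 ≤ p) (hp' : p ≠ ∞) :
    eLpNorm (commutator s ψ u) 2 volume ≤ ‖fracConst N (s / 2)‖ₑ * (ENNReal.ofReal A *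
      (2 * (∫⁻ y, ekern N s R y) * eLpNorm ((Metric.ball (0 : RN N) ρ).indicator u) 2 volume +
        volume (Metric.ball (0 : RN N) R) ^ (1 / (2 : ℝ) - 1 / p.toReal) *
        (∫⁻ y, ekernTail N s R (ρ - R) y) *
        eLpNorm (((Metric.ball (0 : RN N) ρ)ᶜ).indicator u) p volume)) := by
  refine (eLpNorm_le_mul_eLpNorm_of_ae_le_mul'' 2 (c := ‖fracConst N (s / 2)‖ₑ)
    (g := fun z => ∫⁻ x, ‖commIntegrand s ψ u x z‖ₑ)
    (aemeasurable_lintegral_commIntegrand h hu).aestronglyMeasurable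
    (Eventually.of_forall fun z => by simpa only [enorm_eq_self] using enorm_commutator_le z)).trans ?_
  gcongr
  exact h.eLpNorm_lintegral_commIntegrand_le hs0 hs1 hρ hu hp hp'

theorem eLpNorm_ball_indicator_le (hu : AEStronglyMeasurable u volume) (hp : 2 ≤ p) (ρ : ℝ) :
    eLpNorm ((Metric.ball (0 : RN N) ρ).indicator u) 2 volume ≤
      eLpNorm u p volume * volume (Metric.ball (0 : RN N) ρ) ^ (1 / (2 : ℝ) - 1 / p.toReal) := by
  have := eLpNorm_two_indicator_le hu.enorm (S := Metric.ball (0 : RN N) ρ)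
    Metric.isOpen_ball.measurableSet hp
  have e1 : eLpNorm (fun x => ‖u x‖ₑ) p volume = eLpNorm u p volume :=
    eLpNorm_congr_enorm_ae (Eventually.of_forall fun x => by simp)
  have e2 : eLpNorm ((Metric.ball (0 : RN N) ρ).indicator (fun x => ‖u x‖ₑ)) 2 volume =
      eLpNorm ((Metric.ball (0 : RN N) ρ).indicator u) 2 volume :=
    eLpNorm_congr_enorm_ae (Eventually.of_forall fun x => by simp [enorm_indicator_eq_indicator_enorm])
  rwa [e1, e2] at this

theorem inv_exponent_sub_nonneg (hp : 2 ≤ p) (hp' : p ≠ ∞) : 0 ≤ 1 / (2 : ℝ) - 1 / p.toReal := by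
  have : 2 ≤ p.toReal := by
    simpa using (ENNReal.toReal_le_toReal (by norm_num) hp').2 hp
  rw [sub_nonneg]
  exact one_div_le_one_div_of_le (by norm_num) this

theorem volume_ball_rpow_ne_top (hp : 2 ≤ p) (hp' : p ≠ ∞) (r : ℝ) :
    volume (Metric.ball (0 : RN N) r) ^ (1 / (2 : ℝ) - 1 / p.toReal) ≠ ∞ :=
  ENNReal.rpow_ne_top_of_nonneg (inv_exponent_sub_nonneg hp hp') measure_ball_lt_top.ne

theorem lintegral_ekernTail_ne_top (hs0 : 0 < s) (hs1 : s < 1) (hR : 0 < R) (r : ℝ) :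
    ∫⁻ y, ekernTail N s R r y ≠ ∞ :=
  ((lintegral_mono (ekernTail_le _)).trans_lt (lintegral_ekern_ne_top hs0 hs1 hR).lt_top).ne

/-- The `L²` norm of the commutator is bounded by the `L^p` norm. -/
theorem IsCutoff.exists_eLpNorm_lintegral_commIntegrand_le (hs0 : 0 < s) (hs1 : s < 1)
    (h : IsCutoff ψ A R) (hp : 2 ≤ p) (hp' : p ≠ ∞) :
    ∃ C : ℝ≥0∞, C ≠ ∞ ∧ ∀ u : RN N → ℝ, AEStronglyMeasurable u volume →
      eLpNorm (fun z => ∫⁻ x, ‖commIntegrand s ψ u x z‖ₑ) 2 volume ≤ C * eLpNorm u p volume := by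
  set V := volume (Metric.ball (0 : RN N) R) ^ (1 / (2 : ℝ) - 1 / p.toReal)
  have hV : V ≠ ∞ := volume_ball_rpow_ne_top hp hp' R
  refine ⟨ENNReal.ofReal A * (2 * (∫⁻ y, ekern N s R y) * V + V * (∫⁻ y, ekernTail N s R (R - R) y)),
    ?_, fun u hu => ?_⟩
  · have h1 := lintegral_ekern_ne_top (N := N) hs0 hs1 h.pos
    have h2 := lintegral_ekernTail_ne_top (N := N) hs0 hs1 h.pos (R - R)
    finiteness
  · refine (h.eLpNorm_lintegral_commIntegrand_le hs0 hs1 le_rfl hu hp hp').trans ?_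
    rw [mul_assoc (ENNReal.ofReal A), add_mul]
    refine mul_le_mul' le_rfl (add_le_add ?_ ?_)
    · rw [mul_assoc _ V, mul_comm V]
      exact mul_le_mul' le_rfl (eLpNorm_ball_indicator_le hu hp R)
    · exact mul_le_mul' le_rfl (eLpNorm_indicator_le u)

theorem IsCutoff.exists_eLpNorm_commutator_le (hs0 : 0 < s) (hs1 : s < 1)
    (h : IsCutoff ψ A R) (hp : 2 ≤ p) (hp' : p ≠ ∞) :
    ∃ C : ℝ≥0∞, C ≠ ∞ ∧ ∀ u : RN N → ℝ, AEStronglyMeasurable u volume →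
      eLpNorm (commutator s ψ u) 2 volume ≤ C * eLpNorm u p volume := by
  obtain ⟨C, hC, hb⟩ := h.exists_eLpNorm_lintegral_commIntegrand_le hs0 hs1 hp hp'
  refine ⟨‖fracConst N (s / 2)‖ₑ * C, ENNReal.mul_ne_top enorm_ne_top hC, fun u hu => ?_⟩
  refine (eLpNorm_le_mul_eLpNorm_of_ae_le_mul'' 2 (c := ‖fracConst N (s / 2)‖ₑ)
    (g := fun z => ∫⁻ x, ‖commIntegrand s ψ u x z‖ₑ)
    (aemeasurable_lintegral_commIntegrand h hu).aestronglyMeasurable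
    (Eventually.of_forall fun z => by simpa only [enorm_eq_self] using enorm_commutator_le z)).trans ?_
  rw [mul_assoc]
  gcongr
  exact hb u hu

theorem IsCutoff.memLp_commutator (hs0 : 0 < s) (hs1 : s < 1) (h : IsCutoff ψ A R)
    (hp : 2 ≤ p) (hp' : p ≠ ∞) (hu : MemLp u p volume) : MemLp (commutator s ψ u) 2 volume := by
  obtain ⟨C, hC, hb⟩ := h.exists_eLpNorm_commutator_le hs0 hs1 hp hp'
  exact ⟨aestronglyMeasurable_commutator h hu.1,
    (hb u hu.1).trans_lt (ENNReal.mul_lt_top hC.lt_top hu.2)⟩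

/-- Cauchy-Schwarz in z against the L² bound of the inner integral. This justifies Fubini in the
Leibniz rule. -/
theorem IsCutoff.integrable_commIntegrand_mul (hs0 : 0 < s) (hs1 : s < 1) (h : IsCutoff ψ A R)
    (hp : 2 ≤ p) (hp' : p ≠ ∞) (hu : MemLp u p volume) (φ : 𝓢(RN N, ℝ)) :
    Integrable (fun q : RN N × RN N => commIntegrand s ψ u q.1 q.2 * φ q.2)
      (volume.prod volume) := by
  have hm : AEStronglyMeasurable (fun q : RN N × RN N => commIntegrand s ψ u q.1 q.2 * φ q.2)
      (volume.prod volume) :=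
    (aestronglyMeasurable_commIntegrand h hu.1).mul
      (φ.continuous.aestronglyMeasurable (μ := volume)).comp_snd
  obtain ⟨C, hC, hb⟩ := h.exists_eLpNorm_lintegral_commIntegrand_le hs0 hs1 hp hp'
  refine ⟨hm, ?_⟩
  rw [hasFiniteIntegral_iff_enorm, lintegral_prod_symm _ hm.enorm]
  simp only [enorm_mul]
  have h1 : ∀ z, ∫⁻ x, ‖commIntegrand s ψ u x z‖ₑ * ‖φ z‖ₑ =
      (∫⁻ x, ‖commIntegrand s ψ u x z‖ₑ) * ‖φ z‖ₑ := fun z => lintegral_mul_const' _ _ enorm_ne_top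
  simp only [h1]
  have hmm := aemeasurable_lintegral_commIntegrand (s := s) h hu.1
  have hH := ENNReal.lintegral_mul_le_Lp_mul_Lq volume Real.HolderConjugate.two_two
    hmm (φ.continuous.aestronglyMeasurable (μ := volume)).enorm
  simp only [Pi.mul_apply] at hH
  refine hH.trans_lt (ENNReal.mul_lt_top ?_ ?_)
  · have := (hb u hu.1).trans_lt (ENNReal.mul_lt_top hC.lt_top hu.2)
    rw [eLpNorm_eq_lintegral_rpow_enorm_toReal (by norm_num) (by norm_num)] at this
    simpa using this
  · have := (φ.memLp 2 volume).2
    rw [eLpNorm_eq_lintegral_rpow_enorm_toReal (by norm_num) (by norm_num)] at this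
    simpa using this

/-- Product of a Schwartz function with a cutoff. -/
noncomputable def cutoffMul (ψ : RN N → ℝ) (φ : 𝓢(RN N, ℝ)) : 𝓢(RN N, ℝ) :=
  SchwartzMap.smulLeftCLM ℝ ψ φ

theorem IsCutoff.cutoffMul_apply (h : IsCutoff ψ A R) (φ : 𝓢(RN N, ℝ)) (x : RN N) :
    cutoffMul ψ φ x = ψ x * φ x := by
  rw [cutoffMul, SchwartzMap.smulLeftCLM_apply_apply h.hasTemperateGrowth, smul_eq_mul]

/-- Integrate ψ(x)φ(x) - ψ(z)φ(z) = ψ(x)(φ(x) - φ(z)) + (ψ(x) - ψ(z))φ(z) against the kernel. -/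
theorem IsCutoff.fracLaplacian_cutoffMul (hs0 : 0 < s) (hs1 : s < 1) (h : IsCutoff ψ A R)
    (φ : 𝓢(RN N, ℝ)) (x : RN N) :
    fracLaplacian (s / 2) (cutoffMul ψ φ) x = ψ x * fracLaplacian (s / 2) φ x +
      fracConst N (s / 2) * ∫ z, (‖x - z‖ ^ ((N : ℝ) + s))⁻¹ * (ψ x - ψ z) * φ z := by
  rw [fracLaplacian_eq hs0 hs1, fracLaplacian_eq hs0 hs1]
  have hi := integrable_schwartz_sub_div hs0 hs1 φ x
  have hi' := integrable_schwartz_sub_div hs0 hs1 (cutoffMul ψ φ) x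
  simp only [smul_eq_mul] at hi hi'
  have e : ∫ z, (‖x - z‖ ^ ((N : ℝ) + s))⁻¹ * (ψ x - ψ z) * φ z =
      ∫ y : RN N, ((‖y‖ ^ ((N : ℝ) + s))⁻¹ * (cutoffMul ψ φ x - cutoffMul ψ φ (x + y)) -
        ψ x * ((‖y‖ ^ ((N : ℝ) + s))⁻¹ * (φ x - φ (x + y)))) := by
    rw [← integral_add_left_eq_self (fun z => (‖x - z‖ ^ ((N : ℝ) + s))⁻¹ * (ψ x - ψ z) * φ z) x]
    congr 1; ext y
    rw [h.cutoffMul_apply, h.cutoffMul_apply, sub_add_cancel_left, norm_neg]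
    ring
  rw [e, integral_sub hi' (hi.const_mul _), integral_const_mul]
  ring

/-- Leibniz rule with commutator: `(-Δ)^(s/2) (ψ u) = ψ (-Δ)^(s/2) u - [ψ, (-Δ)^(s/2)] u`. -/
theorem IsHalfLap.cutoff_mul (hs0 : 0 < s) (hs1 : s < 1) (h : IsCutoff ψ A R)
    (hp : 2 ≤ p) (hp' : p ≠ ∞) (hu : MemLp u p volume) (hw : IsHalfLap s u w) :
    IsHalfLap s (fun x => ψ x * u x) (fun x => ψ x * w x - commutator s ψ u x) := by
  have hp1 : 1 < p := lt_of_lt_of_le (by norm_num) hp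
  have hcont := h.contDiff.continuous
  have hψw : MemLp (fun x => ψ x * w x) 2 volume := by
    obtain ⟨M, hM⟩ := (h.hasCompactSupport.isCompact_range hcont).isBounded.exists_norm_le
    refine hw.1.of_le_mul (c := M) (hcont.aestronglyMeasurable.mul hw.1.1)
      (Eventually.of_forall fun x => ?_)
    rw [norm_mul]
    gcongr
    exact hM (ψ x) ⟨x, rfl⟩
  have hcm := h.memLp_commutator hs0 hs1 hp hp' hu
  refine ⟨hψw.sub hcm, fun φ => ?_⟩
  have hI := h.integrable_commIntegrand_mul hs0 hs1 hp hp' hu φ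
  have e1 : ∀ x, u x * (fracConst N (s / 2) *
      ∫ z, (‖x - z‖ ^ ((N : ℝ) + s))⁻¹ * (ψ x - ψ z) * φ z) =
      fracConst N (s / 2) * ∫ z, commIntegrand s ψ u x z * φ z := by
    intro x
    rw [mul_left_comm, ← integral_const_mul]
    congr 2; ext z; unfold commIntegrand; ring
  have e2 : ∀ x, ψ x * u x * fracLaplacian (s / 2) φ x =
      u x * fracLaplacian (s / 2) (cutoffMul ψ φ) x -
        fracConst N (s / 2) * ∫ z, commIntegrand s ψ u x z * φ z := by
    intro x
    rw [h.fracLaplacian_cutoffMul hs0 hs1, ← e1]; ring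
  simp only [e2]
  -- The distributional identity for u is used with the test function ψφ. Fubini turns the remaining
  -- double integral into the commutator of u paired with φ.
  rw [integral_sub (integrable_mul_fracLaplacian hs0 hs1 hu hp1 _)
    (hI.integral_prod_left.const_mul _), hw.2, integral_const_mul,
    integral_integral_swap hI, ← integral_const_mul]
  have e3 : ∀ z, fracConst N (s / 2) * ∫ x, commIntegrand s ψ u x z * φ z =
      commutator s ψ u z * φ z := by
    intro z
    rw [integral_mul_const, commutator]; ring
  simp only [e3, h.cutoffMul_apply]
  have i1 : Integrable (fun x => w x * (ψ x * φ x)) volume := by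
    simpa only [h.cutoffMul_apply] using hw.integrable_mul (cutoffMul ψ φ)
  have i2 : Integrable (fun x => commutator s ψ u x * φ x) volume :=
    hcm.integrable_mul (φ.memLp 2 volume)
  rw [← integral_sub i1 i2]
  congr 1; ext x; ring

end Commutator
end FracCC

namespace FracCC

open scoped ENNReal NNReal FourierTransform

/-! ### The Fourier transform on L² -/

section FourierLTwo

variable {V : Type*} [NormedAddCommGroup V] [InnerProductSpace ℝ V] [FiniteDimensional ℝ V]
  [MeasurableSpace V] [BorelSpace V]

/-- The transform on L² agrees with the one on tempered distributions, which is defined by this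
duality. -/
theorem integral_schwartz_mul_fourier (Φ : 𝓢(V, ℂ)) (f : Lp ℂ 2 (volume : Measure V)) :
    ∫ x, Φ x * (𝓕 f : Lp ℂ 2 (volume : Measure V)) x = ∫ x, (𝓕 Φ) x * f x := by
  have h := DFunLike.congr_fun (Lp.fourier_toTemperedDistribution_eq f) Φ
  rw [TemperedDistribution.fourier_apply, Lp.toTemperedDistribution_apply,
    Lp.toTemperedDistribution_apply] at h
  simpa using h.symm

theorem integral_schwartz_mul_fourierInv (Φ : 𝓢(V, ℂ)) (f : Lp ℂ 2 (volume : Measure V)) :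
    ∫ x, Φ x * (𝓕⁻ f : Lp ℂ 2 (volume : Measure V)) x = ∫ x, (𝓕⁻ Φ) x * f x := by
  have h := DFunLike.congr_fun (Lp.fourierInv_toTemperedDistribution_eq f) Φ
  rw [TemperedDistribution.fourierInv_apply, Lp.toTemperedDistribution_apply,
    Lp.toTemperedDistribution_apply] at h
  simpa using h.symm

theorem integral_fourier_mul_eq_of_integrable {f g : V → ℂ} (hf : Integrable f volume)
    (hg : Integrable g volume) : ∫ x, 𝓕 f x * g x = ∫ x, f x * 𝓕 g x := by
  simpa using! VectorFourier.integral_bilin_fourierIntegral_eq_flip (.mul ℂ ℂ) (L := innerₗ V)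
    Real.continuous_fourierChar continuous_inner hf hg

theorem integral_fourierInv_mul_eq_of_integrable {f g : V → ℂ} (hf : Integrable f volume)
    (hg : Integrable g volume) : ∫ x, 𝓕⁻ f x * g x = ∫ x, f x * 𝓕⁻ g x := by
  have h := integral_fourier_mul_eq_of_integrable hf hg.comp_neg
  rw [← integral_neg_eq_self] at h
  simp only [neg_neg] at h
  simp only [Real.fourierInv_eq_fourier_neg]
  rw [h]
  congr 1; ext x
  rw [← Real.fourierInv_eq_fourier_neg, Real.fourierInv_eq_fourier_comp_neg]

theorem continuous_fourier {f : V → ℂ} (hf : Integrable f volume) : Continuous (𝓕 f) :=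
  VectorFourier.fourierIntegral_continuous Real.continuous_fourierChar
    (by exact continuous_inner) hf

theorem continuous_fourierInv {f : V → ℂ} (hf : Integrable f volume) : Continuous (𝓕⁻ f) := by
  have : (𝓕⁻ f : V → ℂ) = fun x => 𝓕 f (-x) := funext fun x => Real.fourierInv_eq_fourier_neg f x
  rw [this]
  exact (continuous_fourier hf).comp continuous_neg

/-- Complexification of a smooth real function with compact support, as a Schwartz function. -/
noncomputable def complexSchwartz {g : V → ℝ} (hgc : HasCompactSupport g)
    (hg : ContDiff ℝ (⊤ : ℕ∞) g) : 𝓢(V, ℂ) :=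
  SchwartzMap.postcompCLM (𝕜 := ℝ) Complex.ofRealCLM (hgc.toSchwartzMap hg)

theorem complexSchwartz_apply {g : V → ℝ} (hgc : HasCompactSupport g)
    (hg : ContDiff ℝ (⊤ : ℕ∞) g) (x : V) : complexSchwartz hgc hg x = g x := rfl

theorem ae_eq_of_integral_complexSchwartz {f g : V → ℂ} (hf : LocallyIntegrable f volume)
    (hg : LocallyIntegrable g volume)
    (h : ∀ (θ : V → ℝ) (hθc : HasCompactSupport θ) (hθ : ContDiff ℝ (⊤ : ℕ∞) θ),
      ∫ x, complexSchwartz hθc hθ x * f x = ∫ x, complexSchwartz hθc hθ x * g x) :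
    f =ᵐ[volume] g := by
  refine ae_eq_of_integral_contDiff_smul_eq hf hg fun θ hθ hθc => ?_
  simpa [complexSchwartz_apply] using h θ hθc hθ

/-- On L¹ ∩ L² the Plancherel and the integral transform define the same distribution: tested
against a smooth compactly supported function, both hand the transform over to it. -/
theorem fourier_toLp_ae_eq {f : V → ℂ} (hf : MemLp f 2 volume) (hf1 : Integrable f volume) :
    (𝓕 (hf.toLp f) : Lp ℂ 2 (volume : Measure V)) =ᵐ[volume] 𝓕 f := by
  refine ae_eq_of_integral_complexSchwartz ((Lp.memLp _).locallyIntegrable (by norm_num))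
    (continuous_fourier hf1).locallyIntegrable fun θ hθc hθ => ?_
  rw [integral_schwartz_mul_fourier]
  have h2 := integral_fourier_mul_eq_of_integrable (complexSchwartz hθc hθ).integrable hf1
  rw [← h2]
  refine integral_congr_ae ?_
  filter_upwards [hf.coeFn_toLp] with x hx
  rw [hx]; rfl

theorem fourierInv_toLp_ae_eq {f : V → ℂ} (hf : MemLp f 2 volume) (hf1 : Integrable f volume) :
    (𝓕⁻ (hf.toLp f) : Lp ℂ 2 (volume : Measure V)) =ᵐ[volume] 𝓕⁻ f := by
  refine ae_eq_of_integral_complexSchwartz ((Lp.memLp _).locallyIntegrable (by norm_num))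
    (continuous_fourierInv hf1).locallyIntegrable fun θ hθc hθ => ?_
  rw [integral_schwartz_mul_fourierInv]
  have h2 := integral_fourierInv_mul_eq_of_integrable (complexSchwartz hθc hθ).integrable hf1
  rw [← h2]
  refine integral_congr_ae ?_
  filter_upwards [hf.coeFn_toLp] with x hx
  rw [hx, SchwartzMap.fourierInv_coe]

/-- The multiplication formula on `L²`. -/
theorem integral_fourier_mul_eq (f g : Lp ℂ 2 (volume : Measure V)) :
    ∫ x, (𝓕 g : Lp ℂ 2 (volume : Measure V)) x * f x =
      ∫ x, g x * (𝓕 f : Lp ℂ 2 (volume : Measure V)) x := by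
  let B := (ContinuousLinearMap.mul ℂ ℂ).lpPairing (volume : Measure V) 2 2
  have hB : ∀ a b : Lp ℂ 2 (volume : Measure V), B a b = ∫ x, a x * b x := fun a b => by
    simp [B, ContinuousLinearMap.lpPairing_eq_integral]
  rw [← hB, ← hB]
  -- Both sides are continuous in g, so it is enough to treat Schwartz functions, which are dense in
  -- L².
  refine DenseRange.induction_on (p := fun g => B (𝓕 g) f = B g (𝓕 f))
    (SchwartzMap.denseRange_toLpCLM (p := 2) ENNReal.ofNat_ne_top) g ?_ ?_
  · refine isClosed_eq ?_ ?_
    · exact (B.flip f).continuous.comp (Lp.fourierTransformₗᵢ V ℂ).continuous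
    · exact (B.flip (𝓕 f)).continuous
  · intro Φ
    simp only [SchwartzMap.toLpCLM_apply]
    rw [SchwartzMap.toLp_fourier_eq, hB, hB]
    have e1 : ∫ x, (𝓕 Φ).toLp 2 volume x * f x = ∫ x, (𝓕 Φ) x * f x :=
      integral_congr_ae (by filter_upwards [(𝓕 Φ).coeFn_toLp 2 volume] with x hx; rw [hx])
    have e2 : ∫ x, Φ.toLp 2 volume x * (𝓕 f : Lp ℂ 2 (volume : Measure V)) x =
        ∫ x, Φ x * (𝓕 f : Lp ℂ 2 (volume : Measure V)) x :=
      integral_congr_ae (by filter_upwards [Φ.coeFn_toLp 2 volume] with x hx; rw [hx])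
    rw [e1, e2, integral_schwartz_mul_fourier]

theorem lintegral_enorm_sq_fourier (f : Lp ℂ 2 (volume : Measure V)) :
    eLpNorm (𝓕 f : Lp ℂ 2 (volume : Measure V)) 2 volume = eLpNorm f 2 volume := by
  have h := Lp.norm_fourier_eq f
  rw [Lp.norm_def, Lp.norm_def] at h
  exact (ENNReal.toReal_eq_toReal_iff' (Lp.eLpNorm_ne_top _) (Lp.eLpNorm_ne_top _)).1 h

end FourierLTwo
end FracCC

namespace FracCC

open scoped ENNReal NNReal FourierTransform

/-! ### The Fourier symbol of (-Δ)^(s/2) -/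

section Symbol

variable {N : ℕ} [NeZero N] {s : ℝ}

theorem one_sub_cos_nonneg (t : ℝ) : 0 ≤ 1 - Real.cos t := by linarith [Real.cos_le_one t]

theorem norm_one_sub_exp_le (t : ℝ) : ‖1 - Complex.exp (t * Complex.I)‖ ≤ 2 * min 1 |t| := by
  rw [mul_min_of_nonneg _ _ (by norm_num), mul_one]
  refine le_min ?_ ?_
  · refine (norm_sub_le _ _).trans ?_
    rw [Complex.norm_exp_ofReal_mul_I]; norm_num
  · rw [norm_sub_rev, mul_comm (t : ℂ)]
    refine (Real.norm_exp_I_mul_ofReal_sub_one_le).trans ?_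
    rw [Real.norm_eq_abs]
    linarith [abs_nonneg t]

theorem norm_one_sub_exp_inner_le (y η : RN N) :
    ‖1 - Complex.exp ((inner ℝ y η : ℝ) * Complex.I)‖ ≤ 2 * (1 + ‖η‖) * min 1 ‖y‖ := by
  refine (norm_one_sub_exp_le _).trans ?_
  rw [mul_assoc]
  refine mul_le_mul_of_nonneg_left ?_ (by norm_num)
  rw [mul_min_of_nonneg _ _ (by positivity), mul_one]
  refine min_le_min (by linarith [norm_nonneg η]) ?_
  refine (abs_real_inner_le_norm y η).trans ?_
  nlinarith [norm_nonneg y, norm_nonneg η]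

theorem integrable_one_sub_exp (hs0 : 0 < s) (hs1 : s < 1) (η : RN N) :
    Integrable (fun y : RN N => (‖y‖ ^ ((N : ℝ) + s))⁻¹ •
      (1 - Complex.exp ((inner ℝ y η : ℝ) * Complex.I))) volume := by
  refine ((integrable_kern_one (N := N) hs0 hs1).const_mul (2 * (1 + ‖η‖))).mono' ?_ ?_
  · have h1 : Measurable fun y : RN N => (‖y‖ ^ ((N : ℝ) + s))⁻¹ := by fun_prop
    have h2 : Continuous fun y : RN N => 1 - Complex.exp ((inner ℝ y η : ℝ) * Complex.I) := by
      fun_prop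
    exact (h1.smul h2.measurable).aestronglyMeasurable
  · refine Eventually.of_forall fun y => ?_
    rw [norm_smul, norm_inv, Real.norm_of_nonneg (by positivity), inv_mul_eq_div]
    unfold kern
    rw [mul_div_assoc', div_one]
    gcongr
    exact norm_one_sub_exp_inner_le y η

/-- The imaginary part is odd in y and cancels against its reflection. -/
theorem integral_one_sub_exp_eq_cos (hs0 : 0 < s) (hs1 : s < 1) (η : RN N) :
    ∫ y : RN N, (‖y‖ ^ ((N : ℝ) + s))⁻¹ • (1 - Complex.exp ((inner ℝ y η : ℝ) * Complex.I)) =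
      ((∫ y : RN N, (1 - Real.cos (inner ℝ y η)) / ‖y‖ ^ ((N : ℝ) + s) : ℝ) : ℂ) := by
  have hi := integrable_one_sub_exp hs0 hs1 η
  have hi' := hi.comp_neg
  have e : ∫ y : RN N, (‖y‖ ^ ((N : ℝ) + s))⁻¹ • (1 - Complex.exp ((inner ℝ y η : ℝ) * Complex.I)) =
      ∫ y : RN N, (‖-y‖ ^ ((N : ℝ) + s))⁻¹ • (1 - Complex.exp ((inner ℝ (-y) η : ℝ) * Complex.I)) :=
    (integral_neg_eq_self (fun y : RN N => (‖y‖ ^ ((N : ℝ) + s))⁻¹ •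
      (1 - Complex.exp ((inner ℝ y η : ℝ) * Complex.I))) volume).symm
  have h2 : (2 : ℂ) * ∫ y : RN N, (‖y‖ ^ ((N : ℝ) + s))⁻¹ •
      (1 - Complex.exp ((inner ℝ y η : ℝ) * Complex.I)) =
      2 * ((∫ y : RN N, (1 - Real.cos (inner ℝ y η)) / ‖y‖ ^ ((N : ℝ) + s) : ℝ) : ℂ) := by
    rw [two_mul]
    nth_rewrite 2 [e]
    rw [← integral_add hi hi', ← integral_complex_ofReal, ← integral_const_mul]
    congr 1; ext y
    rw [norm_neg, inner_neg_left, ← smul_add]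
    push_cast
    rw [Complex.real_smul, Complex.cos]
    push_cast
    rw [div_eq_inv_mul]
    ring_nf
  exact mul_left_cancel₀ two_ne_zero h2

theorem integral_one_sub_cos_scale {c : ℝ} (hc : 0 < c) (η : RN N) :
    ∫ y : RN N, (1 - Real.cos (inner ℝ y (c • η))) / ‖y‖ ^ ((N : ℝ) + s) =
      c ^ s * ∫ y : RN N, (1 - Real.cos (inner ℝ y η)) / ‖y‖ ^ ((N : ℝ) + s) := by
  have h := Measure.integral_comp_smul (volume : Measure (RN N))
    (fun y : RN N => (1 - Real.cos (inner ℝ y η)) / ‖y‖ ^ ((N : ℝ) + s)) c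
  simp only [finrank_euclideanSpace, Fintype.card_fin, smul_eq_mul] at h
  rw [abs_of_pos (by positivity)] at h
  have hcN : (c : ℝ) ^ N ≠ 0 := by positivity
  have e : ∀ y : RN N, (1 - Real.cos (inner ℝ y (c • η))) / ‖y‖ ^ ((N : ℝ) + s) =
      c ^ ((N : ℝ) + s) * ((1 - Real.cos (inner ℝ (c • y) η)) / ‖c • y‖ ^ ((N : ℝ) + s)) := by
    intro y
    rw [norm_smul, Real.norm_of_nonneg hc.le, Real.mul_rpow hc.le (norm_nonneg _),
      real_inner_smul_left, real_inner_smul_right]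
    have := (Real.rpow_pos_of_pos hc ((N : ℝ) + s)).ne'
    by_cases hy : ‖y‖ ^ ((N : ℝ) + s) = 0
    · simp [hy]
    · field_simp
  simp only [e]
  rw [integral_const_mul, h, ← mul_assoc, Real.rpow_add hc, Real.rpow_natCast]
  field_simp

/-- The reflection in the hyperplane orthogonal to η - η' exchanges the two vectors and preserves
Lebesgue measure. -/
theorem integral_one_sub_cos_isometry {η η' : RN N} (h : ‖η‖ = ‖η'‖) :
    ∫ y : RN N, (1 - Real.cos (inner ℝ y η)) / ‖y‖ ^ ((N : ℝ) + s) =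
      ∫ y : RN N, (1 - Real.cos (inner ℝ y η')) / ‖y‖ ^ ((N : ℝ) + s) := by
  set T : RN N ≃ₗᵢ[ℝ] RN N := Submodule.reflection (Submodule.span ℝ {η - η'})ᗮ with hT
  have hTη : T η = η' := Submodule.reflection_sub h
  have hmp : MeasurePreserving T volume volume := T.measurePreserving
  rw [← hmp.integral_comp T.toHomeomorph.measurableEmbedding
    (fun y : RN N => (1 - Real.cos (inner ℝ y η')) / ‖y‖ ^ ((N : ℝ) + s))]
  congr 1; ext y
  rw [← hTη, T.inner_map_map, T.norm_map]

/-- By rotation invariance η may be replaced by |η| times the first basis vector; scaling then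
extracts |η|^s. -/
theorem integral_one_sub_cos (hs0 : 0 < s) (η : RN N) :
    ∫ y : RN N, (1 - Real.cos (inner ℝ y η)) / ‖y‖ ^ ((N : ℝ) + s) =
      ‖η‖ ^ s * ∫ y : RN N, (1 - Real.cos (y 0)) / ‖y‖ ^ ((N : ℝ) + s) := by
  rcases eq_or_ne η 0 with rfl | hη
  · simp [Real.zero_rpow hs0.ne']
  have hη' : 0 < ‖η‖ := norm_pos_iff.2 hη
  set e : RN N := EuclideanSpace.single 0 1 with he
  have hnorm : ‖η‖ = ‖‖η‖ • e‖ := by simp [he, norm_smul]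
  rw [integral_one_sub_cos_isometry hnorm, integral_one_sub_cos_scale hη']
  simp [he, EuclideanSpace.inner_single_right]

theorem integrable_one_sub_cos (hs0 : 0 < s) (hs1 : s < 1) :
    Integrable (fun y : RN N => (1 - Real.cos (y 0)) / ‖y‖ ^ ((N : ℝ) + s)) volume := by
  have h := (integrable_one_sub_exp hs0 hs1 (EuclideanSpace.single (0 : Fin N) (1 : ℝ))).re
  refine h.congr (Eventually.of_forall fun y => ?_)
  simp [EuclideanSpace.inner_single_right, Complex.exp_ofReal_mul_I_re, div_eq_inv_mul]
  left
  by_cases h0 : ‖y‖ ^ ((N : ℝ) + s) = 0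
  · simp [h0]
  · field_simp

/-- The integrand is positive on the open strip 0 < y₀ < 1. Positivity and integrability make the
inverse in `fracConst` a genuine one. -/
theorem integral_one_sub_cos_pos (hs0 : 0 < s) (hs1 : s < 1) :
    0 < ∫ y : RN N, (1 - Real.cos (y 0)) / ‖y‖ ^ ((N : ℝ) + s) := by
  rw [integral_pos_iff_support_of_nonneg (fun y => div_nonneg (one_sub_cos_nonneg _) (by positivity))
    (integrable_one_sub_cos hs0 hs1)]
  set U : Set (RN N) := {y | 0 < y 0 ∧ y 0 < 1} with hU
  have hUo : IsOpen U := by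
    have hc : Continuous fun y : RN N => y 0 := by fun_prop
    exact (isOpen_lt continuous_const hc).inter (isOpen_lt hc continuous_const)
  have hUn : U.Nonempty := ⟨EuclideanSpace.single 0 (1 / 2), by
    show 0 < _ ∧ _ < _; simp; norm_num⟩
  refine (hUo.measure_pos volume hUn).trans_le (measure_mono fun y hy => ?_)
  obtain ⟨h0, h1⟩ : 0 < y 0 ∧ y 0 < 1 := hy
  have hne : y ≠ 0 := fun h => by simp [h] at h0
  have hcos : Real.cos (y 0) < 1 := by
    have := Real.cos_lt_cos_of_nonneg_of_le_pi le_rfl (by linarith [Real.pi_gt_three]) h0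
    simpa using this
  have : 0 < ‖y‖ ^ ((N : ℝ) + s) := Real.rpow_pos_of_pos (norm_pos_iff.2 hne) _
  exact (div_pos (by linarith) this).ne'

/-- The normalising constant is the inverse of the integral in the direction of the first basis
vector, so exactly |η|^s is left. -/
theorem fracConst_mul_integral (hs0 : 0 < s) (hs1 : s < 1) (η : RN N) :
    (fracConst N (s / 2) : ℂ) * ∫ y : RN N, (‖y‖ ^ ((N : ℝ) + s))⁻¹ •
      (1 - Complex.exp ((inner ℝ y η : ℝ) * Complex.I)) = ((‖η‖ ^ s : ℝ) : ℂ) := by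
  rw [integral_one_sub_exp_eq_cos hs0 hs1, integral_one_sub_cos hs0, ← Complex.ofReal_mul]
  congr 1
  have h := (integral_one_sub_cos_pos (N := N) hs0 hs1).ne'
  rw [fracConst, show 2 * (s / 2) = s by ring]
  field_simp

/-- The Fourier symbol `|2πξ|^s` of `(-Δ)^(s/2)`. -/
noncomputable def symbol (s : ℝ) (ξ : RN N) : ℝ := ‖(2 * Real.pi) • ξ‖ ^ s

theorem continuous_symbol (hs0 : 0 < s) : Continuous (symbol (N := N) s) := by
  unfold symbol
  exact (by fun_prop : Continuous fun ξ : RN N => ‖(2 * Real.pi) • ξ‖).rpow_const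
    fun _ => Or.inr hs0.le

theorem symbol_eq (ξ : RN N) : symbol s ξ = (2 * Real.pi) ^ s * ‖ξ‖ ^ s := by
  rw [symbol, norm_smul, Real.norm_of_nonneg (by positivity), Real.mul_rpow (by positivity)
    (by positivity)]

/-- The integral operator of the fractional Laplacian on the Fourier side. -/
theorem fracConst_mul_integral_fourier_sub (hs0 : 0 < s) (hs1 : s < 1) (Φ : 𝓢(RN N, ℂ))
    (x : RN N) :
    (fracConst N (s / 2) : ℂ) * ∫ y : RN N, (‖y‖ ^ ((N : ℝ) + s))⁻¹ • ((𝓕 Φ) x - (𝓕 Φ) (x + y)) =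
      𝓕 (fun ξ => (symbol s ξ : ℂ) * Φ ξ) x := by
  have hinteg : ∀ x : RN N, Integrable (fun ξ : RN N =>
      Complex.exp (↑(-2 * Real.pi * inner ℝ ξ x) * Complex.I) * Φ ξ) volume := fun x => by
    refine Φ.integrable.norm.mono' (Continuous.aestronglyMeasurable (by fun_prop)) ?_
    refine Eventually.of_forall fun ξ => ?_
    rw [norm_mul, Complex.norm_exp_ofReal_mul_I, one_mul]
  have hF : ∀ x : RN N, (𝓕 Φ) x = ∫ ξ : RN N,
      Complex.exp (↑(-2 * Real.pi * inner ℝ ξ x) * Complex.I) * Φ ξ := fun x => by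
    rw [SchwartzMap.fourier_coe, Real.fourier_eq']; rfl
  set G : RN N → RN N → ℂ := fun y ξ =>
    Complex.exp (↑(-2 * Real.pi * inner ℝ ξ x) * Complex.I) * Φ ξ * ((‖y‖ ^ ((N : ℝ) + s))⁻¹ •
      (1 - Complex.exp ((inner ℝ y ((-(2 * Real.pi)) • ξ) : ℝ) * Complex.I))) with hG
  have e1 : ∀ y : RN N, (‖y‖ ^ ((N : ℝ) + s))⁻¹ • ((𝓕 Φ) x - (𝓕 Φ) (x + y)) = ∫ ξ, G y ξ := by
    intro y
    rw [hF, hF, ← integral_sub (hinteg _) (hinteg _), ← integral_smul]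
    congr 1; ext ξ
    simp only [hG]
    rw [Algebra.mul_smul_comm, real_inner_smul_right, inner_add_right, real_inner_comm ξ y]
    congr 1
    rw [show -2 * Real.pi * (inner ℝ ξ x + inner ℝ ξ y) = -2 * Real.pi * inner ℝ ξ x +
      (-(2 * Real.pi) * inner ℝ ξ y) by ring, Complex.ofReal_add, add_mul, Complex.exp_add]
    ring
  -- For Fubini: |1 - exp(i y·η)| is at most 2(1 + |η|) min(1,|y|), so G is dominated by the kernel
  -- in y times an integrable function of ξ.
  have hGint : Integrable (Function.uncurry G) (volume.prod volume) := by
    have hdom : Integrable (fun q : RN N × RN N => kern N s 1 q.1 *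
        (2 * (1 + 2 * Real.pi * ‖q.2‖) * ‖Φ q.2‖)) (volume.prod volume) := by
      refine (integrable_kern_one hs0 hs1).mul_prod
        (g := fun ξ : RN N => 2 * (1 + 2 * Real.pi * ‖ξ‖) * ‖Φ ξ‖) ?_
      have h1 := Φ.integrable (μ := volume) |>.norm
      have h2 := Φ.integrable_pow_mul (volume : Measure (RN N)) 1
      refine ((h1.const_mul 2).add (h2.const_mul (4 * Real.pi))).congr
        (Eventually.of_forall fun ξ => ?_)
      simp only [Pi.add_apply, pow_one]; ring
    refine hdom.mono' ?_ (Eventually.of_forall fun q => ?_)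
    · have h1 : Measurable fun q : RN N × RN N => (‖q.1‖ ^ ((N : ℝ) + s))⁻¹ := by fun_prop
      have h2 : Continuous fun q : RN N × RN N =>
          1 - Complex.exp ((inner ℝ q.1 ((-(2 * Real.pi)) • q.2) : ℝ) * Complex.I) := by fun_prop
      have h3 : Continuous fun q : RN N × RN N =>
          Complex.exp (↑(-2 * Real.pi * inner ℝ q.2 x) * Complex.I) * Φ q.2 := by fun_prop
      exact (h3.measurable.mul (h1.smul h2.measurable)).aestronglyMeasurable
    · simp only [Function.uncurry, hG]
      rw [norm_mul, norm_mul, Complex.norm_exp_ofReal_mul_I, one_mul, norm_smul, norm_inv,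
        Real.norm_of_nonneg (by positivity), inv_mul_eq_div]
      have h1 := norm_one_sub_exp_inner_le q.1 ((-(2 * Real.pi)) • q.2)
      rw [norm_smul, norm_neg, Real.norm_of_nonneg (by positivity)] at h1
      unfold kern
      rw [div_one, mul_comm, div_mul_eq_mul_div, div_mul_eq_mul_div]
      refine div_le_div_of_nonneg_right ?_ (by positivity)
      calc _ ≤ (2 * (1 + 2 * Real.pi * ‖q.2‖) * min 1 ‖q.1‖) * ‖Φ q.2‖ := by gcongr
        _ = _ := by ring
  simp only [e1]
  rw [integral_integral_swap hGint, ← integral_const_mul, Real.fourier_eq']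
  congr 1; ext ξ
  simp only [hG]
  rw [integral_const_mul, mul_left_comm, fracConst_mul_integral hs0 hs1, norm_smul, norm_neg,
    ← norm_smul, symbol, smul_eq_mul]
  ring

end Symbol
end FracCC

namespace FracCC

open scoped ENNReal NNReal FourierTransform

/-! ### The distributional (-Δ)^(s/2) on the Fourier side -/

section FourierHalfLap

variable {N : ℕ} [NeZero N] {s : ℝ} {u w : RN N → ℝ}

/-- Real part of a complex Schwartz function. -/
noncomputable def reSchwartz (Ψ : 𝓢(RN N, ℂ)) : 𝓢(RN N, ℝ) :=
  SchwartzMap.postcompCLM (𝕜 := ℝ) Complex.reCLM Ψ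

/-- Imaginary part of a complex Schwartz function. -/
noncomputable def imSchwartz (Ψ : 𝓢(RN N, ℂ)) : 𝓢(RN N, ℝ) :=
  SchwartzMap.postcompCLM (𝕜 := ℝ) Complex.imCLM Ψ

theorem reSchwartz_apply (Ψ : 𝓢(RN N, ℂ)) (x : RN N) : reSchwartz Ψ x = (Ψ x).re := rfl

theorem imSchwartz_apply (Ψ : 𝓢(RN N, ℂ)) (x : RN N) : imSchwartz Ψ x = (Ψ x).im := rfl

theorem fracConst_mul_integral_complex (hs0 : 0 < s) (hs1 : s < 1) (Ψ : 𝓢(RN N, ℂ)) (x : RN N) :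
    (fracConst N (s / 2) : ℂ) * ∫ y : RN N, (‖y‖ ^ ((N : ℝ) + s))⁻¹ • (Ψ x - Ψ (x + y)) =
      (fracLaplacian (s / 2) (reSchwartz Ψ) x : ℂ) +
        (fracLaplacian (s / 2) (imSchwartz Ψ) x : ℂ) * Complex.I := by
  have hi := integrable_schwartz_sub_div hs0 hs1 Ψ x
  have hre : (∫ y : RN N, (‖y‖ ^ ((N : ℝ) + s))⁻¹ • (Ψ x - Ψ (x + y))).re =
      ∫ y : RN N, (‖y‖ ^ ((N : ℝ) + s))⁻¹ * (reSchwartz Ψ x - reSchwartz Ψ (x + y)) := by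
    have := Complex.reCLM.integral_comp_comm hi
    simp only [Complex.reCLM_apply, Complex.smul_re, Complex.sub_re, smul_eq_mul] at this
    rw [← this]; rfl
  have him : (∫ y : RN N, (‖y‖ ^ ((N : ℝ) + s))⁻¹ • (Ψ x - Ψ (x + y))).im =
      ∫ y : RN N, (‖y‖ ^ ((N : ℝ) + s))⁻¹ * (imSchwartz Ψ x - imSchwartz Ψ (x + y)) := by
    have := Complex.imCLM.integral_comp_comm hi
    simp only [Complex.imCLM_apply, Complex.smul_im, Complex.sub_im, smul_eq_mul] at this
    rw [← this]; rfl
  rw [fracLaplacian_eq hs0 hs1, fracLaplacian_eq hs0 hs1, ← hre, ← him]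
  refine Complex.ext ?_ ?_ <;> simp

/-- The defining identity holds for real test functions; it is applied to real and imaginary parts,
as Fourier transforms of test functions are complex. -/
theorem IsHalfLap.integral_complex (hs0 : 0 < s) (hs1 : s < 1) (hu : MemLp u 2 volume)
    (h : IsHalfLap s u w) (Ψ : 𝓢(RN N, ℂ)) :
    ∫ x, (u x : ℂ) * ((fracConst N (s / 2) : ℂ) *
      ∫ y : RN N, (‖y‖ ^ ((N : ℝ) + s))⁻¹ • (Ψ x - Ψ (x + y))) = ∫ x, (w x : ℂ) * Ψ x := by
  have i1 := integrable_mul_fracLaplacian hs0 hs1 hu (by norm_num) (reSchwartz Ψ)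
  have i2 := integrable_mul_fracLaplacian hs0 hs1 hu (by norm_num) (imSchwartz Ψ)
  have j1 := h.integrable_mul (reSchwartz Ψ)
  have j2 := h.integrable_mul (imSchwartz Ψ)
  have e1 : ∀ x, (u x : ℂ) * ((fracConst N (s / 2) : ℂ) *
      ∫ y : RN N, (‖y‖ ^ ((N : ℝ) + s))⁻¹ • (Ψ x - Ψ (x + y))) =
      ((u x * fracLaplacian (s / 2) (reSchwartz Ψ) x : ℝ) : ℂ) +
        ((u x * fracLaplacian (s / 2) (imSchwartz Ψ) x : ℝ) : ℂ) * Complex.I := by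
    intro x
    rw [fracConst_mul_integral_complex hs0 hs1]; push_cast; ring
  have e2 : ∀ x, (w x : ℂ) * Ψ x = ((w x * reSchwartz Ψ x : ℝ) : ℂ) +
        ((w x * imSchwartz Ψ x : ℝ) : ℂ) * Complex.I := by
    intro x
    rw [reSchwartz_apply, imSchwartz_apply]
    refine Complex.ext ?_ ?_ <;> simp
  simp only [e1, e2]
  rw [integral_add i1.ofReal (i2.ofReal.mul_const _), integral_add j1.ofReal (j2.ofReal.mul_const _),
    integral_mul_const, integral_mul_const]
  have c1 := h.2 (reSchwartz Ψ)
  have c2 := h.2 (imSchwartz Ψ)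
  congr 1
  · exact (integral_ofReal (𝕜 := ℂ)).trans ((congrArg _ c1).trans (integral_ofReal (𝕜 := ℂ)).symm)
  · congr 1
    exact (integral_ofReal (𝕜 := ℂ)).trans ((congrArg _ c2).trans (integral_ofReal (𝕜 := ℂ)).symm)

theorem memLp_complex {u : RN N → ℝ} {p : ℝ≥0∞} (hu : MemLp u p volume) :
    MemLp (fun x => (u x : ℂ)) p volume := hu.ofReal

/-- The Fourier transform of a real `L²` function. -/
noncomputable def hat (hu : MemLp u 2 volume) : Lp ℂ 2 (volume : Measure (RN N)) :=
  𝓕 ((memLp_complex hu).toLp _)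

theorem eLpNorm_hat (hu : MemLp u 2 volume) : eLpNorm (hat hu) 2 volume = eLpNorm u 2 volume := by
  rw [hat, lintegral_enorm_sq_fourier, eLpNorm_congr_ae (memLp_complex hu).coeFn_toLp]
  exact eLpNorm_congr_norm_ae (Eventually.of_forall fun x => by simp)

/-- `(-Δ)^(s/2)` acts on the Fourier side as multiplication by `|2πξ|^s`. -/
theorem IsHalfLap.symbol_mul_hat (hs0 : 0 < s) (hs1 : s < 1) (hu : MemLp u 2 volume)
    (h : IsHalfLap s u w) :
    (fun ξ => (symbol s ξ : ℂ) * hat hu ξ) =ᵐ[volume] hat h.1 := by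
  have hsym : Continuous fun ξ : RN N => (symbol s ξ : ℂ) :=
    Complex.continuous_ofReal.comp (continuous_symbol hs0)
  have hloc : LocallyIntegrable (hat hu) volume := (Lp.memLp _).locallyIntegrable (by norm_num)
  refine ae_eq_of_integral_complexSchwartz ?_ ((Lp.memLp _).locallyIntegrable (by norm_num)) ?_
  · rw [locallyIntegrable_iff] at hloc ⊢
    exact fun k hk => (hloc k hk).continuousOn_mul hsym.continuousOn hk
  intro θ hθc hθ
  set Φ := complexSchwartz hθc hθ with hΦ
  -- The symbol need not be smooth at the origin, so f is treated as a continuous function with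
  -- compact support, hence in L¹ ∩ L², and not as a Schwartz function. Its transform is the
  -- singular integral of 𝓕 Φ, where the hypothesis on u applies.
  set f : RN N → ℂ := fun ξ => (symbol s ξ : ℂ) * Φ ξ with hf
  have hfc : Continuous f := hsym.mul Φ.continuous
  have hfs : HasCompactSupport f := by
    refine HasCompactSupport.mul_left ?_
    exact hθc.comp_left (g := fun t : ℝ => (t : ℂ)) (by simp)
  have hf1 : Integrable f volume := hfc.integrable_of_hasCompactSupport hfs
  have hf2 : MemLp f 2 volume := hfc.memLp_of_hasCompactSupport hfs
  have hu' := memLp_complex hu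
  calc ∫ ξ, Φ ξ * ((symbol s ξ : ℂ) * hat hu ξ) = ∫ ξ, hat hu ξ * hf2.toLp f ξ := by
        refine integral_congr_ae ?_
        filter_upwards [hf2.coeFn_toLp] with ξ hξ
        rw [hξ]; simp only [hf]; ring
    _ = ∫ x, hu'.toLp _ x * (𝓕 (hf2.toLp f) : Lp ℂ 2 (volume : Measure (RN N))) x :=
        integral_fourier_mul_eq _ _
    _ = ∫ x, (u x : ℂ) * 𝓕 f x := by
        refine integral_congr_ae ?_
        filter_upwards [hu'.coeFn_toLp, fourier_toLp_ae_eq hf2 hf1] with x h1 h2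
        rw [h1, h2]
    _ = ∫ x, (w x : ℂ) * (𝓕 Φ) x := by
        rw [← h.integral_complex hs0 hs1 hu (𝓕 Φ)]
        simp only [fracConst_mul_integral_fourier_sub hs0 hs1, hf]
    _ = ∫ x, (𝓕 Φ) x * (memLp_complex h.1).toLp _ x := by
        refine integral_congr_ae ?_
        filter_upwards [(memLp_complex h.1).coeFn_toLp] with x h1
        rw [h1, mul_comm]
    _ = ∫ ξ, Φ ξ * hat h.1 ξ := (integral_schwartz_mul_fourier _ _).symm

theorem IsHalfLap.eLpNorm_symbol_mul_hat (hs0 : 0 < s) (hs1 : s < 1) (hu : MemLp u 2 volume)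
    (h : IsHalfLap s u w) :
    eLpNorm (fun ξ => (symbol s ξ : ℂ) * hat hu ξ) 2 volume = eLpNorm w 2 volume := by
  rw [eLpNorm_congr_ae (h.symbol_mul_hat hs0 hs1 hu), eLpNorm_hat]

end FourierHalfLap
end FracCC

namespace FracCC

open scoped ENNReal NNReal FourierTransform

/-! ### Low and high frequencies at a given level of |u| -/

section Sobolev

variable {N : ℕ} [NeZero N] {s : ℝ} {u w : RN N → ℝ}

theorem lintegral_norm_rpow_mul_hat_le (hs0 : 0 < s) (hs1 : s < 1) (hu : MemLp u 2 volume)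
    (h : IsHalfLap s u w) :
    ∫⁻ ξ, (ENNReal.ofReal (‖ξ‖ ^ s) * ‖hat hu ξ‖ₑ) ^ (2 : ℝ) ≤ eLpNorm w 2 volume ^ (2 : ℝ) := by
  rw [← h.eLpNorm_symbol_mul_hat hs0 hs1 hu,
    eLpNorm_eq_lintegral_rpow_enorm_toReal (by norm_num) (by norm_num), ← ENNReal.rpow_mul]
  simp only [ENNReal.toReal_ofNat]
  rw [one_div_mul_cancel (by norm_num), ENNReal.rpow_one]
  refine lintegral_mono fun ξ => ?_
  refine ENNReal.rpow_le_rpow ?_ (by norm_num)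
  rw [enorm_mul, symbol_eq]
  gcongr
  rw [← ofReal_norm, Complex.norm_real, Real.norm_of_nonneg (by positivity)]
  refine ENNReal.ofReal_le_ofReal (le_mul_of_one_le_left (by positivity) ?_)
  exact Real.one_le_rpow (by linarith [Real.pi_gt_three]) hs0.le

/-- The function `|ξ|^(-2s)` cut off to the ball of radius `A`. -/
noncomputable def lowWeight (N : ℕ) (s A : ℝ) (ξ : RN N) : ℝ :=
  (Metric.ball (0 : RN N) A).indicator (fun ξ => ‖ξ‖ ^ (-(2 * s))) ξ

theorem lowWeight_nonneg (A : ℝ) (ξ : RN N) : 0 ≤ lowWeight N s A ξ :=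
  indicator_nonneg (fun _ _ => by positivity) _

/-- The radial density is r^(N-1-2s) on (0,1), integrable because N > 2s. -/
theorem integrable_lowWeight_one (hN : 2 * s < (N : ℝ)) : Integrable (lowWeight N s 1) volume := by
  have key := (integrable_fun_norm_addHaar (volume : Measure (RN N))
    (f := fun r : ℝ => (Iio 1).indicator (fun r => r ^ (-(2 * s))) r)).2
  have e : lowWeight N s 1 = fun ξ => (Iio 1).indicator (fun r => r ^ (-(2 * s))) ‖ξ‖ := by
    ext ξ
    by_cases h : ‖ξ‖ < 1 <;> simp [lowWeight, h]
  rw [e]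
  refine key ?_
  have h1 : IntegrableOn (fun y : ℝ => y ^ ((N : ℝ) - 1 - 2 * s)) (Ioo 0 1) := by
    rw [intervalIntegral.integrableOn_Ioo_rpow_iff one_pos]
    linarith
  rw [← integrable_indicator_iff measurableSet_Ioo] at h1
  rw [← integrable_indicator_iff measurableSet_Ioi]
  refine h1.congr (Eventually.of_forall fun y => ?_)
  simp only [finrank_euclideanSpace, Fintype.card_fin, smul_eq_mul]
  by_cases hy0 : 0 < y
  · by_cases hy1 : y < 1
    · simp only [indicator, mem_Ioo, mem_Ioi, mem_Iio, hy0, hy1, and_self, if_true]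
      rw [← Real.rpow_natCast, Nat.cast_sub (Nat.one_le_iff_ne_zero.2 (NeZero.ne N)),
        ← Real.rpow_add hy0]
      congr 1; push_cast; ring
    · simp [indicator, hy1]
  · simp [indicator, hy0]

theorem lowWeight_eq_smul {A : ℝ} (hA : 0 < A) (ξ : RN N) :
    lowWeight N s A ξ = A ^ (-(2 * s)) * lowWeight N s 1 (A⁻¹ • ξ) := by
  have hn : ‖A⁻¹ • ξ‖ = ‖ξ‖ / A := by
    rw [norm_smul, norm_inv, Real.norm_of_nonneg hA.le]; field_simp
  by_cases h : ‖ξ‖ < A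
  · have h' : ‖ξ‖ / A < 1 := (div_lt_one hA).2 h
    simp only [lowWeight, indicator, Metric.mem_ball, dist_zero_right, h, hn, h', if_true]
    rw [Real.div_rpow (norm_nonneg _) hA.le, mul_div_cancel₀ _ (Real.rpow_pos_of_pos hA _).ne']
  · have h' : ¬ ‖ξ‖ / A < 1 := fun h'' => h ((div_lt_one hA).1 h'')
    simp [lowWeight, indicator, h, hn, h']

theorem integrable_lowWeight (hN : 2 * s < (N : ℝ)) {A : ℝ} (hA : 0 < A) :
    Integrable (lowWeight N s A) volume := by
  rw [show lowWeight N s A = fun ξ => A ^ (-(2 * s)) * lowWeight N s 1 (A⁻¹ • ξ) from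
    funext fun ξ => lowWeight_eq_smul hA ξ]
  exact ((integrable_lowWeight_one hN).comp_smul (by positivity)).const_mul _

theorem integral_lowWeight {A : ℝ} (hA : 0 < A) :
    ∫ ξ, lowWeight N s A ξ = A ^ ((N : ℝ) - 2 * s) * ∫ ξ, lowWeight N s 1 ξ := by
  rw [show lowWeight N s A = fun ξ => A ^ (-(2 * s)) * lowWeight N s 1 (A⁻¹ • ξ) from
    funext fun ξ => lowWeight_eq_smul hA ξ, integral_const_mul, Measure.integral_comp_smul]
  simp only [finrank_euclideanSpace, Fintype.card_fin, smul_eq_mul]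
  rw [abs_of_pos (by positivity), ← mul_assoc]
  congr 1
  rw [inv_pow, inv_inv, ← Real.rpow_natCast, ← Real.rpow_add hA]
  congr 1; ring

/-- The constant in the low-frequency bound. -/
noncomputable def lowConst (N : ℕ) (s : ℝ) : ℝ := (∫ ξ : RN N, lowWeight N s 1 ξ) ^ (1 / 2 : ℝ) + 1

theorem lowConst_pos : 0 < lowConst N s := by
  have : 0 ≤ ∫ ξ : RN N, lowWeight N s 1 ξ := integral_nonneg fun ξ => lowWeight_nonneg 1 ξ
  unfold lowConst; positivity

/-- Cauchy-Schwarz for |ξ|^(-s) times |ξ|^s|û| on the ball. An L¹ bound on low frequencies is a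
uniform bound on that part of u. -/
theorem setLIntegral_hat_le (hs0 : 0 < s) (hs1 : s < 1) (hN : 2 * s < (N : ℝ))
    (hu : MemLp u 2 volume) (h : IsHalfLap s u w) {A : ℝ} (hA : 0 < A) :
    ∫⁻ ξ in Metric.ball (0 : RN N) A, ‖hat hu ξ‖ₑ ≤
      ENNReal.ofReal (lowConst N s * A ^ (((N : ℝ) - 2 * s) / 2)) * eLpNorm w 2 volume := by
  set a : RN N → ℝ≥0∞ := fun ξ =>
    (Metric.ball (0 : RN N) A).indicator (fun ξ => ENNReal.ofReal (‖ξ‖ ^ (-s))) ξ with ha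
  set b : RN N → ℝ≥0∞ := fun ξ => ENNReal.ofReal (‖ξ‖ ^ s) * ‖hat hu ξ‖ₑ with hb
  have ham : Measurable a := Measurable.indicator (by fun_prop) Metric.isOpen_ball.measurableSet
  have hbm : AEMeasurable b volume :=
    AEMeasurable.mul (Measurable.aemeasurable (by fun_prop)) (Lp.aestronglyMeasurable _).enorm
  have h0 : ∀ᵐ ξ : RN N, ξ ≠ 0 := by
    simp [ae_iff]
  calc ∫⁻ ξ in Metric.ball (0 : RN N) A, ‖hat hu ξ‖ₑ
      = ∫⁻ ξ, (Metric.ball (0 : RN N) A).indicator (fun ξ => ‖hat hu ξ‖ₑ) ξ :=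
        (lintegral_indicator Metric.isOpen_ball.measurableSet _).symm
    _ ≤ ∫⁻ ξ, (a * b) ξ := by
        refine lintegral_mono_ae ?_
        filter_upwards [h0] with ξ hξ
        by_cases hm : ξ ∈ Metric.ball (0 : RN N) A
        · simp only [Pi.mul_apply, ha, hb, indicator_of_mem hm]
          rw [← mul_assoc, ← ENNReal.ofReal_mul (by positivity),
            ← Real.rpow_add (norm_pos_iff.2 hξ)]
          simp
        · simp [indicator_of_notMem hm]
    _ ≤ (∫⁻ ξ, a ξ ^ (2 : ℝ)) ^ (1 / (2 : ℝ)) * (∫⁻ ξ, b ξ ^ (2 : ℝ)) ^ (1 / (2 : ℝ)) :=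
        ENNReal.lintegral_mul_le_Lp_mul_Lq volume Real.HolderConjugate.two_two ham.aemeasurable hbm
    _ ≤ _ := by
        refine mul_le_mul' ?_ ?_
        · have e : ∀ ξ, a ξ ^ (2 : ℝ) = ENNReal.ofReal (lowWeight N s A ξ) := by
            intro ξ
            by_cases hm : ξ ∈ Metric.ball (0 : RN N) A
            · simp only [ha, lowWeight, indicator_of_mem hm]
              rw [ENNReal.ofReal_rpow_of_nonneg (by positivity) (by norm_num),
                ← Real.rpow_mul (norm_nonneg _)]
              congr 2; ring
            · simp [ha, lowWeight, indicator_of_notMem hm]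
          simp only [e]
          have hI : 0 ≤ ∫ ξ : RN N, lowWeight N s 1 ξ := integral_nonneg fun ξ => lowWeight_nonneg 1 ξ
          rw [← ofReal_integral_eq_lintegral_ofReal (integrable_lowWeight hN hA)
            (Eventually.of_forall fun ξ => lowWeight_nonneg A ξ), integral_lowWeight hA,
            ENNReal.ofReal_rpow_of_nonneg (by positivity) (by norm_num),
            Real.mul_rpow (by positivity) hI, ← Real.rpow_mul hA.le, mul_comm]
          refine ENNReal.ofReal_le_ofReal ?_
          rw [mul_one_div]
          gcongr
          unfold lowConst; linarith
        · refine (ENNReal.rpow_le_rpow (lintegral_norm_rpow_mul_hat_le hs0 hs1 hu h)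
            (by norm_num)).trans ?_
          rw [← ENNReal.rpow_mul]; norm_num

/-- The threshold A is such that the part of u with frequencies below A is at most lam/2 everywhere.
Where |u| > lam, the remainder is therefore at least lam/2, and Chebyshev with Plancherel applies;
the constant is (lam/2)^(-2). -/
theorem measure_lt_abs_le (hs0 : 0 < s) (hs1 : s < 1) (hN : 2 * s < (N : ℝ))
    (hu : MemLp u 2 volume) (h : IsHalfLap s u w) {A W lam : ℝ} (hA : 0 < A)
    (hlam : 0 < lam)
    (hw : eLpNorm w 2 volume ≤ ENNReal.ofReal W)
    (hAl : lowConst N s * A ^ (((N : ℝ) - 2 * s) / 2) * W ≤ lam / 2) :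
    volume {x | lam < |u x|} ≤ ENNReal.ofReal (4 / lam ^ 2) *
      ∫⁻ ξ, {ξ : RN N | A ≤ ‖ξ‖}.indicator (fun ξ => ‖hat hu ξ‖ₑ ^ (2 : ℝ)) ξ := by
  set F := hat hu with hF
  have hBm : MeasurableSet (Metric.ball (0 : RN N) A) := Metric.isOpen_ball.measurableSet
  have hFm : MemLp F 2 volume := Lp.memLp F
  set f : RN N → ℂ := (Metric.ball (0 : RN N) A).indicator F with hf
  have hf2 : MemLp f 2 volume := hFm.indicator hBm
  have hlow : ∫⁻ ξ, ‖f ξ‖ₑ ≤ ENNReal.ofReal (lam / 2) := by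
    have e : ∫⁻ ξ, ‖f ξ‖ₑ = ∫⁻ ξ in Metric.ball (0 : RN N) A, ‖F ξ‖ₑ := by
      rw [← lintegral_indicator hBm]
      simp only [hf, enorm_indicator_eq_indicator_enorm]
    rw [e]
    refine (setLIntegral_hat_le hs0 hs1 hN hu h hA).trans ?_
    refine (mul_le_mul' le_rfl hw).trans ?_
    have := lowConst_pos (N := N) (s := s)
    rw [← ENNReal.ofReal_mul (by positivity)]
    exact ENNReal.ofReal_le_ofReal hAl
  have hf1 : Integrable f volume := ⟨hf2.1, hlow.trans_lt ENNReal.ofReal_lt_top⟩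
  have hinv : ∀ x, ‖𝓕⁻ f x‖ ≤ lam / 2 := by
    intro x
    have h1 : ‖𝓕⁻ f x‖ ≤ ∫ ξ, ‖f ξ‖ := by
      rw [Real.fourierInv_eq']
      refine (norm_integral_le_integral_norm _).trans (le_of_eq ?_)
      congr 1; ext ξ
      rw [norm_smul, Complex.norm_exp_ofReal_mul_I, one_mul]
    refine h1.trans ?_
    rw [integral_norm_eq_lintegral_enorm hf1.1]
    exact ENNReal.toReal_le_of_le_ofReal (by positivity) hlow
  set U := (memLp_complex hu).toLp _ with hU
  have hUF : U = 𝓕⁻ F := by rw [hF, hat, FourierTransform.fourierInv_fourier_eq]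
  set D : Lp ℂ 2 (volume : Measure (RN N)) := 𝓕⁻ (F - hf2.toLp f) with hD
  have hDeq : D = U - 𝓕⁻ (hf2.toLp f) := by
    rw [hUF, hD]
    exact map_sub (Lp.fourierTransformₗᵢ (RN N) ℂ).symm _ _
  have hDae : ∀ᵐ x, D x = (u x : ℂ) - 𝓕⁻ f x := by
    rw [hDeq]
    filter_upwards [Lp.coeFn_sub U (𝓕⁻ (hf2.toLp f)), (memLp_complex hu).coeFn_toLp,
      fourierInv_toLp_ae_eq hf2 hf1] with x h1 h2 h3
    rw [h1, Pi.sub_apply, h2, h3]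
  have hDn : eLpNorm D 2 volume = eLpNorm (F - hf2.toLp f : Lp ℂ 2 (volume : Measure (RN N))) 2 volume := by
    have h1 := (Lp.fourierTransformₗᵢ (RN N) ℂ).symm.norm_map (F - hf2.toLp f)
    rw [Lp.norm_def, Lp.norm_def] at h1
    exact (ENNReal.toReal_eq_toReal_iff' (Lp.eLpNorm_ne_top _) (Lp.eLpNorm_ne_top _)).1 h1
  have hhigh : eLpNorm D 2 volume ^ (2 : ℝ) =
      ∫⁻ ξ, {ξ : RN N | A ≤ ‖ξ‖}.indicator (fun ξ => ‖F ξ‖ₑ ^ (2 : ℝ)) ξ := by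
    rw [hDn, eLpNorm_eq_lintegral_rpow_enorm_toReal (by norm_num) (by norm_num), ← ENNReal.rpow_mul]
    simp only [ENNReal.toReal_ofNat]
    rw [one_div_mul_cancel (by norm_num), ENNReal.rpow_one]
    refine lintegral_congr_ae ?_
    filter_upwards [Lp.coeFn_sub F (hf2.toLp f), hf2.coeFn_toLp] with ξ h1 h2
    rw [h1, Pi.sub_apply, h2]
    by_cases hm : ‖ξ‖ < A
    · have hm1 : ξ ∈ Metric.ball (0 : RN N) A := by simpa using hm
      have hm2 : ξ ∉ {ξ : RN N | A ≤ ‖ξ‖} := fun h' => absurd hm (not_lt.2 h')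
      rw [hf, indicator_of_mem hm1, indicator_of_notMem hm2]
      simp
    · have hm1 : ξ ∉ Metric.ball (0 : RN N) A := by simpa using hm
      have hm2 : ξ ∈ {ξ : RN N | A ≤ ‖ξ‖} := not_lt.1 hm
      rw [hf, indicator_of_notMem hm1, indicator_of_mem hm2, sub_zero]
  rw [← hhigh]
  have hsub : {x | lam < |u x|} ≤ᵐ[volume] {x | ENNReal.ofReal (lam / 2) ≤ ‖D x‖ₑ} := by
    filter_upwards [hDae] with x hx hxl
    have hxl' : lam < |u x| := hxl
    change ENNReal.ofReal (lam / 2) ≤ ‖D x‖ₑ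
    rw [hx, ← ofReal_norm]
    refine ENNReal.ofReal_le_ofReal ?_
    have h1 := norm_sub_norm_le (u x : ℂ) (𝓕⁻ f x)
    rw [Complex.norm_real, Real.norm_eq_abs] at h1
    linarith [hinv x]
  refine (measure_mono_ae hsub).trans ?_
  have hch := meas_ge_le_mul_pow_eLpNorm_enorm volume (p := 2) (by norm_num) (by norm_num)
    (Lp.aestronglyMeasurable D) (ε := ENNReal.ofReal (lam / 2))
    (by simpa using hlam) (fun h => absurd h ENNReal.ofReal_ne_top)
  refine hch.trans (le_of_eq ?_)
  simp only [ENNReal.toReal_ofNat]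
  congr 1
  rw [← ENNReal.ofReal_inv_of_pos (by positivity), ENNReal.ofReal_rpow_of_nonneg (by positivity) (by norm_num)]
  congr 1
  rw [show (2 : ℝ) = ((2 : ℕ) : ℝ) by norm_num, Real.rpow_natCast]
  field_simp
  norm_num

end Sobolev
end FracCC

namespace FracCC

open scoped ENNReal NNReal FourierTransform

/-! ### The fractional Sobolev inequality on H^s -/

section Sobolev

variable {N : ℕ} [NeZero N] {s : ℝ} {u w : RN N → ℝ}

theorem two_lt_critExp (hs0 : 0 < s) (hN : 2 * s < (N : ℝ)) : 2 < critExp N s := by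
  unfold critExp
  rw [lt_div_iff₀ (by linarith)]
  linarith

/-- The arithmetic that singles out the critical exponent: it makes the weight produced by the
level-set argument exactly |ξ|^(2s). -/
theorem critExp_sub_two_mul (hN : 2 * s < (N : ℝ)) :
    (((N : ℝ) - 2 * s) / 2) * (critExp N s - 2) = s * 2 := by
  unfold critExp
  have : (N : ℝ) - 2 * s ≠ 0 := by linarith
  field_simp
  ring

theorem lintegral_Ioc_rpow {a Λ : ℝ} (ha : -1 < a) (hΛ : 0 ≤ Λ) :
    ∫⁻ t in Ioc 0 Λ, ENNReal.ofReal (t ^ a) = ENNReal.ofReal (Λ ^ (a + 1) / (a + 1)) := by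
  have hi : IntervalIntegrable (fun t : ℝ => t ^ a) volume 0 Λ :=
    intervalIntegral.intervalIntegrable_rpow' ha
  rw [← ofReal_integral_eq_lintegral_ofReal]
  · rw [← intervalIntegral.integral_of_le hΛ, integral_rpow (Or.inl ha),
      Real.zero_rpow (by linarith), sub_zero]
  · exact (intervalIntegrable_iff_integrableOn_Ioc_of_le hΛ).1 hi
  · filter_upwards [ae_restrict_mem measurableSet_Ioc] with t ht
    have := ht.1
    positivity

/-- Layer-cake formula, with the level-set estimate applied at each level t with its own frequency
threshold. After Tonelli, a fixed frequency ξ sees only the levels t ≤ Λ(ξ), and integrating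
4t^(q-3) over them produces the energy weight. -/
theorem lintegral_rpow_abs_le (hs0 : 0 < s) (hs1 : s < 1) (hN : 2 * s < (N : ℝ))
    (hu : MemLp u 2 volume) (h : IsHalfLap s u w) {W : ℝ} (hW : 0 < W)
    (hw : eLpNorm w 2 volume ≤ ENNReal.ofReal W) :
    ∫⁻ x, ENNReal.ofReal (|u x| ^ critExp N s) ≤
      ENNReal.ofReal (4 * critExp N s / (critExp N s - 2) * (2 * lowConst N s) ^ (critExp N s - 2) *
        W ^ critExp N s) := by
  set q := critExp N s with hq
  set c := lowConst N s with hc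
  have hq2 : 2 < q := two_lt_critExp hs0 hN
  have hc0 : 0 < c := lowConst_pos
  set e := ((N : ℝ) - 2 * s) / 2 with he
  have he0 : 0 < e := by simp only [he]; linarith
  set F := hat hu with hF
  set Λ : RN N → ℝ := fun ξ => 2 * c * W * ‖ξ‖ ^ e with hΛ
  have hΛ0 : ∀ ξ, 0 ≤ Λ ξ := fun ξ => by simp only [hΛ]; positivity
  have hΛm : Measurable Λ := by simp only [hΛ]; fun_prop
  have hFm : AEMeasurable (fun ξ => ‖F ξ‖ₑ ^ (2 : ℝ)) volume :=
    (Lp.aestronglyMeasurable F).enorm.pow_const _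
  set G : ℝ → RN N → ℝ≥0∞ := fun t ξ => (Iic (Λ ξ)).indicator
    (fun t => ENNReal.ofReal (4 * t ^ (q - 3))) t * ‖F ξ‖ₑ ^ (2 : ℝ) with hG
  have hlevel : ∀ t ∈ Ioi (0 : ℝ), volume {x | t < |u x|} * ENNReal.ofReal (t ^ (q - 1)) ≤
      ∫⁻ ξ, G t ξ := by
    intro t ht
    have ht0 : 0 < t := ht
    -- This A gives equality in the low-frequency condition c A^e W ≤ t/2.
    set A := (t / (2 * c * W)) ^ (1 / e) with hA
    have hA0 : 0 < A := by positivity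
    have hAe : A ^ e = t / (2 * c * W) := by
      rw [hA, ← Real.rpow_mul (by positivity), one_div_mul_cancel he0.ne', Real.rpow_one]
    have hb := measure_lt_abs_le hs0 hs1 hN hu h hA0 ht0 hw (by
      rw [← he, hAe, ← hc]; apply le_of_eq; field_simp)
    have hset : ∀ ξ : RN N, A ≤ ‖ξ‖ ↔ t ≤ Λ ξ := by
      intro ξ
      rw [← Real.rpow_le_rpow_iff hA0.le (norm_nonneg ξ) he0, hAe, div_le_iff₀ (by positivity)]
      simp only [hΛ]
      rw [mul_comm]
    calc volume {x | t < |u x|} * ENNReal.ofReal (t ^ (q - 1))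
        ≤ (ENNReal.ofReal (4 / t ^ 2) * ∫⁻ ξ, {ξ : RN N | A ≤ ‖ξ‖}.indicator
            (fun ξ => ‖F ξ‖ₑ ^ (2 : ℝ)) ξ) * ENNReal.ofReal (t ^ (q - 1)) := by gcongr
      _ = ENNReal.ofReal (4 * t ^ (q - 3)) * ∫⁻ ξ, {ξ : RN N | A ≤ ‖ξ‖}.indicator
            (fun ξ => ‖F ξ‖ₑ ^ (2 : ℝ)) ξ := by
          rw [mul_right_comm, ← ENNReal.ofReal_mul (by positivity)]
          congr 2
          rw [show q - 1 = (q - 3) + 2 by ring, Real.rpow_add ht0,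
            show t ^ (2 : ℝ) = t ^ 2 by rw [← Real.rpow_natCast]; norm_num]
          field_simp
      _ = ∫⁻ ξ, G t ξ := by
          rw [← lintegral_const_mul' _ _ ENNReal.ofReal_ne_top]
          congr 1; ext ξ
          simp only [hG]
          by_cases hm : A ≤ ‖ξ‖
          · have hm' := (hset ξ).1 hm
            simp [indicator, hm, hm']
          · have hm' : ¬ t ≤ Λ ξ := fun h' => hm ((hset ξ).2 h')
            simp [indicator, hm, hm']
  have hGm : AEMeasurable (Function.uncurry G) ((volume.restrict (Ioi 0)).prod volume) := by
    refine AEMeasurable.mul ?_ hFm.comp_snd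
    refine Measurable.aemeasurable ?_
    have hS : MeasurableSet {p : ℝ × RN N | p.1 ≤ Λ p.2} :=
      measurableSet_le measurable_fst (hΛm.comp measurable_snd)
    have hm : Measurable fun p : ℝ × RN N => ENNReal.ofReal (4 * p.1 ^ (q - 3)) := by fun_prop
    exact hm.indicator hS
  -- The exponent q - 3 exceeds -1, so the t-integral converges at 0 and equals 4Λ^(q-2)/(q-2),
  -- where e(q-2) = 2s.
  have hinner : ∀ ξ, ∫⁻ t in Ioi (0 : ℝ), G t ξ =
      ENNReal.ofReal (4 / (q - 2) * (2 * c * W) ^ (q - 2)) *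
        (ENNReal.ofReal (‖ξ‖ ^ s) * ‖F ξ‖ₑ) ^ (2 : ℝ) := by
    intro ξ
    simp only [hG]
    rw [lintegral_mul_const' _ _ (by finiteness), ENNReal.mul_rpow_of_nonneg _ _ (by norm_num),
      ← mul_assoc, lintegral_indicator measurableSet_Iic, Measure.restrict_restrict measurableSet_Iic,
      inter_comm, Ioi_inter_Iic]
    congr 1
    have : ∀ t, ENNReal.ofReal (4 * t ^ (q - 3)) = ENNReal.ofReal 4 * ENNReal.ofReal (t ^ (q - 3)) :=
      fun t => ENNReal.ofReal_mul (by norm_num)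
    simp only [this]
    rw [lintegral_const_mul' _ _ ENNReal.ofReal_ne_top, lintegral_Ioc_rpow (by linarith) (hΛ0 ξ),
      ENNReal.ofReal_rpow_of_nonneg (by positivity) (by norm_num), ← ENNReal.ofReal_mul (by norm_num),
      ← ENNReal.ofReal_mul (by positivity [sub_pos.2 hq2])]
    congr 1
    rw [show q - 3 + 1 = q - 2 by ring]
    simp only [hΛ]
    rw [Real.mul_rpow (by positivity) (by positivity), ← Real.rpow_mul (norm_nonneg _),
      critExp_sub_two_mul hN, Real.rpow_mul (norm_nonneg _)]
    ring
  calc ∫⁻ x, ENNReal.ofReal (|u x| ^ q)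
      = ENNReal.ofReal q * ∫⁻ t in Ioi 0, volume {x | t < |u x|} * ENNReal.ofReal (t ^ (q - 1)) :=
        lintegral_rpow_eq_lintegral_meas_lt_mul volume (Eventually.of_forall fun x => abs_nonneg _)
          hu.1.aemeasurable.norm (by linarith)
    _ ≤ ENNReal.ofReal q * ∫⁻ t in Ioi 0, ∫⁻ ξ, G t ξ := by
        exact mul_le_mul' le_rfl (setLIntegral_mono' measurableSet_Ioi hlevel)
    _ = ENNReal.ofReal q * ∫⁻ ξ, ∫⁻ t in Ioi 0, G t ξ := by
        rw [lintegral_lintegral_swap hGm]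
    _ ≤ ENNReal.ofReal q * (ENNReal.ofReal (4 / (q - 2) * (2 * c * W) ^ (q - 2)) *
          ENNReal.ofReal (W ^ (2 : ℝ))) := by
        gcongr
        simp only [hinner]
        rw [lintegral_const_mul' _ _ ENNReal.ofReal_ne_top]
        gcongr
        refine (lintegral_norm_rpow_mul_hat_le hs0 hs1 hu h).trans ?_
        rw [← ENNReal.ofReal_rpow_of_nonneg hW.le (by norm_num)]
        gcongr
    _ = _ := by
        have hq20 : 0 < q - 2 := by linarith
        rw [← ENNReal.ofReal_mul (by positivity), ← ENNReal.ofReal_mul (by positivity)]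
        congr 1
        rw [Real.mul_rpow (by positivity) hW.le]
        have : W ^ q = W ^ (q - 2) * W ^ (2 : ℝ) := by rw [← Real.rpow_add hW]; congr 1; ring
        rw [this]; ring

/-- The fractional Sobolev inequality on `H^s`. -/
theorem exists_sobolev_Hs (hs0 : 0 < s) (hs1 : s < 1) (hN : 2 * s < (N : ℝ)) :
    ∃ C : ℝ≥0∞, C ≠ ∞ ∧ ∀ u w : RN N → ℝ, MemLp u 2 volume → IsHalfLap s u w →
      eLpNorm u (ENNReal.ofReal (critExp N s)) volume ≤ C * eLpNorm w 2 volume := by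
  set q := critExp N s with hq
  have hq2 : 2 < q := two_lt_critExp hs0 hN
  have hq0 : 0 < q := by linarith
  have hq20 : 0 < q - 2 := by linarith
  have hc0 : 0 < lowConst N s := lowConst_pos
  set D : ℝ := 4 * q / (q - 2) * (2 * lowConst N s) ^ (q - 2) with hD
  have hD0 : 0 ≤ D := by positivity
  refine ⟨ENNReal.ofReal (D ^ (1 / q)), ENNReal.ofReal_ne_top, fun u w hu h => ?_⟩
  have key : ∀ W : ℝ, 0 < W → eLpNorm w 2 volume ≤ ENNReal.ofReal W →
      eLpNorm u (ENNReal.ofReal q) volume ≤ ENNReal.ofReal (D ^ (1 / q) * W) := by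
    intro W hW hw
    rw [eLpNorm_eq_lintegral_rpow_enorm_toReal (by simpa using hq0) ENNReal.ofReal_ne_top,
      ENNReal.toReal_ofReal hq0.le]
    have e : ∀ x, ‖u x‖ₑ ^ q = ENNReal.ofReal (|u x| ^ q) := fun x => by
      rw [← ENNReal.ofReal_rpow_of_nonneg (abs_nonneg _) hq0.le, ← Real.norm_eq_abs, ofReal_norm]
    simp only [e]
    refine (ENNReal.rpow_le_rpow (lintegral_rpow_abs_le hs0 hs1 hN hu h hW hw)
      (by positivity)).trans (le_of_eq ?_)
    rw [ENNReal.ofReal_rpow_of_nonneg (by positivity) (by positivity),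
      Real.mul_rpow (by positivity) (by positivity), ← Real.rpow_mul hW.le,
      mul_one_div_cancel hq0.ne', Real.rpow_one]
  have hwf : eLpNorm w 2 volume ≠ ∞ := h.1.eLpNorm_ne_top
  set W₀ := (eLpNorm w 2 volume).toReal with hW₀
  -- The bound needs W > 0, whereas the norm of w may vanish; it is used at W₀ + ε with ε ↓ 0.
  have hlim : Tendsto (fun ε : ℝ => ENNReal.ofReal (D ^ (1 / q) * (W₀ + ε))) (𝓝[>] 0)
      (𝓝 (ENNReal.ofReal (D ^ (1 / q) * (W₀ + 0)))) := by
    refine Tendsto.mono_left ?_ nhdsWithin_le_nhds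
    exact (ENNReal.continuous_ofReal.comp (by fun_prop)).tendsto 0
  have hfin : ENNReal.ofReal (D ^ (1 / q)) * eLpNorm w 2 volume =
      ENNReal.ofReal (D ^ (1 / q) * (W₀ + 0)) := by
    rw [add_zero, ENNReal.ofReal_mul (by positivity), hW₀, ENNReal.ofReal_toReal hwf]
  rw [hfin]
  refine ge_of_tendsto hlim ?_
  filter_upwards [self_mem_nhdsWithin] with ε hε
  have hε0 : 0 < ε := hε
  refine key _ (add_pos_of_nonneg_of_pos ENNReal.toReal_nonneg hε0) ?_
  rw [← ENNReal.ofReal_toReal hwf]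
  exact ENNReal.ofReal_le_ofReal (by linarith)

end Sobolev
end FracCC

namespace FracCC

open scoped ENNReal NNReal FourierTransform

/-! ### The Sobolev inequality on Ḣ^s -/

section SobolevHdot

variable {N : ℕ} [NeZero N] {s : ℝ} {u w : RN N → ℝ}

theorem tendsto_eLpNorm_indicator_compl_ball {p : ℝ≥0∞} (hp : p ≠ 0) (hp' : p ≠ ∞)
    (hu : MemLp u p volume) :
    Tendsto (fun n : ℕ => eLpNorm (((Metric.ball (0 : RN N) n)ᶜ).indicator u) p volume) atTop
      (𝓝 0) := by
  simp only [eLpNorm_eq_lintegral_rpow_enorm_toReal hp hp']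
  have hp0 : 0 < p.toReal := ENNReal.toReal_pos hp hp'
  have h0 : Tendsto (fun n : ℕ => ∫⁻ x, ‖((Metric.ball (0 : RN N) n)ᶜ).indicator u x‖ₑ ^ p.toReal)
      atTop (𝓝 (∫⁻ _ : RN N, 0)) := by
    refine tendsto_lintegral_of_dominated_convergence' (fun x => ‖u x‖ₑ ^ p.toReal) ?_ ?_ ?_ ?_
    · exact fun n => (hu.1.indicator Metric.isOpen_ball.measurableSet.compl).enorm.pow_const _
    · intro n
      refine Eventually.of_forall fun x => ?_
      simp only
      gcongr
      exact enorm_indicator_le_enorm_self _ _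
    · exact (lintegral_rpow_enorm_lt_top_of_eLpNorm_lt_top hp hp' hu.2).ne
    · refine Eventually.of_forall fun x => tendsto_const_nhds.congr' ?_
      obtain ⟨n₀, hn₀⟩ := exists_nat_gt ‖x‖
      filter_upwards [eventually_ge_atTop n₀] with n hn
      have : x ∉ (Metric.ball (0 : RN N) n)ᶜ := by
        have h2 : (n₀ : ℝ) ≤ n := by exact_mod_cast hn
        simpa using hn₀.trans_le h2
      rw [indicator_of_notMem this, enorm_zero, ENNReal.zero_rpow_of_pos hp0]
  rw [lintegral_zero] at h0
  have h1 := (ENNReal.continuous_rpow_const (y := 1 / p.toReal)).tendsto 0 |>.comp h0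
  rw [ENNReal.zero_rpow_of_pos (by positivity)] at h1
  exact h1

theorem two_le_ofReal_critExp (hs0 : 0 < s) (hN : 2 * s < (N : ℝ)) :
    2 ≤ ENNReal.ofReal (critExp N s) := by
  rw [show (2 : ℝ≥0∞) = ENNReal.ofReal 2 by norm_num]
  exact ENNReal.ofReal_le_ofReal (two_lt_critExp hs0 hN).le

theorem half_sub_inv_critExp (hs0 : 0 < s) (hN : 2 * s < (N : ℝ)) :
    1 / (2 : ℝ) - 1 / (ENNReal.ofReal (critExp N s)).toReal = s / N := by
  have h2 := two_lt_critExp hs0 hN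
  rw [ENNReal.toReal_ofReal (by linarith), critExp]
  have hN0 : (N : ℝ) ≠ 0 := by exact_mod_cast NeZero.ne N
  have : (N : ℝ) - 2 * s ≠ 0 := by linarith
  field_simp
  ring

theorem volume_ball_rpow (hs0 : 0 < s) {R : ℝ} (hR : 0 < R) :
    volume (Metric.ball (0 : RN N) R) ^ (s / (N : ℝ)) =
      ENNReal.ofReal (R ^ s) * volume (Metric.ball (0 : RN N) 1) ^ (s / (N : ℝ)) := by
  have hN0 : (N : ℝ) ≠ 0 := by exact_mod_cast NeZero.ne N
  rw [Measure.addHaar_ball volume (0 : RN N) hR.le, ENNReal.mul_rpow_of_nonneg _ _ (by positivity),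
    ENNReal.ofReal_rpow_of_nonneg (by positivity) (by positivity)]
  congr 2
  rw [finrank_euclideanSpace, Fintype.card_fin, ← Real.rpow_natCast, ← Real.rpow_mul hR.le]
  congr 1
  field_simp

/-- Take ρ = 2R. Hölder at the critical exponent costs |B_R|^(s/N), proportional to R^s, which
cancels the kernel mass R^(-s). Splitting u at a second radius M leaves R^(-s) only on an L² term
over B_M; the other terms are tails of u in the critical space. -/
theorem IsCutoff.eLpNorm_commutator_le_scale (hs0 : 0 < s) (hs1 : s < 1) (hN : 2 * s < (N : ℝ))
    {ψ : RN N → ℝ} {A R : ℝ} (h : IsCutoff ψ A R)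
    (hu : AEStronglyMeasurable u volume) (M : ℝ) :
    eLpNorm (commutator s ψ u) 2 volume ≤ ‖fracConst N (s / 2)‖ₑ * (ENNReal.ofReal A *
      ((∫⁻ y, ekern N s 1 y) * (2 * (ENNReal.ofReal (R ^ (-s)) *
        eLpNorm ((Metric.ball (0 : RN N) M).indicator u) 2 volume +
        ENNReal.ofReal (2 ^ s) * volume (Metric.ball (0 : RN N) 1) ^ (s / (N : ℝ)) *
          eLpNorm (((Metric.ball (0 : RN N) M)ᶜ).indicator u) (ENNReal.ofReal (critExp N s)) volume) +
        volume (Metric.ball (0 : RN N) 1) ^ (s / (N : ℝ)) *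
          eLpNorm (((Metric.ball (0 : RN N) (2 * R))ᶜ).indicator u)
            (ENNReal.ofReal (critExp N s)) volume))) := by
  have hR := h.pos
  set q := ENNReal.ofReal (critExp N s) with hq
  have hq2 : 2 ≤ q := two_le_ofReal_critExp hs0 hN
  have hqe : 1 / (2 : ℝ) - 1 / q.toReal = s / N := half_sub_inv_critExp hs0 hN
  set v := volume (Metric.ball (0 : RN N) 1) ^ (s / (N : ℝ)) with hv
  have hRR : ENNReal.ofReal (R ^ (-s)) * ENNReal.ofReal (R ^ s) = 1 := by
    rw [← ENNReal.ofReal_mul (by positivity), ← Real.rpow_add hR]; simp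
  refine (h.eLpNorm_commutator_le hs0 hs1 (by linarith : R ≤ 2 * R) hu hq2
    ENNReal.ofReal_ne_top).trans ?_
  refine mul_le_mul' le_rfl (mul_le_mul' le_rfl ?_)
  rw [mul_add]
  refine add_le_add ?_ ?_
  · have hsplit : eLpNorm ((Metric.ball (0 : RN N) (2 * R)).indicator u) 2 volume ≤
        eLpNorm ((Metric.ball (0 : RN N) M).indicator u) 2 volume +
        eLpNorm (((Metric.ball (0 : RN N) M)ᶜ).indicator u) q volume *
          (ENNReal.ofReal ((2 * R) ^ s) * v) := by
      have hB : MeasurableSet (Metric.ball (0 : RN N) M) := Metric.isOpen_ball.measurableSet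
      have hB' : MeasurableSet (Metric.ball (0 : RN N) (2 * R)) := Metric.isOpen_ball.measurableSet
      have e : (Metric.ball (0 : RN N) (2 * R)).indicator u =
          (Metric.ball (0 : RN N) (2 * R)).indicator ((Metric.ball (0 : RN N) M).indicator u) +
          (Metric.ball (0 : RN N) (2 * R)).indicator (((Metric.ball (0 : RN N) M)ᶜ).indicator u) := by
        rw [← indicator_add', indicator_self_add_compl]
      rw [e]
      refine (eLpNorm_add_le ((hu.indicator hB).indicator hB')
        ((hu.indicator hB.compl).indicator hB') (by norm_num)).trans (add_le_add ?_ ?_)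
      · exact eLpNorm_indicator_le _
      · rw [← volume_ball_rpow hs0 (by positivity), ← hqe]
        exact eLpNorm_ball_indicator_le (hu.indicator hB.compl) hq2 _
    rw [lintegral_ekern hs0 hs1 hR]
    refine (mul_le_mul' le_rfl hsplit).trans (le_of_eq ?_)
    rw [Real.mul_rpow (by norm_num) hR.le, ENNReal.ofReal_mul (by positivity)]
    set κ := ∫⁻ y, ekern N s 1 y
    set x := ENNReal.ofReal (R ^ (-s))
    set y := ENNReal.ofReal (R ^ s)
    set a := eLpNorm ((Metric.ball (0 : RN N) M).indicator u) 2 volume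
    set b := eLpNorm (((Metric.ball (0 : RN N) M)ᶜ).indicator u) q volume
    set c := ENNReal.ofReal (2 ^ s)
    calc 2 * (x * κ) * (a + b * (c * y * v)) = 2 * κ * (x * a) + 2 * κ * (b * c * v * (x * y)) := by ring
      _ = _ := by rw [hRR]; ring
  · rw [hqe, volume_ball_rpow hs0 hR, ← mul_assoc, ← hv]
    refine mul_le_mul' ?_ le_rfl
    refine (mul_le_mul' le_rfl (lintegral_mono (ekernTail_le _))).trans (le_of_eq ?_)
    rw [lintegral_ekern hs0 hs1 hR]
    calc ENNReal.ofReal (R ^ s) * v * (ENNReal.ofReal (R ^ (-s)) * ∫⁻ y, ekern N s 1 y)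
        = (ENNReal.ofReal (R ^ (-s)) * ENNReal.ofReal (R ^ s)) * ((∫⁻ y, ekern N s 1 y) * v) := by ring
      _ = _ := by rw [hRR, one_mul]

/-- A bump function equal to one on the unit ball. -/
theorem exists_unit_cutoff (N : ℕ) : ∃ (ψ : RN N → ℝ) (A R : ℝ), IsCutoff ψ A R ∧
    (∀ x, 0 ≤ ψ x ∧ ψ x ≤ 1) ∧ ∀ x ∈ Metric.ball (0 : RN N) 1, ψ x = 1 := by
  let b : ContDiffBump (0 : RN N) := ⟨1, 2, one_pos, by norm_num⟩
  obtain ⟨A, R, h⟩ := exists_isCutoff b.contDiff b.hasCompactSupport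
  exact ⟨b, A, R, h, fun x => ⟨b.nonneg, b.le_one⟩, fun x hx =>
    b.one_of_mem_closedBall (Metric.ball_subset_closedBall hx)⟩

theorem IsCutoff.memLp_mul {ψ : RN N → ℝ} {A R : ℝ} (h : IsCutoff ψ A R) {p q : ℝ≥0∞}
    (hpq : p ≤ q) (hu : MemLp u q volume) : MemLp (fun x => ψ x * u x) p volume := by
  have hcont := h.contDiff.continuous
  obtain ⟨M, hM⟩ := (h.hasCompactSupport.isCompact_range hcont).isBounded.exists_norm_le
  have h1 : MemLp (fun x => ψ x * u x) q volume := by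
    refine hu.of_le_mul (c := M) (hcont.aestronglyMeasurable.mul hu.1)
      (Eventually.of_forall fun x => ?_)
    rw [norm_mul]
    gcongr
    exact hM (ψ x) ⟨x, rfl⟩
  refine h1.mono_exponent_of_measure_support_ne_top (s := Metric.ball (0 : RN N) R) (fun x hx => ?_)
    measure_ball_lt_top.ne hpq
  rw [h.zero x hx, zero_mul]

/-- The fractional Sobolev inequality on the homogeneous space. -/
theorem exists_sobolev_Hdot (hs0 : 0 < s) (hs1 : s < 1) (hN : 2 * s < (N : ℝ)) :
    ∃ C : ℝ≥0∞, C ≠ ∞ ∧ ∀ u w : RN N → ℝ, MemLp u (ENNReal.ofReal (critExp N s)) volume →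
      IsHalfLap s u w →
      eLpNorm u (ENNReal.ofReal (critExp N s)) volume ≤ C * eLpNorm w 2 volume := by
  obtain ⟨C, hC, hsob⟩ := exists_sobolev_Hs (N := N) hs0 hs1 hN
  refine ⟨C, hC, fun u w hu h => ?_⟩
  set q := ENNReal.ofReal (critExp N s) with hq
  have hq2 : 2 ≤ q := two_le_ofReal_critExp hs0 hN
  have hq0 : q ≠ 0 := (lt_of_lt_of_le (by norm_num) hq2).ne'
  have hqt : q ≠ ∞ := ENNReal.ofReal_ne_top
  obtain ⟨ψ, A, R, hψ, hψ01, hψ1⟩ := exists_unit_cutoff N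
  set r : ℕ → ℝ := fun n => (n : ℝ) + 1 with hr
  have hr0 : ∀ n, 0 < r n := fun n => by simp only [hr]; positivity
  set ψn : ℕ → RN N → ℝ := fun n x => ψ ((r n)⁻¹ • x) with hψn
  have hcut : ∀ n, IsCutoff (ψn n) A (r n * R) := fun n => hψ.comp_smul (hr0 n)
  have hR := hψ.pos
  set v := volume (Metric.ball (0 : RN N) 1) ^ (s / (N : ℝ)) with hv
  have hvt : v ≠ ∞ := ENNReal.rpow_ne_top_of_nonneg (by positivity) measure_ball_lt_top.ne
  set κ := ∫⁻ y, ekern N s 1 y with hκ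
  have hκt : κ ≠ ∞ := lintegral_ekern_ne_top hs0 hs1 one_pos
  set T : ℝ → ℝ≥0∞ := fun M => eLpNorm (((Metric.ball (0 : RN N) M)ᶜ).indicator u) q volume with hT
  have hTlim : Tendsto (fun n : ℕ => T n) atTop (𝓝 0) :=
    tendsto_eLpNorm_indicator_compl_ball hq0 hqt hu
  have hTanti : Antitone T := fun M M' hMM' => by
    refine eLpNorm_mono_enorm fun x => ?_
    simp only [enorm_indicator_eq_indicator_enorm]
    refine indicator_le_indicator_of_subset ?_ (fun _ => zero_le) x
    exact compl_subset_compl.2 (Metric.ball_subset_ball hMM')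
  have hTlim' : Tendsto T atTop (𝓝 0) := by
    refine ENNReal.tendsto_nhds_zero.2 fun ε hε => ?_
    obtain ⟨n, hn⟩ := (ENNReal.tendsto_nhds_zero.1 hTlim ε hε).exists
    filter_upwards [eventually_ge_atTop (n : ℝ)] with M hM
    exact (hTanti hM).trans hn
  set K := ‖fracConst N (s / 2)‖ₑ with hK
  -- The product ψ_n u has compact support and so lies in L²: the inequality on H^s applies to it,
  -- with the commutator as error.
  have hbound : ∀ (M : ℝ) (n : ℕ), eLpNorm (fun x => ψn n x * u x) q volume ≤
      C * (eLpNorm w 2 volume + K * (ENNReal.ofReal A * (κ * (2 * (ENNReal.ofReal ((r n * R) ^ (-s)) *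
        eLpNorm ((Metric.ball (0 : RN N) M).indicator u) 2 volume +
        ENNReal.ofReal (2 ^ s) * v * T M) + v * T (2 * (r n * R)))))) := by
    intro M n
    have hl := h.cutoff_mul hs0 hs1 (hcut n) hq2 hqt hu
    refine (hsob _ _ ((hcut n).memLp_mul hq2 hu) hl).trans (mul_le_mul' le_rfl ?_)
    have hm := (hcut n).memLp_commutator hs0 hs1 hq2 hqt hu
    have hm1 : AEStronglyMeasurable (fun x => ψn n x * w x) volume :=
      (hcut n).contDiff.continuous.aestronglyMeasurable.mul h.1.1
    refine (eLpNorm_sub_le hm1 hm.1 (by norm_num)).trans (add_le_add ?_ ?_)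
    · refine eLpNorm_mono fun x => ?_
      rw [norm_mul]
      refine mul_le_of_le_one_left (norm_nonneg _) ?_
      rw [Real.norm_of_nonneg (hψ01 _).1]
      exact (hψ01 _).2
    · exact (hcut n).eLpNorm_commutator_le_scale hs0 hs1 hN hu.1 M
  have hrR : Tendsto (fun n => r n * R) atTop atTop :=
    (tendsto_natCast_atTop_atTop.atTop_add tendsto_const_nhds).atTop_mul_const hR
  have hfatou : eLpNorm u q volume ≤ liminf (fun n => eLpNorm (fun x => ψn n x * u x) q volume) atTop := by
    refine Lp.eLpNorm_lim_le_liminf_eLpNorm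
      (fun n => (hcut n).contDiff.continuous.aestronglyMeasurable.mul hu.1) u
      (Eventually.of_forall fun x => tendsto_const_nhds.congr' ?_)
    obtain ⟨n₀, hn₀⟩ := exists_nat_gt ‖x‖
    filter_upwards [eventually_ge_atTop n₀] with n hn
    have h2 : (n₀ : ℝ) ≤ n := by exact_mod_cast hn
    have : ψn n x = 1 := by
      refine hψ1 _ ?_
      simp only [Metric.mem_ball, dist_zero_right, norm_smul, norm_inv, Real.norm_of_nonneg (hr0 n).le]
      rw [inv_mul_lt_iff₀ (hr0 n), mul_one]
      simp only [hr]; linarith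
    rw [Pi.mul_apply, this, one_mul]
  -- First n → ∞ at fixed M, where Fatou recovers u on the left; afterwards M → ∞ removes the tail T
  -- M.
  have hM : ∀ M : ℝ, eLpNorm u q volume ≤
      C * (eLpNorm w 2 volume + K * (ENNReal.ofReal A * (κ * (2 *
        (ENNReal.ofReal (2 ^ s) * v * T M))))) := by
    intro M
    refine hfatou.trans ?_
    have hat : eLpNorm ((Metric.ball (0 : RN N) M).indicator u) 2 volume ≠ ∞ := by
      refine ((eLpNorm_ball_indicator_le hu.1 hq2 M).trans_lt (ENNReal.mul_lt_top hu.2 ?_)).ne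
      exact (volume_ball_rpow_ne_top hq2 hqt M).lt_top
    have l1 : Tendsto (fun n => ENNReal.ofReal ((r n * R) ^ (-s)) *
        eLpNorm ((Metric.ball (0 : RN N) M).indicator u) 2 volume) atTop (𝓝 0) := by
      have h1 : Tendsto (fun n => ENNReal.ofReal ((r n * R) ^ (-s))) atTop (𝓝 0) := by
        have := ENNReal.tendsto_ofReal ((tendsto_rpow_neg_atTop hs0).comp hrR)
        rwa [ENNReal.ofReal_zero] at this
      simpa using ENNReal.Tendsto.mul_const h1 (Or.inr hat)
    have l2 : Tendsto (fun n => T (2 * (r n * R))) atTop (𝓝 0) :=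
      hTlim'.comp (hrR.const_mul_atTop (by norm_num))
    have l3 : Tendsto (fun n => C * (eLpNorm w 2 volume + K * (ENNReal.ofReal A * (κ * (2 *
        (ENNReal.ofReal ((r n * R) ^ (-s)) *
        eLpNorm ((Metric.ball (0 : RN N) M).indicator u) 2 volume +
        ENNReal.ofReal (2 ^ s) * v * T M) + v * T (2 * (r n * R))))))) atTop
        (𝓝 (C * (eLpNorm w 2 volume + K * (ENNReal.ofReal A * (κ * (2 *
        (0 + ENNReal.ofReal (2 ^ s) * v * T M) + v * 0)))))) := by
      refine ENNReal.Tendsto.const_mul (tendsto_const_nhds.add (ENNReal.Tendsto.const_mul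
        (ENNReal.Tendsto.const_mul (ENNReal.Tendsto.const_mul ((ENNReal.Tendsto.const_mul
        (l1.add tendsto_const_nhds) (Or.inr (by norm_num))).add (ENNReal.Tendsto.const_mul l2
          (Or.inr hvt))) (Or.inr hκt)) (Or.inr ENNReal.ofReal_ne_top)) (Or.inr enorm_ne_top)))
        (Or.inr hC)
    rw [zero_add, mul_zero, add_zero] at l3
    rw [← l3.liminf_eq]
    exact liminf_le_liminf (Eventually.of_forall fun n => hbound M n)
  have l4 : Tendsto (fun M => C * (eLpNorm w 2 volume + K * (ENNReal.ofReal A * (κ * (2 *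
        (ENNReal.ofReal (2 ^ s) * v * T M)))))) atTop
      (𝓝 (C * (eLpNorm w 2 volume + K * (ENNReal.ofReal A * (κ * (2 *
        (ENNReal.ofReal (2 ^ s) * v * 0))))))) := by
    refine ENNReal.Tendsto.const_mul (tendsto_const_nhds.add (ENNReal.Tendsto.const_mul
        (ENNReal.Tendsto.const_mul (ENNReal.Tendsto.const_mul (ENNReal.Tendsto.const_mul
        (ENNReal.Tendsto.const_mul hTlim' (Or.inr ?_)) (Or.inr (by norm_num))) (Or.inr hκt))
        (Or.inr ENNReal.ofReal_ne_top)) (Or.inr enorm_ne_top))) (Or.inr hC)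
    finiteness
  simp only [mul_zero, add_zero] at l4
  exact ge_of_tendsto' l4 hM

end SobolevHdot
end FracCC

namespace FracCC

open scoped ENNReal NNReal FourierTransform

/-! ### Completeness of Ḣ^s and the consequences of weak convergence -/

section WeakConvergence

variable {N : ℕ} [NeZero N] {s : ℝ} {u u' w : RN N → ℝ}

/-- The critical exponent as an extended non-negative real. -/
noncomputable abbrev critE (N : ℕ) (s : ℝ) : ℝ≥0∞ := ENNReal.ofReal (critExp N s)

theorem one_lt_critE (hs0 : 0 < s) (hN : 2 * s < (N : ℝ)) : 1 < critE N s :=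
  lt_of_lt_of_le (by norm_num) (two_le_ofReal_critExp hs0 hN)

/-- The Sobolev inequality for u - u', whose (-Δ)^(s/2) vanishes. -/
theorem IsHalfLap.ae_unique_left (hs0 : 0 < s) (hs1 : s < 1) (hN : 2 * s < (N : ℝ))
    (hu : MemLp u (critE N s) volume) (hu' : MemLp u' (critE N s) volume)
    (h : IsHalfLap s u w) (h' : IsHalfLap s u' w) : u =ᵐ[volume] u' := by
  obtain ⟨C, hC, hsob⟩ := exists_sobolev_Hdot (N := N) hs0 hs1 hN
  have hp := one_lt_critE hs0 hN
  have h2 := hsob _ _ (hu.sub hu') (h.sub hs0 hs1 hp hu hu' h')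
  rw [sub_self, eLpNorm_zero, mul_zero, nonpos_iff_eq_zero,
    eLpNorm_eq_zero_iff (hu.sub hu').1 (zero_lt_one.trans hp).ne'] at h2
  filter_upwards [h2] with x hx
  simpa [sub_eq_zero] using hx

/-- The range of `(-Δ)^(s/2)` on the homogeneous Sobolev space, as a subspace of `L²`. -/
def halfLapRange (hs0 : 0 < s) (hs1 : s < 1) (hN : 2 * s < (N : ℝ)) :
    Submodule ℝ (Lp ℝ 2 (volume : Measure (RN N))) where
  carrier := {f | ∃ u, MemLp u (critE N s) volume ∧ IsHalfLap s u f}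
  add_mem' := by
    rintro f g ⟨u, hu, h⟩ ⟨v, hv, h'⟩
    exact ⟨u + v, hu.add hv, (h.add hs0 hs1 (one_lt_critE hs0 hN) hu hv h').congr_right
      (Lp.coeFn_add f g).symm⟩
  zero_mem' := by
    refine ⟨0, MemLp.zero, Lp.memLp _, fun φ => ?_⟩
    rw [integral_eq_zero_of_ae, integral_eq_zero_of_ae]
    · exact Eventually.of_forall fun x => by simp
    · exact Eventually.of_forall fun x => by simp
  smul_mem' := by
    rintro c f ⟨u, hu, h⟩
    exact ⟨c • u, hu.const_smul c, (h.const_smul c).congr_right (Lp.coeFn_smul c f).symm⟩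

/-- The inverse of `(-Δ)^(s/2)`, a choice of representative. -/
noncomputable def preimage (hs0 : 0 < s) (hs1 : s < 1) (hN : 2 * s < (N : ℝ))
    (f : halfLapRange hs0 hs1 hN) : RN N → ℝ := f.2.choose

theorem memLp_preimage (hs0 : 0 < s) (hs1 : s < 1) (hN : 2 * s < (N : ℝ))
    (f : halfLapRange hs0 hs1 hN) :
    MemLp (preimage hs0 hs1 hN f) (critE N s) volume := f.2.choose_spec.1

theorem isHalfLap_preimage (hs0 : 0 < s) (hs1 : s < 1) (hN : 2 * s < (N : ℝ))
    (f : halfLapRange hs0 hs1 hN) :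
    IsHalfLap s (preimage hs0 hs1 hN f) f.1 := f.2.choose_spec.2

/-- The Sobolev inequality bounds the inverse from its range in L² into the critical space.
Injectivity makes the chosen preimages linear and independent of the choice. -/
theorem exists_inverse (hs0 : 0 < s) (hs1 : s < 1) (hN : 2 * s < (N : ℝ))
    [Fact (1 ≤ critE N s)] :
    ∃ S : halfLapRange hs0 hs1 hN →L[ℝ] Lp ℝ (critE N s) (volume : Measure (RN N)),
      ∀ (f : halfLapRange hs0 hs1 hN) (u : RN N → ℝ), MemLp u (critE N s) volume →
        IsHalfLap s u f.1 → S f =ᵐ[volume] u := by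
  obtain ⟨C, hC, hsob⟩ := exists_sobolev_Hdot (N := N) hs0 hs1 hN
  have hp := one_lt_critE (N := N) hs0 hN
  have key : ∀ (f : halfLapRange hs0 hs1 hN) (u : RN N → ℝ), MemLp u (critE N s) volume →
      IsHalfLap s u f.1 → (memLp_preimage hs0 hs1 hN f).toLp _ =ᵐ[volume] u := fun f u hu h =>
    (memLp_preimage hs0 hs1 hN f).coeFn_toLp.trans
      ((isHalfLap_preimage hs0 hs1 hN f).ae_unique_left hs0 hs1 hN
        (memLp_preimage hs0 hs1 hN f) hu h)
  let S₀ : halfLapRange hs0 hs1 hN →ₗ[ℝ] Lp ℝ (critE N s) (volume : Measure (RN N)) :=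
    { toFun := fun f => (memLp_preimage hs0 hs1 hN f).toLp _
      map_add' := fun f g => by
        refine Lp.ext ?_
        have h1 := (isHalfLap_preimage hs0 hs1 hN f).add hs0 hs1 hp (memLp_preimage hs0 hs1 hN f)
          (memLp_preimage hs0 hs1 hN g) (isHalfLap_preimage hs0 hs1 hN g)
        have h2 := key (f + g) _ ((memLp_preimage hs0 hs1 hN f).add (memLp_preimage hs0 hs1 hN g))
          (h1.congr_right (Lp.coeFn_add f.1 g.1).symm)
        filter_upwards [h2, Lp.coeFn_add ((memLp_preimage hs0 hs1 hN f).toLp _)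
          ((memLp_preimage hs0 hs1 hN g).toLp _), (memLp_preimage hs0 hs1 hN f).coeFn_toLp,
          (memLp_preimage hs0 hs1 hN g).coeFn_toLp] with x e1 e2 e3 e4
        rw [e1, e2, Pi.add_apply, Pi.add_apply, e3, e4]
      map_smul' := fun c f => by
        refine Lp.ext ?_
        have h1 := (isHalfLap_preimage hs0 hs1 hN f).const_smul c
        have h2 := key (c • f) _ ((memLp_preimage hs0 hs1 hN f).const_smul c)
          (h1.congr_right (Lp.coeFn_smul c f.1).symm)
        filter_upwards [h2, Lp.coeFn_smul c ((memLp_preimage hs0 hs1 hN f).toLp _),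
          (memLp_preimage hs0 hs1 hN f).coeFn_toLp] with x e1 e2 e3
        rw [e1, RingHom.id_apply, e2, Pi.smul_apply, Pi.smul_apply, e3] }
  refine ⟨S₀.mkContinuous C.toReal fun f => ?_, key⟩
  have h1 := hsob _ _ (memLp_preimage hs0 hs1 hN f) (isHalfLap_preimage hs0 hs1 hN f)
  change ‖(memLp_preimage hs0 hs1 hN f).toLp _‖ ≤ C.toReal * ‖f.1‖
  rw [Lp.norm_toLp, Lp.norm_def, ← ENNReal.toReal_mul]
  exact ENNReal.toReal_mono (ENNReal.mul_ne_top hC (Lp.eLpNorm_ne_top _)) h1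

theorem holderConjugate_critE (hs0 : 0 < s) (hN : 2 * s < (N : ℝ)) :
    ENNReal.HolderConjugate (critE N s) (critE N s).conjExponent :=
  .conjExponent (one_lt_critE hs0 hN).le

theorem conjExponent_critE_ne_top (hs0 : 0 < s) (hN : 2 * s < (N : ℝ)) :
    (critE N s).conjExponent ≠ ∞ := by
  have := holderConjugate_critE (N := N) hs0 hN
  rw [Ne, ENNReal.HolderConjugate.eq_top_iff_eq_one _ (critE N s)]
  exact (one_lt_critE hs0 hN).ne'

theorem one_le_conjExponent_critE (hs0 : 0 < s) (hN : 2 * s < (N : ℝ)) :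
    1 ≤ (critE N s).conjExponent := by
  have := holderConjugate_critE (N := N) hs0 hN
  exact ENNReal.HolderConjugate.one_le _ (critE N s)

/-- Integration against a function of the dual exponent is continuous. -/
theorem exists_pairing (hs0 : 0 < s) (hN : 2 * s < (N : ℝ))
    [Fact (1 ≤ critE N s)] {h : RN N → ℝ}
    (hh : MemLp h (critE N s).conjExponent volume) :
    ∃ B : Lp ℝ (critE N s) (volume : Measure (RN N)) →L[ℝ] ℝ, ∀ f, B f = ∫ x, f x * h x := by
  have := holderConjugate_critE (N := N) hs0 hN
  have : Fact (1 ≤ (critE N s).conjExponent) := ⟨one_le_conjExponent_critE hs0 hN⟩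
  refine ⟨((ContinuousLinearMap.mul ℝ ℝ).lpPairing (volume : Measure (RN N)) (critE N s)
    (critE N s).conjExponent).flip (hh.toLp h), fun f => ?_⟩
  rw [ContinuousLinearMap.flip_apply, ContinuousLinearMap.lpPairing_eq_integral]
  refine integral_congr_ae ?_
  filter_upwards [hh.coeFn_toLp] with x hx
  simp [hx]

/-- If images converge in L², their preimages are Cauchy in the critical space by the bounded
inverse; the distributional identity passes to the limit because both of its sides are continuous
pairings. -/
theorem isClosed_halfLapRange (hs0 : 0 < s) (hs1 : s < 1) (hN : 2 * s < (N : ℝ))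
    :
    IsClosed (halfLapRange hs0 hs1 hN : Set (Lp ℝ 2 (volume : Measure (RN N)))) := by
  have : Fact (1 ≤ critE N s) := ⟨(one_lt_critE hs0 hN).le⟩
  obtain ⟨S, hS⟩ := exists_inverse hs0 hs1 hN
  refine isClosed_of_closure_subset fun f hf => ?_
  obtain ⟨g, hg, hlim⟩ := mem_closure_iff_seq_limit.1 hf
  set g' : ℕ → halfLapRange hs0 hs1 hN := fun n => ⟨g n, hg n⟩ with hg'
  have hcau : CauchySeq g' := by
    have h1 := Metric.cauchySeq_iff.1 hlim.cauchySeq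
    rw [Metric.cauchySeq_iff]
    exact h1
  obtain ⟨U, hU⟩ := cauchySeq_tendsto_of_complete (S.uniformContinuous.comp_cauchySeq hcau)
  refine ⟨U, Lp.memLp U, Lp.memLp f, fun φ => ?_⟩
  obtain ⟨B, hB⟩ := exists_pairing hs0 hN (memLp_fracLaplacian hs0 hs1 φ
    (one_le_conjExponent_critE hs0 hN) (conjExponent_critE_ne_top hs0 hN))
  obtain ⟨B', hB'⟩ : ∃ B' : Lp ℝ 2 (volume : Measure (RN N)) →L[ℝ] ℝ, ∀ f, B' f = ∫ x, f x * φ x := by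
    refine ⟨((ContinuousLinearMap.mul ℝ ℝ).lpPairing (volume : Measure (RN N)) 2 2).flip
      (φ.toLp 2 volume), fun f => ?_⟩
    rw [ContinuousLinearMap.flip_apply, ContinuousLinearMap.lpPairing_eq_integral]
    refine integral_congr_ae ?_
    filter_upwards [φ.coeFn_toLp 2 volume] with x hx
    simp [hx]
  rw [← hB, ← hB']
  have l1 : Tendsto (fun n => B (S (g' n))) atTop (𝓝 (B U)) := (B.continuous.tendsto U).comp hU
  have l2 : Tendsto (fun n => B' (g n)) atTop (𝓝 (B' f)) := (B'.continuous.tendsto f).comp hlim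
  refine tendsto_nhds_unique l1 (l2.congr fun n => ?_)
  obtain ⟨un, hun, hn⟩ := hg n
  rw [hB, hB', ← hn.2 φ]
  exact integral_congr_ae ((hS (g' n) un hun hn).mono fun x hx => by simp only [hx])

variable {un : ℕ → RN N → ℝ} {u₀ : RN N → ℝ}

theorem MemHdot.memLp_halfLap (h : MemHdot s u) : MemLp (halfLap s u) 2 volume :=
  (isHalfLap_halfLap h.2).1

/-- The element of the range of `(-Δ)^(s/2)` given by a function of the homogeneous space. -/
noncomputable def MemHdot.toRange (hs0 : 0 < s) (hs1 : s < 1) (hN : 2 * s < (N : ℝ))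
    (h : MemHdot s u) : halfLapRange hs0 hs1 hN :=
  ⟨h.memLp_halfLap.toLp _, u, h.1, (isHalfLap_halfLap h.2).congr_right h.memLp_halfLap.coeFn_toLp.symm⟩

/-- The range is a Hilbert space, being closed in L². Riesz represents ℓ by some (-Δ)^(s/2)φ with φ
in Ḣ^s, and these are precisely the test functions of `WeakTendsto`. -/
theorem tendsto_of_weakTendsto (hs0 : 0 < s) (hs1 : s < 1) (hN : 2 * s < (N : ℝ))
    (hun : ∀ n, MemHdot s (un n)) (hu₀ : MemHdot s u₀)
    (hw : WeakTendsto s un u₀) (ℓ : halfLapRange hs0 hs1 hN →L[ℝ] ℝ) :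
    Tendsto (fun n => ℓ ((hun n).toRange hs0 hs1 hN)) atTop (𝓝 (ℓ (hu₀.toRange hs0 hs1 hN))) := by
  have : CompleteSpace (halfLapRange hs0 hs1 hN) := (isClosed_halfLapRange hs0 hs1 hN).completeSpace_coe
  set g := (InnerProductSpace.toDual ℝ (halfLapRange hs0 hs1 hN)).symm ℓ with hg
  have hφ := isHalfLap_preimage hs0 hs1 hN g
  have hφm : MemHdot s (preimage hs0 hs1 hN g) := ⟨memLp_preimage hs0 hs1 hN g, _, hφ⟩
  have key : ∀ {v : RN N → ℝ} (hv : MemHdot s v), ℓ (hv.toRange hs0 hs1 hN) =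
      ∫ x, halfLap s v x * halfLap s (preimage hs0 hs1 hN g) x := by
    intro v hv
    rw [← InnerProductSpace.toDual_symm_apply (𝕜 := ℝ) (y := ℓ), ← hg, Submodule.coe_inner,
      L2.inner_def]
    refine integral_congr_ae ?_
    filter_upwards [hφ.ae_eq, hv.memLp_halfLap.coeFn_toLp] with x h1 h2
    simp only [MemHdot.toRange]
    rw [h1, h2]
    simp
  rw [key]
  exact (hw _ hφm).congr fun n => (key (hun n)).symm

/-- Weak convergence in the homogeneous space implies weak convergence in the critical Lebesgue
space. -/
theorem WeakTendsto.tendsto_integral_mul (hs0 : 0 < s) (hs1 : s < 1) (hN : 2 * s < (N : ℝ))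
    (hun : ∀ n, MemHdot s (un n)) (hu₀ : MemHdot s u₀)
    (hw : WeakTendsto s un u₀) {h : RN N → ℝ} (hh : MemLp h (critE N s).conjExponent volume) :
    Tendsto (fun n => ∫ x, un n x * h x) atTop (𝓝 (∫ x, u₀ x * h x)) := by
  have : Fact (1 ≤ critE N s) := ⟨(one_lt_critE hs0 hN).le⟩
  obtain ⟨S, hS⟩ := exists_inverse hs0 hs1 hN
  obtain ⟨B, hB⟩ := exists_pairing hs0 hN hh
  have key : ∀ {v : RN N → ℝ} (hv : MemHdot s v), (B.comp S) (hv.toRange hs0 hs1 hN) =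
      ∫ x, v x * h x := by
    intro v hv
    rw [ContinuousLinearMap.comp_apply, hB]
    refine integral_congr_ae ?_
    have := hS (hv.toRange hs0 hs1 hN) v hv.1 ((isHalfLap_halfLap hv.2).congr_right
      hv.memLp_halfLap.coeFn_toLp.symm)
    exact this.mono fun x hx => by simp only [hx]
  rw [← key hu₀]
  exact (tendsto_of_weakTendsto hs0 hs1 hN hun hu₀ hw (B.comp S)).congr fun n => key (hun n)

/-- Weak convergence in the homogeneous space implies weak convergence of `(-Δ)^(s/2) u_n`
in `L²`. -/
theorem WeakTendsto.tendsto_integral_halfLap_mul (hs0 : 0 < s) (hs1 : s < 1) (hN : 2 * s < (N : ℝ))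
    (hun : ∀ n, MemHdot s (un n)) (hu₀ : MemHdot s u₀)
    (hw : WeakTendsto s un u₀) {g : RN N → ℝ} (hg : MemLp g 2 volume) :
    Tendsto (fun n => ∫ x, halfLap s (un n) x * g x) atTop (𝓝 (∫ x, halfLap s u₀ x * g x)) := by
  set ℓ : halfLapRange hs0 hs1 hN →L[ℝ] ℝ :=
    (innerSL ℝ (hg.toLp g)).comp (halfLapRange hs0 hs1 hN).subtypeL with hℓ
  have key : ∀ {v : RN N → ℝ} (hv : MemHdot s v), ℓ (hv.toRange hs0 hs1 hN) =
      ∫ x, halfLap s v x * g x := by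
    intro v hv
    simp only [hℓ, ContinuousLinearMap.comp_apply, Submodule.subtypeL_apply, innerSL_apply_apply]
    rw [L2.inner_def]
    refine integral_congr_ae ?_
    filter_upwards [hg.coeFn_toLp, hv.memLp_halfLap.coeFn_toLp] with x h1 h2
    simp only [MemHdot.toRange]
    rw [h1, h2]
    simp
  rw [← key hu₀]
  exact (tendsto_of_weakTendsto hs0 hs1 hN hun hu₀ hw ℓ).congr fun n => key (hun n)

end WeakConvergence
end FracCC

namespace FracCC

open scoped ENNReal NNReal FourierTransform

/-! ### Local compactness and vanishing commutators -/

section LocalCompactness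

variable {N : ℕ} [NeZero N] {s : ℝ} {ψ : RN N → ℝ} {A R : ℝ}

/-- A bounded sequence of the homogeneous Sobolev space that converges weakly to zero in the
critical Lebesgue space. -/
structure IsWeaklyNull (s : ℝ) (θ w : ℕ → RN N → ℝ) (M : ℝ≥0∞) : Prop where
  ne_top : M ≠ ∞
  memLp : ∀ n, MemLp (θ n) (critE N s) volume
  isHalfLap : ∀ n, IsHalfLap s (θ n) (w n)
  eLpNorm_le : ∀ n, eLpNorm (θ n) (critE N s) volume ≤ M
  eLpNorm_halfLap_le : ∀ n, eLpNorm (w n) 2 volume ≤ M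
  tendsto : ∀ h : RN N → ℝ, MemLp h (critE N s).conjExponent volume →
    Tendsto (fun n => ∫ x, θ n x * h x) atTop (𝓝 0)

variable {θ w : ℕ → RN N → ℝ} {M : ℝ≥0∞}

theorem fourier_ofReal_eq {g : RN N → ℝ} (hg : Integrable g volume) (ξ : RN N) :
    𝓕 (fun x => (g x : ℂ)) ξ = ((∫ x, g x * Real.cos (-2 * Real.pi * inner ℝ x ξ) : ℝ) : ℂ) +
      ((∫ x, g x * Real.sin (-2 * Real.pi * inner ℝ x ξ) : ℝ) : ℂ) * Complex.I := by
  have hc : Continuous fun x : RN N => -2 * Real.pi * inner ℝ x ξ := by fun_prop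
  have h1 : Integrable (fun x => g x * Real.cos (-2 * Real.pi * inner ℝ x ξ)) volume :=
    hg.mul_bdd (c := 1) (Real.continuous_cos.comp hc).aestronglyMeasurable
      (Eventually.of_forall fun x => Real.abs_cos_le_one _)
  have h2 : Integrable (fun x => g x * Real.sin (-2 * Real.pi * inner ℝ x ξ)) volume :=
    hg.mul_bdd (c := 1) (Real.continuous_sin.comp hc).aestronglyMeasurable
      (Eventually.of_forall fun x => Real.abs_sin_le_one _)
  rw [Real.fourier_eq', ← integral_complex_ofReal, ← integral_complex_ofReal, ← integral_mul_const,
    ← integral_add h1.ofReal (h2.ofReal.mul_const _)]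
  refine integral_congr_ae (Eventually.of_forall fun x => ?_)
  simp only [smul_eq_mul, Complex.exp_mul_I, ← Complex.ofReal_cos, ← Complex.ofReal_sin]
  push_cast
  ring

theorem IsCutoff.memLp (h : IsCutoff ψ A R) (p : ℝ≥0∞) : MemLp ψ p volume :=
  h.contDiff.continuous.memLp_of_hasCompactSupport h.hasCompactSupport

theorem IsCutoff.exists_norm_le (h : IsCutoff ψ A R) : ∃ B : ℝ, 0 ≤ B ∧ ∀ x, ‖ψ x‖ ≤ B := by
  obtain ⟨B, hB⟩ := (h.hasCompactSupport.isCompact_range h.contDiff.continuous).isBounded.exists_norm_le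
  exact ⟨B, (norm_nonneg _).trans (hB _ ⟨0, rfl⟩), fun x => hB _ ⟨x, rfl⟩⟩

theorem eLpNorm_mul_le_of_norm_le {B : ℝ} {f : RN N → ℝ} {p : ℝ≥0∞} (hB : ∀ x, ‖ψ x‖ ≤ B) :
    eLpNorm (fun x => ψ x * f x) p volume ≤ ENNReal.ofReal B * eLpNorm f p volume :=
  eLpNorm_le_mul_eLpNorm_of_ae_le_mul (Eventually.of_forall fun x => by
    rw [norm_mul]; gcongr; exact hB x) p

/-- At a fixed frequency the real and imaginary parts are pairings of θ_n with ψ cos and ψ sin,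
which lie in the dual Lebesgue space. -/
theorem IsWeaklyNull.tendsto_fourier (hs0 : 0 < s) (hN : 2 * s < (N : ℝ))
    (h : IsWeaklyNull s θ w M) (hψ : IsCutoff ψ A R) (ξ : RN N) :
    Tendsto (fun n => 𝓕 (fun x => ((ψ x * θ n x : ℝ) : ℂ)) ξ) atTop (𝓝 0) := by
  have hc : Continuous fun x : RN N => -2 * Real.pi * inner ℝ x ξ := by fun_prop
  have hinteg : ∀ n, Integrable (fun x => ψ x * θ n x) volume := fun n =>
    memLp_one_iff_integrable.1 (hψ.memLp_mul (one_lt_critE hs0 hN).le (h.memLp n))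
  simp only [fun n => fourier_ofReal_eq (hinteg n) ξ]
  have key : ∀ f : ℝ → ℝ, Continuous f → (∀ t, |f t| ≤ 1) → Tendsto (fun n =>
      ((∫ x, ψ x * θ n x * f (-2 * Real.pi * inner ℝ x ξ) : ℝ) : ℂ)) atTop (𝓝 0) := by
    intro f hf hf1
    have hm : MemLp (fun x => ψ x * f (-2 * Real.pi * inner ℝ x ξ)) (critE N s).conjExponent
        volume := by
      refine (hψ.memLp _).of_le_mul (c := 1)
        (hψ.contDiff.continuous.mul (hf.comp hc)).aestronglyMeasurable
        (Eventually.of_forall fun x => ?_)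
      rw [norm_mul, mul_comm]
      gcongr
      exact hf1 _
    have h1 := (Complex.continuous_ofReal.tendsto _).comp (h.tendsto _ hm)
    rw [Complex.ofReal_zero] at h1
    refine h1.congr fun n => ?_
    rw [Function.comp_apply]
    congr 2; ext x; ring
  have h1 := (key _ Real.continuous_cos Real.abs_cos_le_one).add
    ((key _ Real.continuous_sin Real.abs_sin_le_one).mul_const Complex.I)
  simpa only [zero_mul, add_zero] using h1

/-- Hölder; the bound is uniform in n and ξ and serves as the dominating constant on bounded sets of
frequencies. -/
theorem IsWeaklyNull.enorm_fourier_le (hs0 : 0 < s) (hN : 2 * s < (N : ℝ))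
    (h : IsWeaklyNull s θ w M) (hψ : IsCutoff ψ A R) (n : ℕ) (ξ : RN N) :
    ‖𝓕 (fun x => ((ψ x * θ n x : ℝ) : ℂ)) ξ‖ₑ ≤
      eLpNorm ψ (critE N s).conjExponent volume * M := by
  have := holderConjugate_critE (N := N) hs0 hN
  calc ‖𝓕 (fun x => ((ψ x * θ n x : ℝ) : ℂ)) ξ‖ₑ ≤ ∫⁻ x, ‖ψ x * θ n x‖ₑ := by
        rw [Real.fourier_eq]
        refine (enorm_integral_le_lintegral_enorm _).trans (lintegral_mono fun x => le_of_eq ?_)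
        rw [← ofReal_norm, Circle.norm_smul, Complex.norm_real, ofReal_norm]
    _ = eLpNorm (ψ • θ n) 1 volume := by rw [eLpNorm_one_eq_lintegral_enorm]; rfl
    _ ≤ _ := (eLpNorm_smul_le_mul_eLpNorm (p := (critE N s).conjExponent) (q := critE N s)
        (h.memLp n).1 (hψ.memLp 1).1).trans (mul_le_mul' le_rfl (h.eLpNorm_le n))

theorem eLpNorm_two_rpow {E : Type*} [NormedAddCommGroup E] (f : RN N → E) :
    eLpNorm f 2 volume ^ (2 : ℝ) = ∫⁻ x, ‖f x‖ₑ ^ (2 : ℝ) :=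
  eLpNorm_nnreal_pow_eq_lintegral (p := 2) (by norm_num)

/-- Local compactness in `L²`. -/
theorem IsWeaklyNull.tendsto_eLpNorm_cutoff (hs0 : 0 < s) (hs1 : s < 1) (hN : 2 * s < (N : ℝ))
    (h : IsWeaklyNull s θ w M) (hψ : IsCutoff ψ A R) :
    Tendsto (fun n => eLpNorm (fun x => ψ x * θ n x) 2 volume) atTop (𝓝 0) := by
  have hp2 := two_le_ofReal_critExp (N := N) hs0 hN
  obtain ⟨B, hB0, hB⟩ := hψ.exists_norm_le
  obtain ⟨C, hC, hcomm⟩ := hψ.exists_eLpNorm_commutator_le hs0 hs1 hp2 ENNReal.ofReal_ne_top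
  set W : ℝ≥0∞ := (ENNReal.ofReal B * M + C * M) ^ (2 : ℝ) with hW
  have hWtop : W ≠ ∞ := ENNReal.rpow_ne_top_of_nonneg (by norm_num) (ENNReal.add_ne_top.2
    ⟨ENNReal.mul_ne_top ENNReal.ofReal_ne_top h.ne_top, ENNReal.mul_ne_top hC h.ne_top⟩)
  have hm : ∀ n, MemLp (fun x => ψ x * θ n x) 2 volume := fun n => hψ.memLp_mul hp2 (h.memLp n)
  have hinteg : ∀ n, Integrable (fun x => ψ x * θ n x) volume := fun n =>
    memLp_one_iff_integrable.1 (hψ.memLp_mul (one_lt_critE hs0 hN).le (h.memLp n))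
  have hhl : ∀ n, IsHalfLap s (fun x => ψ x * θ n x) (fun x => ψ x * w n x - commutator s ψ (θ n) x) :=
    fun n => IsHalfLap.cutoff_mul hs0 hs1 hψ hp2 ENNReal.ofReal_ne_top (h.memLp n) (h.isHalfLap n)
  have hWn : ∀ n, eLpNorm (fun x => ψ x * w n x - commutator s ψ (θ n) x) 2 volume ^ (2 : ℝ) ≤ W := by
    intro n
    refine ENNReal.rpow_le_rpow ?_ (by norm_num)
    refine (eLpNorm_sub_le (hψ.contDiff.continuous.aestronglyMeasurable.mul (h.isHalfLap n).1.1)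
      (aestronglyMeasurable_commutator hψ (h.memLp n).1) (by norm_num)).trans (add_le_add ?_ ?_)
    · exact (eLpNorm_mul_le_of_norm_le hB).trans (mul_le_mul' le_rfl (h.eLpNorm_halfLap_le n))
    · exact (hcomm _ (h.memLp n).1).trans (mul_le_mul' le_rfl (h.eLpNorm_le n))
  set F : ℕ → RN N → ℂ := fun n => 𝓕 (fun x => ((ψ x * θ n x : ℝ) : ℂ)) with hF
  have hFhat : ∀ n, (hat (hm n) : RN N → ℂ) =ᵐ[volume] F n := fun n =>
    fourier_toLp_ae_eq (memLp_complex (hm n)) (hinteg n).ofReal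
  -- Low frequencies: pointwise convergence with a constant bound on a ball of finite measure.
  have hlow : ∀ Λ : ℝ, Tendsto (fun n => ∫⁻ ξ in Metric.ball (0 : RN N) Λ, ‖F n ξ‖ₑ ^ (2 : ℝ)) atTop
      (𝓝 0) := by
    intro Λ
    have h1 := tendsto_lintegral_of_dominated_convergence'
      (μ := volume.restrict (Metric.ball (0 : RN N) Λ))
      (F := fun n ξ => ‖F n ξ‖ₑ ^ (2 : ℝ)) (f := fun _ => 0)
      (fun _ => (eLpNorm ψ (critE N s).conjExponent volume * M) ^ (2 : ℝ))
      (fun n => ((continuous_fourier (hinteg n).ofReal).aestronglyMeasurable.enorm.pow_const _))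
      (fun n => Eventually.of_forall fun ξ => ENNReal.rpow_le_rpow
        (h.enorm_fourier_le hs0 hN hψ n ξ) (by norm_num)) ?_ (Eventually.of_forall fun ξ => ?_)
    · simpa using h1
    · rw [lintegral_const, Measure.restrict_apply_univ]
      exact ENNReal.mul_ne_top (ENNReal.rpow_ne_top_of_nonneg (by norm_num)
        (ENNReal.mul_ne_top (hψ.memLp _).2.ne h.ne_top)) measure_ball_lt_top.ne
    · have h2 := ((h.tendsto_fourier hs0 hN hψ ξ).enorm).ennrpow_const (2 : ℝ)
      rwa [enorm_zero, ENNReal.zero_rpow_of_pos (by norm_num)] at h2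
  -- High frequencies: where |ξ| ≥ Λ, the energy bound W on ψθ_n yields Λ^(-2s) W uniformly in n.
  have hhigh : ∀ Λ : ℝ, 0 < Λ → ∀ n, ∫⁻ ξ in (Metric.ball (0 : RN N) Λ)ᶜ, ‖F n ξ‖ₑ ^ (2 : ℝ) ≤
      (ENNReal.ofReal (Λ ^ s)) ^ (-2 : ℝ) * W := by
    intro Λ hΛ n
    have hpos : (0 : ℝ) < Λ ^ s := Real.rpow_pos_of_pos hΛ s
    have e1 : (ENNReal.ofReal (Λ ^ s)) ^ (-2 : ℝ) * (ENNReal.ofReal (Λ ^ s)) ^ (2 : ℝ) = 1 := by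
      rw [← ENNReal.rpow_add _ _ (by simpa using hpos) ENNReal.ofReal_ne_top]
      simp
    refine le_trans ?_ (mul_le_mul' le_rfl ((lintegral_norm_rpow_mul_hat_le hs0 hs1 (hm n)
      (hhl n)).trans (hWn n)))
    rw [← lintegral_const_mul']
    · refine le_trans (lintegral_mono_ae ?_) (setLIntegral_le_lintegral (Metric.ball (0 : RN N) Λ)ᶜ _)
      filter_upwards [ae_restrict_mem measurableSet_ball.compl, ae_restrict_of_ae (hFhat n)]
        with ξ hξ hξ'
      rw [hξ', ENNReal.mul_rpow_of_nonneg _ _ (by norm_num), ← mul_assoc]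
      refine le_trans (le_of_eq (by rw [e1, one_mul])) (mul_le_mul' (mul_le_mul' le_rfl
        (ENNReal.rpow_le_rpow (ENNReal.ofReal_le_ofReal (Real.rpow_le_rpow hΛ.le ?_ hs0.le))
          (by norm_num))) (le_refl (‖F n ξ‖ₑ ^ (2 : ℝ))))
      simpa using hξ
    · exact ENNReal.rpow_ne_top_of_ne_zero (by simpa using hpos) ENNReal.ofReal_ne_top
  have hsq : Tendsto (fun n => eLpNorm (fun x => ψ x * θ n x) 2 volume ^ (2 : ℝ)) atTop (𝓝 0) := by
    have hsplit : ∀ Λ : ℝ, ∀ n, eLpNorm (fun x => ψ x * θ n x) 2 volume ^ (2 : ℝ) =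
        (∫⁻ ξ in Metric.ball (0 : RN N) Λ, ‖F n ξ‖ₑ ^ (2 : ℝ)) +
          ∫⁻ ξ in (Metric.ball (0 : RN N) Λ)ᶜ, ‖F n ξ‖ₑ ^ (2 : ℝ) := by
      intro Λ n
      rw [lintegral_add_compl _ measurableSet_ball, ← eLpNorm_hat (hm n), eLpNorm_two_rpow]
      exact lintegral_congr_ae ((hFhat n).mono fun ξ hξ => by simp only [hξ])
    have hsmall : Tendsto (fun Λ : ℝ => (ENNReal.ofReal (Λ ^ s)) ^ (-2 : ℝ) * W) atTop (𝓝 0) := by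
      have t1 : Tendsto (fun Λ : ℝ => (ENNReal.ofReal (Λ ^ s)) ^ (2 : ℝ)) atTop (𝓝 ∞) := by
        have t0 := (ENNReal.tendsto_ofReal_atTop.comp (tendsto_rpow_atTop hs0)).ennrpow_const 2
        simpa using t0
      have t2 := ENNReal.Tendsto.mul_const (b := W)
        (tendsto_inv_iff.2 t1) (Or.inr hWtop)
      rw [ENNReal.inv_top, zero_mul] at t2
      exact t2.congr fun Λ => by rw [ENNReal.rpow_neg]
    rw [ENNReal.tendsto_nhds_zero]
    intro ε hε
    obtain ⟨Λ, hΛε, hΛ⟩ := ((ENNReal.tendsto_nhds_zero.1 hsmall (ε / 2)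
      (ENNReal.half_pos hε.ne')).and (eventually_gt_atTop 0)).exists
    filter_upwards [ENNReal.tendsto_nhds_zero.1 (hlow Λ) (ε / 2) (ENNReal.half_pos hε.ne')] with n hn
    rw [hsplit Λ n, ← ENNReal.add_halves ε]
    exact add_le_add hn ((hhigh Λ hΛ n).trans hΛε)
  have := hsq.ennrpow_const (1 / 2)
  rw [ENNReal.zero_rpow_of_pos (by norm_num)] at this
  refine this.congr fun n => ?_
  rw [← ENNReal.rpow_mul, mul_one_div_cancel (by norm_num), ENNReal.rpow_one]

theorem IsWeaklyNull.tendsto_eLpNorm_ball (hs0 : 0 < s) (hs1 : s < 1) (hN : 2 * s < (N : ℝ))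
    (h : IsWeaklyNull s θ w M) {ρ : ℝ} (hρ : 0 < ρ) :
    Tendsto (fun n => eLpNorm ((Metric.ball (0 : RN N) ρ).indicator (θ n)) 2 volume) atTop
      (𝓝 0) := by
  obtain ⟨ψ, A, R, hψ, h01, h1⟩ := exists_unit_cutoff N
  refine tendsto_of_tendsto_of_tendsto_of_le_of_le tendsto_const_nhds
    (h.tendsto_eLpNorm_cutoff hs0 hs1 hN (hψ.comp_smul hρ)) (fun n => zero_le) fun n => ?_
  refine eLpNorm_mono fun x => ?_
  by_cases hx : x ∈ Metric.ball (0 : RN N) ρ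
  · rw [indicator_of_mem hx, h1, one_mul]
    rw [mem_ball_zero_iff, norm_smul, norm_inv, Real.norm_of_nonneg hρ.le, inv_mul_lt_iff₀ hρ,
      mul_one]
    simpa using hx
  · rw [indicator_of_notMem hx, norm_zero]
    positivity

theorem tendsto_lintegral_ekernTail (hs0 : 0 < s) (hs1 : s < 1) (hR : 0 < R) :
    Tendsto (fun k : ℕ => ∫⁻ y, ekernTail N s R k y) atTop (𝓝 0) := by
  have h1 := tendsto_lintegral_of_dominated_convergence (μ := (volume : Measure (RN N)))
    (F := fun (k : ℕ) y => ekernTail N s R k y) (f := fun _ => 0) (ekern N s R)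
    (fun k => measurable_ekernTail) (fun k => Eventually.of_forall fun y => ekernTail_le _ y)
    (lintegral_ekern_ne_top hs0 hs1 hR) (Eventually.of_forall fun y => ?_)
  · simpa using h1
  · refine tendsto_const_nhds.congr' ?_
    obtain ⟨k, hk⟩ := exists_nat_gt ‖y‖
    filter_upwards [eventually_ge_atTop k] with m hm
    rw [ekernTail, indicator_of_notMem]
    simp only [mem_ofPred_eq, not_le]
    exact hk.trans_le (by exact_mod_cast hm)

/-- The part of θ_n far from the cutoff contributes a kernel tail times the uniform bound M, small
once k is large. With k fixed, the near part vanishes by local compactness. -/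
theorem IsWeaklyNull.tendsto_eLpNorm_commutator (hs0 : 0 < s) (hs1 : s < 1) (hN : 2 * s < (N : ℝ))
    (h : IsWeaklyNull s θ w M) (hψ : IsCutoff ψ A R) :
    Tendsto (fun n => eLpNorm (commutator s ψ (θ n)) 2 volume) atTop (𝓝 0) := by
  have hp2 := two_le_ofReal_critExp (N := N) hs0 hN
  have hV := volume_ball_rpow_ne_top (N := N) hp2 ENNReal.ofReal_ne_top R
  set V := volume (Metric.ball (0 : RN N) R) ^ (1 / (2 : ℝ) - 1 / (critE N s).toReal) with hVdef
  have hest : ∀ (k n : ℕ), eLpNorm (commutator s ψ (θ n)) 2 volume ≤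
      ‖fracConst N (s / 2)‖ₑ * ENNReal.ofReal A *
        (2 * (∫⁻ y, ekern N s R y)) *
          eLpNorm ((Metric.ball (0 : RN N) (R + k)).indicator (θ n)) 2 volume +
      ‖fracConst N (s / 2)‖ₑ * ENNReal.ofReal A * V * M * (∫⁻ y, ekernTail N s R k y) := by
    intro k n
    have h1 := hψ.eLpNorm_commutator_le (ρ := R + k) hs0 hs1 (by simp) (h.memLp n).1 hp2
      ENNReal.ofReal_ne_top
    rw [add_sub_cancel_left, ← hVdef] at h1
    have h2 : eLpNorm (((Metric.ball (0 : RN N) (R + k))ᶜ).indicator (θ n)) (critE N s) volume ≤ M :=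
      (eLpNorm_indicator_le _).trans (h.eLpNorm_le n)
    refine h1.trans ?_
    rw [mul_add, mul_add]
    refine add_le_add (le_of_eq (by ring)) ?_
    calc _ ≤ ‖fracConst N (s / 2)‖ₑ * (ENNReal.ofReal A * (V * (∫⁻ y, ekernTail N s R k y) * M)) :=
          mul_le_mul' le_rfl (mul_le_mul' le_rfl (mul_le_mul' le_rfl h2))
      _ = _ := by ring
  have t1 : Tendsto (fun k : ℕ => ‖fracConst N (s / 2)‖ₑ * ENNReal.ofReal A * V * M *
      (∫⁻ y, ekernTail N s R k y)) atTop (𝓝 0) := by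
    have := ENNReal.Tendsto.const_mul (a := ‖fracConst N (s / 2)‖ₑ * ENNReal.ofReal A * V * M)
      (tendsto_lintegral_ekernTail (N := N) hs0 hs1 hψ.pos) (Or.inr (by finiteness [h.ne_top, hV]))
    simpa using this
  rw [ENNReal.tendsto_nhds_zero]
  intro ε hε
  obtain ⟨k, hk⟩ := (ENNReal.tendsto_nhds_zero.1 t1 (ε / 2) (ENNReal.half_pos hε.ne')).exists
  have t2 := ENNReal.Tendsto.const_mul
    (a := ‖fracConst N (s / 2)‖ₑ * ENNReal.ofReal A * (2 * (∫⁻ y, ekern N s R y)))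
    (h.tendsto_eLpNorm_ball hs0 hs1 hN (ρ := R + k) (by have := hψ.pos; positivity))
    (Or.inr (by finiteness [lintegral_ekern_ne_top (N := N) hs0 hs1 hψ.pos]))
  rw [mul_zero] at t2
  filter_upwards [ENNReal.tendsto_nhds_zero.1 t2 (ε / 2) (ENNReal.half_pos hε.ne')] with n hn
  rw [← ENNReal.add_halves ε]
  exact (hest k n).trans (add_le_add hn hk)

end LocalCompactness
end FracCC

namespace FracCC

open scoped ENNReal NNReal FourierTransform

/-! ### Brezis-Lieb splitting for homogeneous functions -/

section Homogeneous

variable {E : Type*} [NormedAddCommGroup E] [NormedSpace ℝ E] {F : E → ℝ} {q : ℝ}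

/-- Continuous positively homogeneous functions of degree `q`. -/
structure IsHomogeneous (q : ℝ) (F : E → ℝ) : Prop where
  continuous : Continuous F
  smul : ∀ (t : ℝ) (a : E), 0 ≤ t → F (t • a) = t ^ q * F a

theorem IsHomogeneous.map_zero (h : IsHomogeneous q F) (hq : 0 < q) : F 0 = 0 := by
  have := h.smul 0 0 le_rfl
  rwa [smul_zero, Real.zero_rpow hq.ne', zero_mul] at this

theorem IsHomogeneous.eq_norm_rpow_mul (h : IsHomogeneous q F) {a c : E} (hc : c ≠ 0) :
    F a = ‖c‖ ^ q * F (‖c‖⁻¹ • a) := by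
  rw [← h.smul _ _ (norm_nonneg _), smul_inv_smul₀ (norm_ne_zero_iff.2 hc)]

theorem norm_inv_norm_smul {a : E} (ha : a ≠ 0) : ‖‖a‖⁻¹ • a‖ = 1 := by
  rw [norm_smul, norm_inv, norm_norm, inv_mul_cancel₀ (norm_ne_zero_iff.2 ha)]

variable [ProperSpace E]

theorem IsHomogeneous.exists_abs_le (h : IsHomogeneous q F) (hq : 0 < q) :
    ∃ C : ℝ, 0 ≤ C ∧ ∀ a, |F a| ≤ C * ‖a‖ ^ q := by
  obtain ⟨C, hC⟩ := (isCompact_closedBall (0 : E) 1).exists_bound_of_continuousOn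
    h.continuous.continuousOn
  refine ⟨C, (norm_nonneg _).trans (hC 0 (by simp)), fun a => ?_⟩
  by_cases ha : a = 0
  · rw [ha, h.map_zero hq, norm_zero, Real.zero_rpow hq.ne']
    simp
  · rw [h.eq_norm_rpow_mul ha, abs_mul, abs_of_nonneg (by positivity), mul_comm]
    gcongr
    exact hC _ (by simp [norm_inv_norm_smul ha])

/-- If ‖b‖ ≤ d‖a‖, rescale to ‖a‖ = 1 and use uniform continuity on the ball of radius 2, which
contains the points because d ≤ 1. Otherwise ‖a‖ is below ‖b‖/d, and both values of F are controlled
by ‖b‖^q; they account for the two summands of the constant. -/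
theorem IsHomogeneous.exists_abs_sub_le (h : IsHomogeneous q F) (hq : 0 < q) {ε : ℝ} (hε : 0 < ε) :
    ∃ C : ℝ, 0 ≤ C ∧ ∀ a b, |F (a + b) - F a| ≤ ε * ‖a‖ ^ q + C * ‖b‖ ^ q := by
  obtain ⟨C, hC0, hC⟩ := h.exists_abs_le hq
  have huc := (isCompact_closedBall (0 : E) 2).uniformContinuousOn_of_continuous
    h.continuous.continuousOn
  obtain ⟨δ, hδ, hδ'⟩ := Metric.uniformContinuousOn_iff_le.1 huc ε hε
  set d := min δ 1 with hd
  have hd0 : 0 < d := lt_min hδ one_pos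
  refine ⟨C * (d⁻¹ + 1) ^ q + C * d⁻¹ ^ q, by positivity, fun a b => ?_⟩
  rcases le_or_gt ‖b‖ (d * ‖a‖) with hb | hb
  · by_cases ha : a = 0
    · have : b = 0 := by simpa [ha] using hb
      rw [this, add_zero, sub_self, abs_zero]
      positivity
    · have ha' : 0 < ‖a‖ := norm_pos_iff.2 ha
      have hb' : ‖‖a‖⁻¹ • b‖ ≤ d := by
        rw [norm_smul, norm_inv, norm_norm, inv_mul_le_iff₀ ha', mul_comm]
        exact hb
      have h1 : |F (‖a‖⁻¹ • (a + b)) - F (‖a‖⁻¹ • a)| ≤ ε := by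
        refine hδ' _ ?_ _ ?_ ?_
        · rw [mem_closedBall_zero_iff, smul_add]
          refine (norm_add_le _ _).trans ?_
          rw [norm_inv_norm_smul ha]
          linarith [min_le_right δ 1]
        · rw [mem_closedBall_zero_iff, norm_inv_norm_smul ha]; norm_num
        · rw [dist_eq_norm, ← smul_sub, add_sub_cancel_left]
          exact hb'.trans (min_le_left _ _)
      rw [h.eq_norm_rpow_mul (a := a + b) ha, h.eq_norm_rpow_mul (a := a) ha, ← mul_sub, abs_mul,
        abs_of_nonneg (by positivity), mul_comm]
      have : 0 ≤ (C * (d⁻¹ + 1) ^ q + C * d⁻¹ ^ q) * ‖b‖ ^ q := by positivity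
      nlinarith [mul_le_mul_of_nonneg_right h1 (Real.rpow_nonneg ha'.le q)]
  · have ha : ‖a‖ ≤ d⁻¹ * ‖b‖ := by
      rw [← div_eq_inv_mul, le_div_iff₀ hd0, mul_comm]
      exact hb.le
    have hab : ‖a + b‖ ≤ (d⁻¹ + 1) * ‖b‖ := by
      refine (norm_add_le _ _).trans ?_
      linarith
    have e1 : |F (a + b)| ≤ C * (d⁻¹ + 1) ^ q * ‖b‖ ^ q := by
      rw [mul_assoc, ← Real.mul_rpow (by positivity) (norm_nonneg _)]
      exact (hC _).trans (by gcongr)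
    have e2 : |F a| ≤ C * d⁻¹ ^ q * ‖b‖ ^ q := by
      rw [mul_assoc, ← Real.mul_rpow (by positivity) (norm_nonneg _)]
      exact (hC _).trans (by gcongr)
    have e3 : 0 ≤ ε * ‖a‖ ^ q := by positivity
    linarith [abs_sub (F (a + b)) (F a)]

theorem ofReal_norm_rpow (hq : 0 ≤ q) (a : E) : ENNReal.ofReal (‖a‖ ^ q) = ‖a‖ₑ ^ q := by
  rw [← ofReal_norm, ENNReal.ofReal_rpow_of_nonneg (norm_nonneg _) hq]

theorem enorm_le_of_abs_le (hq : 0 ≤ q) {t c d : ℝ} {a b : E} (hc : 0 ≤ c) (hd : 0 ≤ d)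
    (h : |t| ≤ c * ‖a‖ ^ q + d * ‖b‖ ^ q) :
    ‖t‖ₑ ≤ ENNReal.ofReal c * ‖a‖ₑ ^ q + ENNReal.ofReal d * ‖b‖ₑ ^ q := by
  rw [← ofReal_norm, ← ofReal_norm_rpow hq, ← ofReal_norm_rpow hq, ← ENNReal.ofReal_mul hc,
    ← ENNReal.ofReal_mul hd, ← ENNReal.ofReal_add (by positivity) (by positivity)]
  exact ENNReal.ofReal_le_ofReal h

variable {α : Type*} [MeasurableSpace α] {μ : Measure α}

/-- The Brezis–Lieb splitting for homogeneous functions. -/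
theorem IsHomogeneous.tendsto_lintegral_brezisLieb (h : IsHomogeneous q F) (hq : 0 < q)
    {a : α → E} {b : ℕ → α → E} (ha : AEStronglyMeasurable a μ)
    (hb : ∀ n, AEStronglyMeasurable (b n) μ) (ha' : ∫⁻ x, ‖a x‖ₑ ^ q ∂μ ≠ ∞) {M : ℝ≥0∞} (hM : M ≠ ∞)
    (hbM : ∀ n, ∫⁻ x, ‖b n x‖ₑ ^ q ∂μ ≤ M)
    (hlim : ∀ᵐ x ∂μ, Tendsto (fun n => b n x) atTop (𝓝 0)) :
    Tendsto (fun n => ∫⁻ x, ‖F (a x + b n x) - F (b n x) - F (a x)‖ₑ ∂μ) atTop (𝓝 0) := by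
  set f : ℕ → α → ℝ≥0∞ := fun n x => ‖F (a x + b n x) - F (b n x) - F (a x)‖ₑ with hf
  have hfm : ∀ n, AEMeasurable (f n) μ := fun n =>
    (((h.continuous.comp_aestronglyMeasurable (ha.add (hb n))).sub
      (h.continuous.comp_aestronglyMeasurable (hb n))).sub
        (h.continuous.comp_aestronglyMeasurable ha)).enorm
  obtain ⟨C₀, hC₀, hF₀⟩ := h.exists_abs_le hq
  have key : ∀ ε : ℝ, 0 < ε → ∃ C : ℝ≥0∞, C ≠ ∞ ∧ ∀ n x,
      f n x ≤ ENNReal.ofReal ε * ‖b n x‖ₑ ^ q + C * ‖a x‖ₑ ^ q := by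
    intro ε hε
    obtain ⟨C, hC, hF⟩ := h.exists_abs_sub_le hq hε
    refine ⟨ENNReal.ofReal (C + C₀), ENNReal.ofReal_ne_top, fun n x => ?_⟩
    refine enorm_le_of_abs_le hq.le hε.le (by positivity) ?_
    -- Here b_n is the base point and a the increment, so that the small factor ε falls on b_n,
    -- which is merely bounded.
    have h1 := hF (b n x) (a x)
    rw [add_comm (b n x)] at h1
    linarith [abs_sub (F (a x + b n x) - F (b n x)) (F (a x)), hF₀ (a x)]
  have hpt : ∀ᵐ x ∂μ, Tendsto (fun n => f n x) atTop (𝓝 0) := by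
    filter_upwards [hlim] with x hx
    have h1 := (h.continuous.tendsto _).comp (hx.const_add (a x))
    have h2 := (h.continuous.tendsto _).comp hx
    have h3 := ((h1.sub h2).sub_const (F (a x))).enorm
    simpa [h.map_zero hq] using h3
  rw [ENNReal.tendsto_nhds_zero]
  intro δ hδ
  obtain ⟨ε, hε, hεδ⟩ : ∃ ε : ℝ, 0 < ε ∧ ENNReal.ofReal ε * M ≤ δ / 2 := by
    have t : Tendsto (fun ε : ℝ => ENNReal.ofReal ε * M) (𝓝[>] 0) (𝓝 0) := by
      have := (ENNReal.Tendsto.mul_const (ENNReal.tendsto_ofReal (tendsto_id (x := 𝓝 (0 : ℝ))))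
        (Or.inr hM)).mono_left (nhdsWithin_le_nhds (s := Ioi 0))
      simpa using this
    obtain ⟨ε, h1, h2⟩ := ((ENNReal.tendsto_nhds_zero.1 t (δ / 2) (ENNReal.half_pos hδ.ne')).and
      self_mem_nhdsWithin).exists
    exact ⟨ε, h2, h1⟩
  obtain ⟨C, hC, hfC⟩ := key ε hε
  have hbm : ∀ n, AEMeasurable (fun x => ENNReal.ofReal ε * ‖b n x‖ₑ ^ q) μ := fun n =>
    ((hb n).enorm.pow_const q).const_mul _
  -- The truncated difference is dominated by C‖a‖^q, independent of n, and tends to 0 pointwise.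
  -- What it removes has integral at most εM ≤ δ/2.
  have t2 := tendsto_lintegral_of_dominated_convergence' (μ := μ)
    (F := fun n x => f n x - ENNReal.ofReal ε * ‖b n x‖ₑ ^ q) (f := fun _ => 0)
    (fun x => C * ‖a x‖ₑ ^ q) (fun n => (hfm n).sub (hbm n))
    (fun n => Eventually.of_forall fun x => tsub_le_iff_left.2 (hfC n x))
    (by rw [lintegral_const_mul' _ _ hC]; exact ENNReal.mul_ne_top hC ha')
    (hpt.mono fun x hx => tendsto_of_tendsto_of_tendsto_of_le_of_le tendsto_const_nhds hx
      (fun n => zero_le) fun n => tsub_le_self)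
  rw [lintegral_zero] at t2
  filter_upwards [ENNReal.tendsto_nhds_zero.1 t2 (δ / 2) (ENNReal.half_pos hδ.ne')] with n hn
  calc ∫⁻ x, f n x ∂μ ≤ ∫⁻ x, ENNReal.ofReal ε * ‖b n x‖ₑ ^ q +
        (f n x - ENNReal.ofReal ε * ‖b n x‖ₑ ^ q) ∂μ := lintegral_mono fun x => le_add_tsub
    _ = ENNReal.ofReal ε * (∫⁻ x, ‖b n x‖ₑ ^ q ∂μ) +
        ∫⁻ x, (f n x - ENNReal.ofReal ε * ‖b n x‖ₑ ^ q) ∂μ := by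
      rw [lintegral_add_left' (hbm n), lintegral_const_mul' _ _ ENNReal.ofReal_ne_top]
    _ ≤ δ / 2 + δ / 2 := add_le_add ((mul_le_mul' le_rfl (hbM n)).trans hεδ) hn
    _ = δ := ENNReal.add_halves δ

/-- The Brezis–Lieb splitting along sequences that converge in measure. -/
theorem IsHomogeneous.tendsto_lintegral_brezisLieb_of_inMeasure (h : IsHomogeneous q F)
    (hq : 0 < q) {a : α → E} {b : ℕ → α → E} (ha : AEStronglyMeasurable a μ)
    (hb : ∀ n, AEStronglyMeasurable (b n) μ) (ha' : ∫⁻ x, ‖a x‖ₑ ^ q ∂μ ≠ ∞) {M : ℝ≥0∞} (hM : M ≠ ∞)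
    (hbM : ∀ n, ∫⁻ x, ‖b n x‖ₑ ^ q ∂μ ≤ M) (hlim : TendstoInMeasure μ b atTop 0) :
    Tendsto (fun n => ∫⁻ x, ‖F (a x + b n x) - F (b n x) - F (a x)‖ₑ ∂μ) atTop (𝓝 0) := by
  -- Every subsequence has a further one converging almost everywhere, and the limit 0 is always the
  -- same.
  refine tendsto_of_subseq_tendsto fun ns hns => ?_
  have h1 : TendstoInMeasure μ (fun n => b (ns n)) atTop 0 := hlim.comp hns
  obtain ⟨ms, hms, hae⟩ := h1.exists_seq_tendsto_ae
  exact ⟨ms, h.tendsto_lintegral_brezisLieb hq ha (fun n => hb (ns (ms n))) ha' hM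
    (fun n => hbM (ns (ms n))) hae⟩

end Homogeneous

/-! ### Consequences of the structure of K -/

section Nonlinearity

variable {q : ℝ} {K : ℝ × ℝ → ℝ}

theorem IsCriticalK.map_zero (hK : IsCriticalK q K) (hq : 0 < q) : K (0, 0) = 0 := by
  have h := hK.homogeneous 2 0 0 (by norm_num) le_rfl le_rfl
  rw [mul_zero] at h
  have h1 : (1 : ℝ) < 2 ^ q := Real.one_lt_rpow (by norm_num) hq
  nlinarith

theorem derivWithin_rpow_mul (c : ℝ) (f : ℝ → ℝ) (hf : ∀ t, 0 < t → f t = t ^ q * c) :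
    derivWithin f (Ici 0) 1 = q * c := by
  have h1 : HasDerivAt (fun t : ℝ => t ^ q * c) (q * c) 1 := by
    have := (Real.hasDerivAt_rpow_const (x := 1) (p := q) (Or.inl one_ne_zero)).mul_const c
    simpa using this
  have h2 : HasDerivAt f (q * c) 1 :=
    h1.congr_of_eventuallyEq ((eventually_gt_nhds one_pos).mono hf)
  exact h2.hasDerivWithinAt.derivWithin (uniqueDiffOn_Ici 0 1 (by simp))

/-- By homogeneity K(t,0) = t^q K(1,0), so K_u(1,0) = q K(1,0); the vanishing of this derivative
kills K on the axis. With the other axis, this makes the extension by zero continuous. -/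
theorem IsCriticalK.map_left (hK : IsCriticalK q K) (hq : 0 < q) {t : ℝ} (ht : 0 ≤ t) :
    K (t, 0) = 0 := by
  have hhom : ∀ t, 0 < t → K (t, 0) = t ^ q * K (1, 0) := fun t ht => by
    simpa using hK.homogeneous t 1 0 ht zero_le_one le_rfl
  have h1 := hK.axis_zero.1
  rw [partialU, derivWithin_rpow_mul _ _ hhom] at h1
  rcases ht.eq_or_lt with rfl | ht
  · exact hK.map_zero hq
  · rw [hhom t ht, (mul_eq_zero.1 h1).resolve_left hq.ne', mul_zero]

theorem IsCriticalK.map_right (hK : IsCriticalK q K) (hq : 0 < q) {t : ℝ} (ht : 0 ≤ t) :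
    K (0, t) = 0 := by
  have hhom : ∀ t, 0 < t → K (0, t) = t ^ q * K (0, 1) := fun t ht => by
    simpa using hK.homogeneous t 0 1 ht le_rfl zero_le_one
  have h1 := hK.axis_zero.2
  rw [partialV, derivWithin_rpow_mul _ _ hhom] at h1
  rcases ht.eq_or_lt with rfl | ht
  · exact hK.map_zero hq
  · rw [hhom t ht, (mul_eq_zero.1 h1).resolve_left hq.ne', mul_zero]

theorem IsCriticalK.extendK_eq (hK : IsCriticalK q K) (hq : 0 < q) (u v : ℝ) :
    extendK K u v = K (max u 0, max v 0) := by
  unfold extendK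
  split_ifs with h
  · rcases h with h | h
    · rw [max_eq_right h, hK.map_right hq (le_max_right _ _)]
    · rw [max_eq_right h, hK.map_left hq (le_max_right _ _)]
  · push Not at h
    rw [max_eq_left h.1.le, max_eq_left h.2.le]

theorem extendK_max (u v : ℝ) : extendK K (max u 0) (max v 0) = extendK K u v := by
  unfold extendK
  have e : ∀ t : ℝ, max t 0 ≤ 0 ↔ t ≤ 0 := fun t => by simp
  simp only [e]
  split_ifs with h
  · rfl
  · push Not at h
    rw [max_eq_left h.1.le, max_eq_left h.2.le]

theorem IsCriticalK.extendK_nonneg (hK : IsCriticalK q K) (u v : ℝ) : 0 ≤ extendK K u v := by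
  unfold extendK
  split_ifs with h
  · exact le_rfl
  · push Not at h
    exact (hK.pos u v h.1 h.2).le

theorem IsCriticalK.isHomogeneous (hK : IsCriticalK q K) (hq : 0 < q) :
    IsHomogeneous q (fun a : ℝ × ℝ => extendK K a.1 a.2) := by
  refine ⟨?_, fun t a ht => ?_⟩
  · simp only [hK.extendK_eq hq]
    exact hK.contDiffOn.continuousOn.comp_continuous (by fun_prop) fun a =>
      ⟨le_max_right a.1 0, le_max_right a.2 0⟩
  · simp only [Prod.smul_fst, Prod.smul_snd, smul_eq_mul]
    rcases ht.eq_or_lt with rfl | ht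
    · rw [Real.zero_rpow hq.ne', zero_mul, zero_mul, zero_mul]
      simp [extendK]
    · unfold extendK
      have e : ∀ x : ℝ, t * x ≤ 0 ↔ x ≤ 0 := fun x => by
        rw [mul_nonpos_iff]
        constructor
        · rintro (h | h)
          · exact h.2
          · linarith
        · exact fun h => Or.inl ⟨ht.le, h⟩
      simp only [e]
      split_ifs with h
      · rw [mul_zero]
      · push Not at h
        exact hK.homogeneous t a.1 a.2 ht h.1.le h.2.le

/-- The perturbation inequality at the base point (0,v), where the extension vanishes. The
arbitrarily small coefficient on one variable later forces an atom of ν to charge the energy of the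
other component. -/
theorem IsCriticalK.exists_extendK_le_left (hK : IsCriticalK q K) (hq : 0 < q) {ε : ℝ} (hε : 0 < ε) :
    ∃ C : ℝ, 0 ≤ C ∧ ∀ u v, extendK K u v ≤ ε * |v| ^ q + C * |u| ^ q := by
  obtain ⟨C, hC, h⟩ := (hK.isHomogeneous hq).exists_abs_sub_le hq hε
  refine ⟨C, hC, fun u v => ?_⟩
  have h1 := h (0, v) (u, 0)
  simp only [Prod.mk_add_mk, zero_add, add_zero, Prod.norm_def, norm_zero, Real.norm_eq_abs] at h1
  rw [max_eq_right (abs_nonneg _), max_eq_left (abs_nonneg _)] at h1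
  have h2 : extendK K 0 v = 0 := by simp [extendK]
  rw [h2, sub_zero] at h1
  exact (le_abs_self _).trans h1

theorem IsCriticalK.exists_extendK_le_right (hK : IsCriticalK q K) (hq : 0 < q) {ε : ℝ} (hε : 0 < ε) :
    ∃ C : ℝ, 0 ≤ C ∧ ∀ u v, extendK K u v ≤ ε * |u| ^ q + C * |v| ^ q := by
  obtain ⟨C, hC, h⟩ := (hK.isHomogeneous hq).exists_abs_sub_le hq hε
  refine ⟨C, hC, fun u v => ?_⟩
  have h1 := h (u, 0) (0, v)
  simp only [Prod.mk_add_mk, zero_add, add_zero, Prod.norm_def, norm_zero, Real.norm_eq_abs] at h1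
  rw [max_eq_left (abs_nonneg _), max_eq_right (abs_nonneg _)] at h1
  have h2 : extendK K u 0 = 0 := by simp [extendK]
  rw [h2, sub_zero] at h1
  exact (le_abs_self _).trans h1

end Nonlinearity
end FracCC

namespace FracCC

open scoped ENNReal NNReal FourierTransform

/-! ### Limits of the localised energies -/

section Limits

variable {N : ℕ} [NeZero N] {s : ℝ} {ψ : RN N → ℝ} {A R : ℝ} {K : ℝ × ℝ → ℝ}

theorem integral_abs_rpow {f : RN N → ℝ} {p : ℝ} (hp : 0 < p)
    (hf : MemLp f (ENNReal.ofReal p) volume) :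
    ∫ x, |f x| ^ p = (eLpNorm f (ENNReal.ofReal p) volume).toReal ^ p := by
  have h0 : 0 ≤ ∫ x, |f x| ^ p := integral_nonneg fun x => by positivity
  rw [hf.eLpNorm_eq_integral_rpow_norm (by simpa using hp) ENNReal.ofReal_ne_top,
    ENNReal.toReal_ofReal hp.le]
  simp only [Real.norm_eq_abs]
  rw [ENNReal.toReal_ofReal (Real.rpow_nonneg h0 _), ← Real.rpow_mul h0,
    inv_mul_cancel₀ hp.ne', Real.rpow_one]

theorem integral_sq_eq {f : RN N → ℝ} (hf : MemLp f 2 volume) :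
    ∫ x, f x ^ 2 = (eLpNorm f 2 volume).toReal ^ 2 := by
  have h := integral_abs_rpow (f := f) (p := 2) (by norm_num) (by simpa using hf)
  simpa using h

theorem integrable_abs_rpow {f : RN N → ℝ} {p : ℝ} (hp : 0 < p)
    (hf : MemLp f (ENNReal.ofReal p) volume) : Integrable (fun x => |f x| ^ p) volume := by
  have := hf.integrable_norm_rpow (by simpa using hp) ENNReal.ofReal_ne_top
  simpa [ENNReal.toReal_ofReal hp.le] using this

/-- Perturbing an `L²` sequence by a null sequence does not change the limit of the energies. -/
theorem tendsto_integral_sub_sq {f c : ℕ → RN N → ℝ} {L : ℝ} (hf : ∀ n, MemLp (f n) 2 volume)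
    (hc : ∀ n, MemLp (c n) 2 volume) (hL : Tendsto (fun n => ∫ x, f n x ^ 2) atTop (𝓝 L))
    (hc0 : Tendsto (fun n => eLpNorm (c n) 2 volume) atTop (𝓝 0)) :
    Tendsto (fun n => ∫ x, (f n x - c n x) ^ 2) atTop (𝓝 L) := by
  have key : ∀ g : ℕ → RN N → ℝ, ∀ hg : ∀ n, MemLp (g n) 2 volume, ∀ n,
      ∫ x, g n x ^ 2 = ‖(hg n).toLp (g n)‖ ^ 2 := fun g hg n => by
    rw [integral_sq_eq (hg n), Lp.norm_toLp]
  have h1 : Tendsto (fun n => ‖(hf n).toLp (f n)‖) atTop (𝓝 (Real.sqrt L)) := by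
    refine ((Real.continuous_sqrt.tendsto L).comp hL).congr fun n => ?_
    rw [Function.comp_apply, key f hf, Real.sqrt_sq (norm_nonneg _)]
  have h2 : Tendsto (fun n => ‖(hc n).toLp (c n)‖) atTop (𝓝 0) := by
    refine ((ENNReal.tendsto_toReal ENNReal.zero_ne_top).comp hc0).congr fun n => ?_
    rw [Function.comp_apply, Lp.norm_toLp]
  have h3 : Tendsto (fun n => ‖(hf n).toLp (f n) - (hc n).toLp (c n)‖) atTop (𝓝 (Real.sqrt L)) := by
    refine tendsto_of_tendsto_of_tendsto_of_le_of_le (g := fun n => ‖(hf n).toLp (f n)‖ -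
      ‖(hc n).toLp (c n)‖) (h := fun n => ‖(hf n).toLp (f n)‖ + ‖(hc n).toLp (c n)‖) ?_ ?_
      (fun n => norm_sub_norm_le _ _) fun n => norm_sub_le _ _
    · simpa using h1.sub h2
    · simpa using h1.add h2
  have hL0 : 0 ≤ L := ge_of_tendsto' hL fun n => integral_nonneg fun x => sq_nonneg _
  have h4 := h3.pow 2
  rw [Real.sq_sqrt hL0] at h4
  refine h4.congr fun n => ?_
  rw [← MemLp.toLp_sub]
  exact (key (fun n => f n - c n) (fun n => (hf n).sub (hc n)) n).symm

/-- The defining inequality of the constant `S̃_K`, in homogeneous form. -/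
theorem sobolevK_mul_le (hK : IsCriticalK (critExp N s) K) (hq : 0 < critExp N s)
    {f g wf wg : RN N → ℝ} (hf : MemLp f 2 volume) (hg : MemLp g 2 volume)
    (hwf : IsHalfLap s f wf) (hwg : IsHalfLap s g wg) :
    sobolevK N s K * (∫ x, extendK K (f x) (g x)) ^ (2 / critExp N s) ≤
      (∫ x, wf x ^ 2) + ∫ x, wg x ^ 2 := by
  set q := critExp N s with hqdef
  set I := ∫ x, extendK K (f x) (g x) with hI
  have hI0 : 0 ≤ I := integral_nonneg fun x => hK.extendK_nonneg _ _
  have hE : 0 ≤ (∫ x, wf x ^ 2) + ∫ x, wg x ^ 2 :=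
    add_nonneg (integral_nonneg fun x => sq_nonneg _) (integral_nonneg fun x => sq_nonneg _)
  rcases hI0.eq_or_lt with h0 | hpos
  · rw [← h0, Real.zero_rpow (by positivity), mul_zero]
    exact hE
  set t := I ^ (-1 / q) with ht
  have ht0 : 0 < t := Real.rpow_pos_of_pos hpos _
  have htq : t ^ q * I = 1 := by
    rw [ht, ← Real.rpow_mul hI0, div_mul_cancel₀ _ hq.ne', Real.rpow_neg_one,
      inv_mul_cancel₀ hpos.ne']
  have ht2 : t ^ 2 * I ^ (2 / q) = 1 := by
    rw [ht, ← Real.rpow_natCast, ← Real.rpow_mul hI0, ← Real.rpow_add hpos]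
    rw [show -1 / q * ((2 : ℕ) : ℝ) + 2 / q = 0 by push_cast; ring, Real.rpow_zero]
  have hle : sobolevK N s K ≤ t ^ 2 * ((∫ x, wf x ^ 2) + ∫ x, wg x ^ 2) := by
    refine csInf_le ⟨0, ?_⟩ ⟨t • f, t • g, ⟨hf.const_smul t, _, hwf.const_smul t⟩,
      ⟨hg.const_smul t, _, hwg.const_smul t⟩, ?_, ?_⟩
    · rintro e ⟨u, v, -, -, -, rfl⟩
      exact integral_nonneg fun x => add_nonneg (sq_nonneg _) (sq_nonneg _)
    · rw [← htq, hI, ← integral_const_mul]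
      refine integral_congr_ae (Eventually.of_forall fun x => ?_)
      dsimp only
      rw [extendK_max]
      exact (hK.isHomogeneous hq).smul t (f x, g x) ht0.le
    · rw [← integral_add hwf.1.integrable_sq hwg.1.integrable_sq, ← integral_const_mul]
      refine integral_congr_ae ?_
      filter_upwards [(hwf.const_smul t).ae_eq, (hwg.const_smul t).ae_eq] with x h1 h2
      rw [energyDensity, h1, h2]
      simp only [Pi.smul_apply, smul_eq_mul]
      ring
  calc sobolevK N s K * I ^ (2 / q) ≤ t ^ 2 * ((∫ x, wf x ^ 2) + ∫ x, wg x ^ 2) * I ^ (2 / q) := by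
        gcongr
    _ = (t ^ 2 * I ^ (2 / q)) * ((∫ x, wf x ^ 2) + ∫ x, wg x ^ 2) := by ring
    _ = _ := by rw [ht2, one_mul]

variable {u v : ℕ → RN N → ℝ} {u₀ v₀ : RN N → ℝ}

theorem WeakTendsto.exists_isWeaklyNull (hs0 : 0 < s) (hs1 : s < 1) (hN : 2 * s < (N : ℝ))
    (hu : ∀ n, MemHdot s (u n)) (hu₀ : MemHdot s u₀) {C : ℝ}
    (hC : ∀ n, ∫ x, halfLap s (u n) x ^ 2 ≤ C) (hw : WeakTendsto s u u₀) :
    ∃ M, IsWeaklyNull s (fun n => u n - u₀) (fun n => halfLap s (u n) - halfLap s u₀) M := by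
  obtain ⟨S, hS, hsob⟩ := exists_sobolev_Hdot (N := N) hs0 hs1 hN
  have hhl : ∀ n, IsHalfLap s (u n - u₀) (halfLap s (u n) - halfLap s u₀) := fun n =>
    (isHalfLap_halfLap (hu n).2).sub hs0 hs1 (one_lt_critE hs0 hN) (hu n).1 hu₀.1
      (isHalfLap_halfLap hu₀.2)
  have hm := fun n => (hu n).1.sub hu₀.1
  set W : ℝ≥0∞ := ENNReal.ofReal (Real.sqrt C) + eLpNorm (halfLap s u₀) 2 volume with hWdef
  have hWtop : W ≠ ∞ := ENNReal.add_ne_top.2 ⟨ENNReal.ofReal_ne_top, hu₀.memLp_halfLap.2.ne⟩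
  have hW : ∀ n, eLpNorm (halfLap s (u n) - halfLap s u₀) 2 volume ≤ W := by
    intro n
    refine (eLpNorm_sub_le (hu n).memLp_halfLap.1 hu₀.memLp_halfLap.1 (by norm_num)).trans
      (add_le_add ?_ le_rfl)
    rw [← ENNReal.ofReal_toReal (hu n).memLp_halfLap.2.ne]
    refine ENNReal.ofReal_le_ofReal (Real.le_sqrt_of_sq_le ?_)
    rw [← integral_sq_eq (hu n).memLp_halfLap]
    exact hC n
  refine ⟨S * W + W, ENNReal.add_ne_top.2 ⟨ENNReal.mul_ne_top hS hWtop, hWtop⟩, hm, hhl,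
    fun n => ?_, fun n => (hW n).trans le_add_self, fun h hh => ?_⟩
  · exact ((hsob _ _ (hm n) (hhl n)).trans (mul_le_mul' le_rfl (hW n))).trans le_self_add
  · have := holderConjugate_critE (N := N) hs0 hN
    have h1 := (hw.tendsto_integral_mul hs0 hs1 hN hu hu₀ hh).sub_const (∫ x, u₀ x * h x)
    rw [sub_self] at h1
    refine h1.congr fun n => ?_
    refine (integral_sub ((hu n).1.integrable_mul hh) (hu₀.1.integrable_mul hh)).symm.trans ?_
    refine integral_congr_ae (Eventually.of_forall fun x => ?_)
    simp only [Pi.sub_apply, Pi.mul_apply]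
    ring

theorem BoundedSeq.exists_integral_le (hu : ∀ n, MemHdot s (u n)) (hv : ∀ n, MemHdot s (v n))
    (h : BoundedSeq s u v) : ∃ C : ℝ, (∀ n, ∫ x, halfLap s (u n) x ^ 2 ≤ C) ∧
      ∀ n, ∫ x, halfLap s (v n) x ^ 2 ≤ C := by
  obtain ⟨C, hC⟩ := h
  have h1 : ∀ n, ∫ x, energyDensity s (u n) (v n) x =
      (∫ x, halfLap s (u n) x ^ 2) + ∫ x, halfLap s (v n) x ^ 2 := fun n =>
    integral_add (hu n).memLp_halfLap.integrable_sq (hv n).memLp_halfLap.integrable_sq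
  have h2 : ∀ f : RN N → ℝ, 0 ≤ ∫ x, f x ^ 2 := fun f => integral_nonneg fun x => sq_nonneg _
  exact ⟨C, fun n => by linarith [hC n, h1 n, h2 (halfLap s (v n))],
    fun n => by linarith [hC n, h1 n, h2 (halfLap s (u n))]⟩

theorem tendsto_integral_cutoff_sq (hs0 : 0 < s) (hs1 : s < 1) (hN : 2 * s < (N : ℝ))
    (hu : ∀ n, MemHdot s (u n)) (hu₀ : MemHdot s u₀) (hw : WeakTendsto s u u₀) {M : ℝ≥0∞}
    (hnull : IsWeaklyNull s (fun n => u n - u₀) (fun n => halfLap s (u n) - halfLap s u₀) M)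
    {μ : Measure (RN N)} (hμ : MeasTendsto (fun n x => halfLap s (u n) x ^ 2) μ)
    (hψ : IsCutoff ψ A R) :
    Tendsto (fun n => ∫ x, (ψ x * (halfLap s (u n) - halfLap s u₀) x -
      commutator s ψ (u n - u₀) x) ^ 2) atTop
      (𝓝 ((∫ x, ψ x ^ 2 ∂μ) - ∫ x, ψ x ^ 2 * halfLap s u₀ x ^ 2)) := by
  have hcont := hψ.contDiff.continuous
  have hp2 := two_le_ofReal_critExp (N := N) hs0 hN
  have hmul : ∀ f : RN N → ℝ, MemLp f 2 volume → MemLp (fun x => ψ x * f x) 2 volume :=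
    fun f hf => hψ.memLp_mul le_rfl hf
  refine tendsto_integral_sub_sq (fun n => hmul _ (hnull.isHalfLap n).1)
    (fun n => hψ.memLp_commutator hs0 hs1 hp2 ENNReal.ofReal_ne_top (hnull.memLp n)) ?_
    (hnull.tendsto_eLpNorm_commutator hs0 hs1 hN hψ)
  set w₀ := halfLap s u₀ with hw₀
  have hw₀m : MemLp w₀ 2 volume := hu₀.memLp_halfLap
  have hg : MemLp (fun x => ψ x * (ψ x * w₀ x)) 2 volume := hmul _ (hmul _ hw₀m)
  have t1 := hμ (fun x => ψ x ^ 2) (hcont.pow 2) (hψ.hasCompactSupport.comp_left (g := fun t => t ^ 2) (by simp))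
  have t2 := hw.tendsto_integral_halfLap_mul hs0 hs1 hN hu hu₀ hg
  have t3 := (t1.sub (t2.const_mul 2)).add_const (∫ x, w₀ x * (ψ x * (ψ x * w₀ x)))
  have e : (∫ x, w₀ x * (ψ x * (ψ x * w₀ x))) = ∫ x, ψ x ^ 2 * w₀ x ^ 2 :=
    integral_congr_ae (Eventually.of_forall fun x => by ring)
  rw [e] at t3
  convert t3 using 1
  · ext n
    have hn := (hu n).memLp_halfLap
    have i1 : Integrable (fun x => ψ x ^ 2 * halfLap s (u n) x ^ 2) volume := by
      simpa only [mul_pow] using (hmul _ hn).integrable_sq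
    have i2 : Integrable (fun x => halfLap s (u n) x * (ψ x * (ψ x * w₀ x))) volume :=
      hn.integrable_mul hg
    have i3 : Integrable (fun x => ψ x ^ 2 * w₀ x ^ 2) volume := by
      simpa only [mul_pow] using (hmul _ hw₀m).integrable_sq
    rw [← integral_const_mul, ← integral_sub i1 (i2.const_mul 2)]
    refine Eq.trans ?_ (integral_add (i1.sub (i2.const_mul 2)) i3)
    refine integral_congr_ae (Eventually.of_forall fun x => ?_)
    simp only [Pi.sub_apply]
    ring
  · congr 1; ring

theorem IsCriticalK.integrable_extendK {q : ℝ} (hK : IsCriticalK q K) (hq : 0 < q) {f g : RN N → ℝ}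
    (hf : MemLp f (ENNReal.ofReal q) volume) (hg : MemLp g (ENNReal.ofReal q) volume) :
    Integrable (fun x => extendK K (f x) (g x)) volume := by
  obtain ⟨C, hC, h⟩ := hK.exists_extendK_le_left hq one_pos
  refine Integrable.mono' (((integrable_abs_rpow hq hg).const_mul 1).add
    ((integrable_abs_rpow hq hf).const_mul C))
    ((hK.isHomogeneous hq).continuous.comp_aestronglyMeasurable (hf.1.prodMk hg.1))
    (Eventually.of_forall fun x => ?_)
  rw [Real.norm_of_nonneg (hK.extendK_nonneg _ _)]
  exact h _ _

theorem enorm_prod_rpow_le {q : ℝ} (a b : ℝ) :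
    ‖(a, b)‖ₑ ^ q ≤ ‖a‖ₑ ^ q + ‖b‖ₑ ^ q := by
  rw [← ofReal_norm, Prod.norm_def]
  rcases le_total ‖a‖ ‖b‖ with h | h
  · rw [max_eq_right h, ofReal_norm]; exact le_add_self
  · rw [max_eq_left h, ofReal_norm]; exact le_self_add

theorem lintegral_enorm_rpow_eq {q : ℝ} (hq : 0 < q) (f : RN N → ℝ) :
    ∫⁻ x, ‖f x‖ₑ ^ q = eLpNorm f (ENNReal.ofReal q) volume ^ q := by
  have h := eLpNorm_nnreal_pow_eq_lintegral (f := f) (μ := volume) (p := q.toNNReal)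
    (by simpa using hq)
  rw [Real.coe_toNNReal _ hq.le] at h
  exact h.symm

/-- Splitting of the nonlinear energy along the sequence. -/
theorem tendsto_integral_cutoff_extendK (hs0 : 0 < s) (hs1 : s < 1) (hN : 2 * s < (N : ℝ))
    (hK : IsCriticalK (critExp N s) K)
    (hu : ∀ n, MemHdot s (u n)) (hu₀ : MemHdot s u₀)
    (hv : ∀ n, MemHdot s (v n)) (hv₀ : MemHdot s v₀) {wu wv : ℕ → RN N → ℝ} {M M' : ℝ≥0∞}
    (hnull : IsWeaklyNull s (fun n => u n - u₀) wu M)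
    (hnull' : IsWeaklyNull s (fun n => v n - v₀) wv M')
    {ν : Measure (RN N)} (hν : MeasTendsto (fun n x => extendK K (u n x) (v n x)) ν)
    (hψ : IsCutoff ψ A R) (hψ0 : ∀ x, 0 ≤ ψ x) :
    Tendsto (fun n => ∫ x, ψ x ^ critExp N s * extendK K ((u n - u₀) x) ((v n - v₀) x)) atTop
      (𝓝 ((∫ x, ψ x ^ critExp N s ∂ν) - ∫ x, ψ x ^ critExp N s * extendK K (u₀ x) (v₀ x))) := by
  set q := critExp N s with hqdef
  have hq : 0 < q := by have := two_lt_critExp hs0 hN; linarith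
  have hcont : Continuous fun x => ψ x ^ q := hψ.contDiff.continuous.rpow_const fun x => Or.inr hq.le
  obtain ⟨B, hB0, hB⟩ := hψ.exists_norm_le
  have hBq : ∀ x, ‖ψ x ^ q‖ ≤ B ^ q := fun x => by
    rw [Real.norm_of_nonneg (Real.rpow_nonneg (hψ0 x) _)]
    exact Real.rpow_le_rpow (hψ0 x) ((le_abs_self _).trans (hB x)) hq.le
  have t1 := hν (fun x => ψ x ^ q) hcont
    (hψ.hasCompactSupport.comp_left (g := fun t : ℝ => t ^ q) (by simp [hq.ne']))
  have hinteg : ∀ {f g : RN N → ℝ}, MemLp f (ENNReal.ofReal q) volume →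
      MemLp g (ENNReal.ofReal q) volume →
      Integrable (fun x => ψ x ^ q * extendK K (f x) (g x)) volume := fun hf hg =>
    (hK.integrable_extendK hq hf hg).bdd_mul hcont.aestronglyMeasurable (Eventually.of_forall hBq)
  set D : ℕ → RN N → ℝ := fun n x => extendK K (u n x) (v n x) -
    extendK K ((u n - u₀) x) ((v n - v₀) x) - extendK K (u₀ x) (v₀ x) with hD
  have hmeas : ∀ (θ w : ℕ → RN N → ℝ) (M : ℝ≥0∞), IsWeaklyNull s θ w M →
      TendstoInMeasure (volume.restrict (Metric.ball (0 : RN N) R)) θ atTop 0 := by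
    intro θ w M h
    refine tendstoInMeasure_of_tendsto_eLpNorm (p := 2) (by norm_num)
      (fun n => (h.memLp n).1.restrict) aestronglyMeasurable_zero ?_
    simp only [sub_zero]
    refine (h.tendsto_eLpNorm_ball hs0 hs1 hN hψ.pos).congr fun n => ?_
    rw [eLpNorm_indicator_eq_eLpNorm_restrict measurableSet_ball]
  have hpair : TendstoInMeasure (volume.restrict (Metric.ball (0 : RN N) R))
      (fun n x => ((u n - u₀) x, (v n - v₀) x)) atTop 0 := by
    intro ε hε
    have h1 := (hmeas _ _ _ hnull ε hε).add (hmeas _ _ _ hnull' ε hε)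
    rw [add_zero] at h1
    refine tendsto_of_tendsto_of_tendsto_of_le_of_le tendsto_const_nhds h1 (fun n => zero_le)
      fun n => (measure_mono ?_).trans (measure_union_le _ _)
    intro x hx
    simp only [Pi.zero_apply] at hx
    change ε ≤ edist _ (0 : ℝ × ℝ) at hx
    rw [Prod.edist_eq, le_max_iff] at hx
    exact hx
  have hF := hK.isHomogeneous hq
  have hlin : ∀ {f g : RN N → ℝ} {a b : ℝ≥0∞}, eLpNorm f (ENNReal.ofReal q) volume ≤ a →
      eLpNorm g (ENNReal.ofReal q) volume ≤ b → AEStronglyMeasurable f volume →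
      ∫⁻ x in Metric.ball (0 : RN N) R, ‖(f x, g x)‖ₑ ^ q ≤ a ^ q + b ^ q := by
    intro f g a b ha hb hf
    refine (setLIntegral_le_lintegral _ _).trans
      ((lintegral_mono fun x => enorm_prod_rpow_le (f x) (g x)).trans ?_)
    rw [lintegral_add_left' (hf.enorm.pow_const q), lintegral_enorm_rpow_eq hq,
      lintegral_enorm_rpow_eq hq]
    exact add_le_add (ENNReal.rpow_le_rpow ha hq.le) (ENNReal.rpow_le_rpow hb hq.le)
  have hBL := hF.tendsto_lintegral_brezisLieb_of_inMeasure hq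
    (μ := volume.restrict (Metric.ball (0 : RN N) R)) (a := fun x => (u₀ x, v₀ x))
    (b := fun n x => ((u n - u₀) x, (v n - v₀) x))
    (M := M ^ q + M' ^ q)
    (hu₀.1.1.prodMk hv₀.1.1).restrict
    (fun n => ((hnull.memLp n).1.prodMk (hnull'.memLp n).1).restrict)
    (ne_top_of_le_ne_top (ENNReal.add_ne_top.2
      ⟨ENNReal.rpow_ne_top_of_nonneg hq.le hu₀.1.2.ne,
        ENNReal.rpow_ne_top_of_nonneg hq.le hv₀.1.2.ne⟩) (hlin le_rfl le_rfl hu₀.1.1))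
    (ENNReal.add_ne_top.2 ⟨ENNReal.rpow_ne_top_of_nonneg hq.le hnull.ne_top,
        ENNReal.rpow_ne_top_of_nonneg hq.le hnull'.ne_top⟩)
    (fun n => hlin (hnull.eLpNorm_le n) (hnull'.eLpNorm_le n) (hnull.memLp n).1) hpair
  have t2 : Tendsto (fun n => ∫ x, ψ x ^ q * D n x) atTop (𝓝 0) := by
    rw [tendsto_zero_iff_enorm_tendsto_zero]
    have h1 := ENNReal.Tendsto.const_mul (a := ENNReal.ofReal (B ^ q)) hBL
      (Or.inr ENNReal.ofReal_ne_top)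
    rw [mul_zero] at h1
    refine tendsto_of_tendsto_of_tendsto_of_le_of_le tendsto_const_nhds h1 (fun n => zero_le)
      fun n => ?_
    refine (enorm_integral_le_lintegral_enorm _).trans ?_
    rw [← lintegral_const_mul' _ _ ENNReal.ofReal_ne_top, ← lintegral_indicator measurableSet_ball]
    refine lintegral_mono fun x => ?_
    by_cases hx : x ∈ Metric.ball (0 : RN N) R
    · rw [indicator_of_mem hx, enorm_mul]
      refine mul_le_mul' ?_ (le_of_eq ?_)
      · rw [← ofReal_norm]
        exact ENNReal.ofReal_le_ofReal (hBq x)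
      · simp [hD]
    · rw [hψ.zero x hx, Real.zero_rpow hq.ne', zero_mul, enorm_zero]
      exact zero_le
  have t3 := (t1.sub t2).sub_const (∫ x, ψ x ^ q * extendK K (u₀ x) (v₀ x))
  rw [sub_zero] at t3
  refine t3.congr fun n => ?_
  have i1 := hinteg (hu n).1 (hv n).1
  have i2 := hinteg (hnull.memLp n) (hnull'.memLp n)
  have i3 := hinteg hu₀.1 hv₀.1
  have e : ∫ x, ψ x ^ q * D n x = (∫ x, ψ x ^ q * extendK K (u n x) (v n x)) -
      (∫ x, ψ x ^ q * extendK K ((u n - u₀) x) ((v n - v₀) x)) -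
      ∫ x, ψ x ^ q * extendK K (u₀ x) (v₀ x) := by
    rw [← integral_sub i1 i2]
    refine Eq.trans ?_ (integral_sub (i1.sub i2) i3)
    refine integral_congr_ae (Eventually.of_forall fun x => ?_)
    simp only [hD, Pi.sub_apply]
    ring
  rw [e]
  ring

end Limits
end FracCC

namespace FracCC

open scoped ENNReal NNReal FourierTransform

section LimitInequalities

variable {N : ℕ} [NeZero N] {s : ℝ} {K : ℝ × ℝ → ℝ} {u v : ℕ → RN N → ℝ} {u₀ v₀ : RN N → ℝ}

/-- The inequalities between the defects of the three limit measures, tested on smooth functions. -/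
theorem exists_cutoff_limit_le (hs0 : 0 < s) (hs1 : s < 1) (hN : 2 * s < (N : ℝ))
    (hK : IsCriticalK (critExp N s) K) (hu : ∀ n, MemHdot s (u n)) (hv : ∀ n, MemHdot s (v n))
    (hu₀ : MemHdot s u₀) (hv₀ : MemHdot s v₀) (hbdd : BoundedSeq s u v)
    (huw : WeakTendsto s u u₀) (hvw : WeakTendsto s v v₀) {μ σ ν : Measure (RN N)}
    (hμ : MeasTendsto (fun n x => halfLap s (u n) x ^ 2) μ)
    (hσ : MeasTendsto (fun n x => halfLap s (v n) x ^ 2) σ)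
    (hν : MeasTendsto (fun n x => extendK K (u n x) (v n x)) ν) :
    ∃ S₀ : ℝ, 0 ≤ S₀ ∧ ∀ (ψ : RN N → ℝ), ContDiff ℝ (⊤ : ℕ∞) ψ → HasCompactSupport ψ →
      (∀ x, 0 ≤ ψ x) → ∀ m t k : ℝ,
      m = (∫ x, ψ x ^ 2 ∂μ) - (∫ x, ψ x ^ 2 * halfLap s u₀ x ^ 2) →
      t = (∫ x, ψ x ^ 2 ∂σ) - (∫ x, ψ x ^ 2 * halfLap s v₀ x ^ 2) →
      k = (∫ x, ψ x ^ critExp N s ∂ν) -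
        (∫ x, ψ x ^ critExp N s * extendK K (u₀ x) (v₀ x)) →
      0 ≤ m ∧ 0 ≤ t ∧ 0 ≤ k ∧ sobolevK N s K * k ^ (2 / critExp N s) ≤ m + t ∧
      ∀ c d : ℝ, 0 ≤ c → 0 ≤ d →
        (∀ a b, extendK K a b ≤ c * |a| ^ critExp N s + d * |b| ^ critExp N s) →
        k ≤ S₀ * (c * m ^ (critExp N s / 2) + d * t ^ (critExp N s / 2)) := by
  obtain ⟨C, hCu, hCv⟩ := hbdd.exists_integral_le hu hv
  obtain ⟨M, hnu⟩ := huw.exists_isWeaklyNull hs0 hs1 hN hu hu₀ hCu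
  obtain ⟨M', hnv⟩ := hvw.exists_isWeaklyNull hs0 hs1 hN hv hv₀ hCv
  obtain ⟨S, hS, hsob⟩ := exists_sobolev_Hdot (N := N) hs0 hs1 hN
  have hp2 := two_le_ofReal_critExp (N := N) hs0 hN
  set q := critExp N s with hqdef
  have hq : 0 < q := by have := two_lt_critExp hs0 hN; linarith
  refine ⟨S.toReal ^ q, by positivity, ?_⟩
  rintro ψ hψ1 hψc hψ0 m t k rfl rfl rfl
  obtain ⟨A, R, hψ⟩ := exists_isCutoff hψ1 hψc
  have lu := tendsto_integral_cutoff_sq hs0 hs1 hN hu hu₀ huw hnu hμ hψ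
  have lv := tendsto_integral_cutoff_sq hs0 hs1 hN hv hv₀ hvw hnv hσ hψ
  have lk := tendsto_integral_cutoff_extendK hs0 hs1 hN hK hu hu₀ hv hv₀ hnu hnv hν hψ hψ0
  rw [← hqdef] at lk
  have hlu : ∀ n, IsHalfLap s (fun x => ψ x * (u n - u₀) x) _ := fun n =>
    IsHalfLap.cutoff_mul hs0 hs1 hψ hp2 ENNReal.ofReal_ne_top (hnu.memLp n) (hnu.isHalfLap n)
  have hlv : ∀ n, IsHalfLap s (fun x => ψ x * (v n - v₀) x) _ := fun n =>
    IsHalfLap.cutoff_mul hs0 hs1 hψ hp2 ENNReal.ofReal_ne_top (hnv.memLp n) (hnv.isHalfLap n)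
  have hhom : ∀ n x, extendK K (ψ x * (u n - u₀) x) (ψ x * (v n - v₀) x) =
      ψ x ^ q * extendK K ((u n - u₀) x) ((v n - v₀) x) := fun n x =>
    (hK.isHomogeneous hq).smul (ψ x) ((u n - u₀) x, (v n - v₀) x) (hψ0 x)
  have hmu : ∀ n, MemLp (fun x => ψ x * (u n - u₀) x) (ENNReal.ofReal q) volume := fun n =>
    hψ.memLp_mul le_rfl (hnu.memLp n)
  have hmv : ∀ n, MemLp (fun x => ψ x * (v n - v₀) x) (ENNReal.ofReal q) volume := fun n =>
    hψ.memLp_mul le_rfl (hnv.memLp n)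
  refine ⟨ge_of_tendsto' lu fun n => integral_nonneg fun x => sq_nonneg _,
    ge_of_tendsto' lv fun n => integral_nonneg fun x => sq_nonneg _,
    ge_of_tendsto' lk fun n => integral_nonneg fun x =>
      mul_nonneg (Real.rpow_nonneg (hψ0 x) _) (hK.extendK_nonneg _ _), ?_, ?_⟩
  · refine le_of_tendsto_of_tendsto' ((lk.rpow_const (Or.inr (by positivity))).const_mul _)
      (lu.add lv) fun n => ?_
    have h1 := sobolevK_mul_le hK hq (hψ.memLp_mul hp2 (hnu.memLp n))
      (hψ.memLp_mul hp2 (hnv.memLp n)) (hlu n) (hlv n)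
    simp only [hhom] at h1
    exact h1
  · intro c d hc hd hcd
    refine le_of_tendsto_of_tendsto' lk (((lu.rpow_const (p := q / 2) (Or.inr (by positivity))).const_mul c).add
      ((lv.rpow_const (p := q / 2) (Or.inr (by positivity))).const_mul d) |>.const_mul (S.toReal ^ q)) fun n => ?_
    have key : ∀ {f w : RN N → ℝ}, MemLp f (ENNReal.ofReal q) volume → IsHalfLap s f w →
        ∫ x, |f x| ^ q ≤ S.toReal ^ q * (∫ x, w x ^ 2) ^ (q / 2) := by
      intro f w hf hw
      rw [integral_abs_rpow hq hf, integral_sq_eq hw.1, ← Real.rpow_natCast, ← Real.rpow_mul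
        ENNReal.toReal_nonneg, Nat.cast_ofNat, mul_div_cancel₀ _ two_ne_zero,
        ← Real.mul_rpow ENNReal.toReal_nonneg ENNReal.toReal_nonneg, ← ENNReal.toReal_mul]
      exact Real.rpow_le_rpow ENNReal.toReal_nonneg (ENNReal.toReal_mono
        (ENNReal.mul_ne_top hS hw.1.2.ne) (hsob _ _ hf hw)) hq.le
    have i1 := integrable_abs_rpow hq (hmu n)
    have i2 := integrable_abs_rpow hq (hmv n)
    have h1 := key (hmu n) (hlu n)
    have h2 := key (hmv n) (hlv n)
    calc ∫ x, ψ x ^ q * extendK K ((u n - u₀) x) ((v n - v₀) x)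
        ≤ ∫ x, (c * |ψ x * (u n - u₀) x| ^ q + d * |ψ x * (v n - v₀) x| ^ q) := by
          refine integral_mono ?_ ((i1.const_mul c).add (i2.const_mul d)) fun x => ?_
          · simpa only [hhom] using hK.integrable_extendK hq (hmu n) (hmv n)
          · dsimp only
            rw [← hhom]
            exact hcd _ _
      _ = c * (∫ x, |ψ x * (u n - u₀) x| ^ q) + d * ∫ x, |ψ x * (v n - v₀) x| ^ q := by
          rw [integral_add (i1.const_mul c) (i2.const_mul d), integral_const_mul, integral_const_mul]
      _ ≤ _ := by
          refine (add_le_add (mul_le_mul_of_nonneg_left h1 hc)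
            (mul_le_mul_of_nonneg_left h2 hd)).trans (le_of_eq ?_)
          ring

end LimitInequalities

section Measures

variable {N : ℕ}

/-- Smooth functions that decrease to the indicator of a compact set. -/
theorem exists_smooth_seq {T : Set (RN N)} (hT : IsCompact T) :
    ∃ ψ : ℕ → RN N → ℝ, (∀ n, ContDiff ℝ (⊤ : ℕ∞) (ψ n)) ∧ (∀ n, HasCompactSupport (ψ n)) ∧
      (∀ n x, 0 ≤ ψ n x) ∧ ∀ (τ : Measure (RN N)) [IsFiniteMeasure τ] (p : ℝ), 0 < p →
        Tendsto (fun n => ∫ x, ψ n x ^ p ∂τ) atTop (𝓝 (τ.real T)) := by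
  set δ : ℕ → ℝ := fun n => 1 / ((n : ℝ) + 1) with hδ
  have hδ0 : ∀ n, 0 < δ n := fun n => by simp only [hδ]; positivity
  have hex : ∀ n, ∃ f : RN N → ℝ, ContDiff ℝ (⊤ : ℕ∞) f ∧ range f ⊆ Icc 0 1 ∧
      Function.support f = Metric.thickening (δ n) T ∧ ∀ x, x ∈ T ↔ f x = 1 := fun n => by
    obtain ⟨f, h1, h2, h3, h4⟩ := exists_contMDiff_support_eq_eq_one_iff
      (modelWithCornersSelf ℝ (RN N)) (n := (⊤ : ℕ∞)) (Metric.isOpen_thickening (δ := δ n) (E := T))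
      hT.isClosed (Metric.self_subset_thickening (hδ0 n) T)
    exact ⟨f, contMDiff_iff_contDiff.1 h1, h2, h3, h4⟩
  choose ψ h1 h2 h3 h4 using hex
  have h01 : ∀ n x, 0 ≤ ψ n x ∧ ψ n x ≤ 1 := fun n x => h2 n ⟨x, rfl⟩
  have hcs : ∀ n, HasCompactSupport (ψ n) := fun n =>
    HasCompactSupport.intro (hT.cthickening (r := δ n)) fun x hx => by
      by_contra h
      have : x ∈ Metric.thickening (δ n) T := by rw [← h3 n]; exact h
      exact hx (Metric.thickening_subset_cthickening _ _ this)
  refine ⟨ψ, h1, hcs, fun n x => (h01 n x).1, fun τ _ p hp => ?_⟩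
  have hδlim : Tendsto δ atTop (𝓝[>] 0) := tendsto_nhdsWithin_iff.2
    ⟨tendsto_one_div_add_atTop_nhds_zero_nat, Eventually.of_forall hδ0⟩
  have ht := ((ENNReal.tendsto_toReal (measure_ne_top τ T)).comp
    ((tendsto_measure_thickening_of_isClosed (μ := τ) ⟨1, one_pos, measure_ne_top _ _⟩
      hT.isClosed).comp hδlim))
  have hcont : ∀ n, Continuous fun x => ψ n x ^ p := fun n =>
    (h1 n).continuous.rpow_const fun x => Or.inr hp.le
  have hinteg : ∀ n, Integrable (fun x => ψ n x ^ p) τ := fun n =>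
    (hcont n).integrable_of_hasCompactSupport
      ((hcs n).comp_left (g := fun t : ℝ => t ^ p) (by simp [hp.ne']))
  refine tendsto_of_tendsto_of_tendsto_of_le_of_le tendsto_const_nhds ht (fun n => ?_) fun n => ?_
  · rw [← integral_indicator_one hT.measurableSet]
    refine integral_mono ((integrable_indicator_iff hT.measurableSet).2 (integrable_const 1).integrableOn) (hinteg n)
      fun x => ?_
    by_cases hx : x ∈ T
    · simp [indicator_of_mem hx, (h4 n x).1 hx]
    · simp only [indicator_of_notMem hx]
      exact Real.rpow_nonneg (h01 n x).1 _
  · have hm : MeasurableSet (Metric.thickening (δ n) T) := Metric.isOpen_thickening.measurableSet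
    change _ ≤ τ.real (Metric.thickening (δ n) T)
    rw [← integral_indicator_one hm]
    refine integral_mono (hinteg n) ((integrable_indicator_iff hm).2 (integrable_const 1).integrableOn)
      fun x => ?_
    by_cases hx : x ∈ Metric.thickening (δ n) T
    · simp only [indicator_of_mem hx, Pi.one_apply]
      exact Real.rpow_le_one (h01 n x).1 (h01 n x).2 hp.le
    · have : ψ n x = 0 := by
        rw [← h3 n] at hx
        simpa using hx
      simp only [indicator_of_notMem hx, this, Real.zero_rpow hp.ne', le_refl]

theorem measure_le_of_isCompact {τ₁ τ₂ : Measure (RN N)} [IsFiniteMeasure τ₁]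
    (h : ∀ T, IsCompact T → τ₁ T ≤ τ₂ T) : τ₁ ≤ τ₂ := by
  refine Measure.le_iff.2 fun B hB => ?_
  rw [hB.measure_eq_iSup_isCompact_of_ne_top (measure_ne_top _ _)]
  exact iSup_le fun T => iSup_le fun hTB => iSup_le fun hT => (h T hT).trans (measure_mono hTB)

theorem measure_le_of_integral_rpow_le {τ₁ τ₂ : Measure (RN N)} [IsFiniteMeasure τ₁]
    [IsFiniteMeasure τ₂] {p : ℝ} (hp : 0 < p)
    (h : ∀ ψ : RN N → ℝ, ContDiff ℝ (⊤ : ℕ∞) ψ → HasCompactSupport ψ → (∀ x, 0 ≤ ψ x) →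
      ∫ x, ψ x ^ p ∂τ₁ ≤ ∫ x, ψ x ^ p ∂τ₂) : τ₁ ≤ τ₂ := by
  refine measure_le_of_isCompact fun T hT => ?_
  obtain ⟨ψ, h1, h2, h3, h4⟩ := exists_smooth_seq hT
  have := le_of_tendsto_of_tendsto' (h4 τ₁ p hp) (h4 τ₂ p hp) fun n => h _ (h1 n) (h2 n) (h3 n)
  exact (ENNReal.toReal_le_toReal (measure_ne_top _ _) (measure_ne_top _ _)).1 this

/-- A finite measure that is small of higher order with respect to an atomless measure vanishes. -/
theorem measure_eq_zero_of_le_rpow {τ κ : Measure (RN N)} [IsFiniteMeasure τ] {C : ℝ≥0∞} (hC : C ≠ ∞)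
    {r : ℝ} (hr : 1 < r) (h : ∀ B, MeasurableSet B → κ B ≤ C * τ B ^ r) (hτ : ∀ x, τ {x} = 0) :
    κ = 0 := by
  have key : ∀ δ : ℝ≥0∞, 0 < δ → κ univ ≤ C * (δ ^ (r - 1) * τ univ) := by
    intro δ hδ
    have hnh : ∀ x : RN N, ∃ U ∈ 𝓝 x, IsOpen U ∧ τ U < δ := by
      intro x
      obtain ⟨U, hxU, hU, hlt⟩ := Set.exists_isOpen_lt_of_lt (μ := τ) {x} δ (by rwa [hτ x])
      exact ⟨U, hU.mem_nhds (hxU rfl), hU, hlt⟩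
    choose U hUx hUo hUδ using hnh
    obtain ⟨Z, hZ, hcov⟩ := TopologicalSpace.countable_cover_nhds hUx
    have hne : Z.Nonempty := by
      by_contra hne
      rw [not_nonempty_iff_eq_empty.1 hne] at hcov
      simp only [mem_empty_iff_false, iUnion_of_empty, iUnion_empty] at hcov
      exact Set.empty_ne_univ hcov
    obtain ⟨z, hz⟩ := hZ.exists_eq_range hne
    set V : ℕ → Set (RN N) := fun n => U (z n) with hV
    have hVc : ⋃ n, V n = univ := by
      rw [← hcov, hz, biUnion_range]
    have hVm : ∀ n, MeasurableSet (V n) := fun n => (hUo _).measurableSet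
    have hdm : ∀ n, MeasurableSet (disjointed V n) := fun n => MeasurableSet.disjointed hVm n
    have hdu : ⋃ n, disjointed V n = univ := by rw [iUnion_disjointed, hVc]
    calc κ univ = κ (⋃ n, disjointed V n) := by rw [hdu]
      _ ≤ ∑' n, κ (disjointed V n) := measure_iUnion_le _
      _ ≤ ∑' n, C * (δ ^ (r - 1) * τ (disjointed V n)) := by
          refine ENNReal.tsum_le_tsum fun n => (h _ (hdm n)).trans (mul_le_mul' le_rfl ?_)
          have hle : τ (disjointed V n) ≤ δ :=
            (measure_mono (disjointed_subset V n)).trans (hUδ _).le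
          calc τ (disjointed V n) ^ r = τ (disjointed V n) ^ (r - 1) * τ (disjointed V n) := by
                conv_lhs => rw [show r = (r - 1) + 1 by ring]
                rw [ENNReal.rpow_add_of_nonneg _ _ (by linarith) zero_le_one, ENNReal.rpow_one]
            _ ≤ _ := mul_le_mul' (ENNReal.rpow_le_rpow hle (by linarith)) le_rfl
      _ = C * (δ ^ (r - 1) * τ univ) := by
          rw [ENNReal.tsum_mul_left, ENNReal.tsum_mul_left, ← measure_iUnion (disjoint_disjointed V) hdm,
            hdu]
  rw [← Measure.measure_univ_eq_zero, ← nonpos_iff_eq_zero]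
  have hlim : Tendsto (fun δ : ℝ≥0∞ => C * (δ ^ (r - 1) * τ univ)) (𝓝[>] 0) (𝓝 0) := by
    have t1 : Tendsto (fun δ : ℝ≥0∞ => δ ^ (r - 1)) (𝓝[>] 0) (𝓝 0) := by
      have := ((ENNReal.continuous_rpow_const (y := r - 1)).tendsto 0).mono_left
        (nhdsWithin_le_nhds (s := Ioi 0))
      rwa [ENNReal.zero_rpow_of_pos (by linarith)] at this
    have t2 := ENNReal.Tendsto.const_mul (a := C) (ENNReal.Tendsto.mul_const (b := τ univ) t1
      (Or.inr (measure_ne_top _ _))) (Or.inr hC)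
    simpa using t2
  exact ge_of_tendsto hlim (eventually_nhdsWithin_of_forall fun δ hδ => key δ hδ)

theorem countable_setOf_measure_singleton_ne_zero (τ : Measure (RN N)) [IsFiniteMeasure τ] :
    {x | τ {x} ≠ 0}.Countable := by
  have := Measure.countable_meas_pos_of_disjoint_iUnion (μ := τ) (As := fun x : RN N => {x})
    (fun x => measurableSet_singleton x) fun x y hxy => by simpa using hxy
  simpa [pos_iff_ne_zero] using this

theorem atomicMeasure_eq_restrict (τ : Measure (RN N)) [IsFiniteMeasure τ] {D : Set (RN N)}
    (hD : D.Countable) :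
    atomicMeasure (fun x : D => (x : RN N)) (fun x => τ.real {(x : RN N)}) = τ.restrict D := by
  have := hD.to_subtype
  rw [atomicMeasure]
  conv_rhs => rw [← biUnion_of_singleton D, biUnion_eq_iUnion]
  rw [Measure.restrict_iUnion (fun x y hxy => by
    simpa [Function.onFun, Subtype.ext_iff] using hxy) fun x => measurableSet_singleton _]
  congr 1; ext1 x
  rw [Measure.restrict_singleton, ofReal_measureReal]

/-- Reverse Hölder inequalities force the concentration on countably many atoms. -/
theorem exists_countable_atoms {μ σ ν : Measure (RN N)} [IsFiniteMeasure μ] [IsFiniteMeasure σ]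
    [IsFiniteMeasure ν] {q S : ℝ} (hq : 2 < q)
    (h1 : ∀ T, IsCompact T → S * ν.real T ^ (2 / q) ≤ μ.real T + σ.real T)
    (h2 : ∀ ε : ℝ, 0 < ε → ∃ C : ℝ, 0 ≤ C ∧ ∀ T, IsCompact T →
      ν.real T ≤ ε * σ.real T ^ (q / 2) + C * μ.real T ^ (q / 2))
    (h3 : ∀ ε : ℝ, 0 < ε → ∃ C : ℝ, 0 ≤ C ∧ ∀ T, IsCompact T →
      ν.real T ≤ ε * μ.real T ^ (q / 2) + C * σ.real T ^ (q / 2)) :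
    ∃ D : Set (RN N), D.Countable ∧ ν.restrict D = ν ∧
      (∀ x ∈ D, 0 < μ.real {x} ∧ 0 < σ.real {x} ∧ 0 < ν.real {x}) ∧
      ∀ x ∈ D, S * ν.real {x} ^ (2 / q) ≤ μ.real {x} + σ.real {x} := by
  have hq2 : 0 < q / 2 := by linarith
  have hzero : ∀ {τ₁ τ₂ : Measure (RN N)}, (∀ ε : ℝ, 0 < ε → ∃ C : ℝ, 0 ≤ C ∧ ∀ T, IsCompact T →
      ν.real T ≤ ε * τ₂.real T ^ (q / 2) + C * τ₁.real T ^ (q / 2)) → ∀ x, τ₁.real {x} = 0 →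
      ν.real {x} = 0 := by
    intro τ₁ τ₂ h x hx
    refine le_antisymm (le_of_forall_pos_le_add fun ε hε => ?_) measureReal_nonneg
    obtain ⟨C, -, hC⟩ := h (ε / (τ₂.real {x} ^ (q / 2) + 1)) (by positivity)
    have h4 := hC {x} isCompact_singleton
    rw [hx, Real.zero_rpow hq2.ne', mul_zero, add_zero] at h4
    refine h4.trans ?_
    rw [zero_add, div_mul_eq_mul_div, div_le_iff₀ (by positivity)]
    nlinarith
  set τ := μ + σ with hτ
  obtain ⟨C, hC0, hC⟩ := h2 1 one_pos
  have hbound : ∀ B, MeasurableSet B → ν B ≤ ENNReal.ofReal (1 + C) * τ B ^ (q / 2) := by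
    intro B hB
    rw [hB.measure_eq_iSup_isCompact_of_ne_top (measure_ne_top _ _)]
    refine iSup_le fun T => iSup_le fun hTB => iSup_le fun hT => ?_
    refine le_trans ?_ (mul_le_mul' le_rfl (ENNReal.rpow_le_rpow (measure_mono hTB) hq2.le))
    rw [← ofReal_measureReal (μ := ν), ← ofReal_measureReal (μ := τ),
      ENNReal.ofReal_rpow_of_nonneg measureReal_nonneg hq2.le, ← ENNReal.ofReal_mul (by positivity)]
    refine ENNReal.ofReal_le_ofReal ((hC T hT).trans ?_)
    have e : τ.real T = μ.real T + σ.real T := measureReal_add_apply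
    have e1 : σ.real T ^ (q / 2) ≤ τ.real T ^ (q / 2) := Real.rpow_le_rpow measureReal_nonneg
      (by rw [e]; linarith [measureReal_nonneg (μ := μ) (s := T)]) hq2.le
    have e2 : μ.real T ^ (q / 2) ≤ τ.real T ^ (q / 2) := Real.rpow_le_rpow measureReal_nonneg
      (by rw [e]; linarith [measureReal_nonneg (μ := σ) (s := T)]) hq2.le
    nlinarith
  set D : Set (RN N) := {x | ν {x} ≠ 0} with hD
  have hDc : D.Countable := countable_setOf_measure_singleton_ne_zero ν
  set D' : Set (RN N) := {x | τ {x} ≠ 0} with hD'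
  have hD'c : D'.Countable := countable_setOf_measure_singleton_ne_zero τ
  have hz : ν.restrict D'ᶜ = 0 := by
    refine measure_eq_zero_of_le_rpow (τ := τ.restrict D'ᶜ) (ENNReal.ofReal_ne_top (r := 1 + C))
      (r := q / 2) (by linarith) (fun B hB => ?_) fun x => ?_
    · rw [Measure.restrict_apply hB, Measure.restrict_apply hB]
      exact hbound _ (hB.inter hD'c.measurableSet.compl)
    · rw [Measure.restrict_apply (measurableSet_singleton x)]
      by_cases hx : x ∈ D'
      · rw [show ({x} : Set (RN N)) ∩ D'ᶜ = ∅ by ext y; simp; rintro rfl; exact hx, measure_empty]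
      · exact measure_mono_null inter_subset_left (by simpa [hD'] using hx)
  refine ⟨D, hDc, ?_, fun x hx => ?_, fun x hx => h1 _ isCompact_singleton⟩
  · refine Measure.restrict_eq_self_of_ae_mem ?_
    rw [ae_iff]
    have hsub : {x | ¬ x ∈ D} ⊆ D'ᶜ ∪ ⋃ x ∈ D' \ D, {x} := by
      intro x hx
      by_cases hx' : x ∈ D'
      · exact Or.inr (mem_biUnion (⟨hx', hx⟩ : x ∈ D' \ D) rfl)
      · exact Or.inl hx'
    refine measure_mono_null hsub (measure_union_null ?_ ?_)
    · rwa [Measure.restrict_eq_zero] at hz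
    · refine (measure_biUnion_null_iff (hD'c.mono sdiff_subset)).2 fun x hx => ?_
      simpa [hD] using hx.2
  · have hx' : ν.real {x} ≠ 0 := by
      rw [measureReal_def, ENNReal.toReal_ne_zero]
      exact ⟨hx, measure_ne_top _ _⟩
    exact ⟨measureReal_nonneg.lt_of_ne fun h => hx' (hzero h2 x h.symm),
      measureReal_nonneg.lt_of_ne fun h => hx' (hzero h3 x h.symm),
      measureReal_nonneg.lt_of_ne hx'.symm⟩

end Measures
end FracCC

namespace FracCC

open scoped ENNReal NNReal FourierTransform

section Density

variable {N : ℕ} {f : RN N → ℝ}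

theorem isFiniteMeasure_densityMeasure (hf : Integrable f volume) :
    IsFiniteMeasure (densityMeasure f) :=
  isFiniteMeasure_withDensity_ofReal hf.2

theorem integral_densityMeasure (hf : Integrable f volume) (h0 : ∀ x, 0 ≤ f x) (g : RN N → ℝ) :
    ∫ x, g x ∂(densityMeasure f) = ∫ x, g x * f x := by
  rw [densityMeasure, integral_withDensity_eq_integral_toReal_smul₀ hf.1.aemeasurable.ennreal_ofReal
    (Eventually.of_forall fun x => ENNReal.ofReal_lt_top)]
  refine integral_congr_ae (Eventually.of_forall fun x => ?_)
  simp only [ENNReal.toReal_ofReal (h0 x), smul_eq_mul, mul_comm]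

/-- A measure that dominates a density against powers of test functions splits off that density. -/
theorem exists_add_densityMeasure (hf : Integrable f volume) (h0 : ∀ x, 0 ≤ f x)
    {τ : Measure (RN N)} [IsFiniteMeasure τ] {p : ℝ} (hp : 0 < p)
    (h : ∀ ψ : RN N → ℝ, ContDiff ℝ (⊤ : ℕ∞) ψ → HasCompactSupport ψ → (∀ x, 0 ≤ ψ x) →
      ∫ x, ψ x ^ p * f x ≤ ∫ x, ψ x ^ p ∂τ) :
    ∃ κ : Measure (RN N), IsFiniteMeasure κ ∧ τ = densityMeasure f + κ ∧
      ∀ ψ : RN N → ℝ, ContDiff ℝ (⊤ : ℕ∞) ψ → HasCompactSupport ψ → (∀ x, 0 ≤ ψ x) →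
        ∫ x, ψ x ^ p ∂κ = (∫ x, ψ x ^ p ∂τ) - ∫ x, ψ x ^ p * f x := by
  have := isFiniteMeasure_densityMeasure hf
  have hle : densityMeasure f ≤ τ := measure_le_of_integral_rpow_le hp fun ψ h1 h2 h3 => by
    rw [integral_densityMeasure hf h0]
    exact h ψ h1 h2 h3
  have hadd := Measure.sub_add_cancel_of_le hle
  rw [add_comm] at hadd
  refine ⟨τ - densityMeasure f, inferInstance, hadd.symm, fun ψ h1 h2 h3 => ?_⟩
  have hinteg : ∀ κ : Measure (RN N), IsFiniteMeasure κ → Integrable (fun x => ψ x ^ p) κ :=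
    fun κ _ => (h1.continuous.rpow_const fun x => Or.inr hp.le).integrable_of_hasCompactSupport
      (h2.comp_left (g := fun t : ℝ => t ^ p) (by simp [hp.ne']))
  have h4 := integral_add_measure (hinteg (densityMeasure f) this) (hinteg (τ - densityMeasure f) inferInstance)
  rw [hadd, integral_densityMeasure hf h0] at h4
  rw [h4, add_sub_cancel_left]

end Density
end FracCC

theorem lemma4p2 (N : ℕ) [NeZero N] (s : ℝ) (hs0 : 0 < s) (hs1 : s < 1)
    (hN : 2 * s < (N : ℝ))
    (K : ℝ × ℝ → ℝ) (hK : FracCC.IsCriticalK (FracCC.critExp N s) K)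
    (u v : ℕ → FracCC.RN N → ℝ) (u₀ v₀ : FracCC.RN N → ℝ)
    (hu : ∀ n, FracCC.MemHdot s (u n)) (hv : ∀ n, FracCC.MemHdot s (v n))
    (hu₀ : FracCC.MemHdot s u₀) (hv₀ : FracCC.MemHdot s v₀)
    (hbdd : FracCC.BoundedSeq s u v) (htight : FracCC.TightSeq s u v)
    (huw : FracCC.WeakTendsto s u u₀) (hvw : FracCC.WeakTendsto s v v₀)
    (μ σ ν : Measure (FracCC.RN N))
    [IsFiniteMeasure μ] [IsFiniteMeasure σ] [IsFiniteMeasure ν]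
    (hμ : FracCC.MeasTendsto (fun n x => FracCC.halfLap s (u n) x ^ 2) μ)
    (hσ : FracCC.MeasTendsto (fun n x => FracCC.halfLap s (v n) x ^ 2) σ)
    (hν : FracCC.MeasTendsto (fun n x => FracCC.extendK K (u n x) (v n x)) ν) :
    ∃ (I : Type) (_ : Countable I) (x : I → FracCC.RN N) (μi σi νi : I → ℝ),
      Function.Injective x ∧
      (∀ i, 0 < μi i ∧ 0 < σi i ∧ 0 < νi i) ∧
      ν = FracCC.densityMeasure (fun y => FracCC.extendK K (u₀ y) (v₀ y)) +
        FracCC.atomicMeasure x νi ∧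
      FracCC.densityMeasure (fun y => FracCC.halfLap s u₀ y ^ 2) +
        FracCC.atomicMeasure x μi ≤ μ ∧
      FracCC.densityMeasure (fun y => FracCC.halfLap s v₀ y ^ 2) +
        FracCC.atomicMeasure x σi ≤ σ ∧
      ∀ i, FracCC.sobolevK N s K * νi i ^ (2 / FracCC.critExp N s) ≤ μi i + σi i := by
  obtain ⟨S₀, hS₀, hlim⟩ := FracCC.exists_cutoff_limit_le hs0 hs1 hN hK hu hv hu₀ hv₀ hbdd huw hvw
    hμ hσ hν
  have hq2 := FracCC.two_lt_critExp hs0 hN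
  set q := FracCC.critExp N s with hqdef
  have hq : 0 < q := by linarith
  simp only [← Real.rpow_two] at hlim
  obtain ⟨μ', _, hμeq, hμint⟩ := FracCC.exists_add_densityMeasure (τ := μ) (p := 2)
    hu₀.memLp_halfLap.integrable_sq (fun x => sq_nonneg _) two_pos fun ψ h1 h2 h3 => by
      have := (hlim ψ h1 h2 h3 _ _ _ rfl rfl rfl).1
      simp only [Real.rpow_two] at this ⊢
      linarith
  obtain ⟨σ', _, hσeq, hσint⟩ := FracCC.exists_add_densityMeasure (τ := σ) (p := 2)
    hv₀.memLp_halfLap.integrable_sq (fun x => sq_nonneg _) two_pos fun ψ h1 h2 h3 => by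
      have := (hlim ψ h1 h2 h3 _ _ _ rfl rfl rfl).2.1
      simp only [Real.rpow_two] at this ⊢
      linarith
  obtain ⟨ν', _, hνeq, hνint⟩ := FracCC.exists_add_densityMeasure (τ := ν) (p := q)
    (hK.integrable_extendK hq hu₀.1 hv₀.1) (fun x => hK.extendK_nonneg _ _) hq
    fun ψ h1 h2 h3 => by linarith [(hlim ψ h1 h2 h3 _ _ _ rfl rfl rfl).2.2.1]
  simp only [← Real.rpow_two] at hμint hσint
  have hlim' := fun ψ h1 h2 h3 => hlim ψ h1 h2 h3 _ _ _ (hμint ψ h1 h2 h3) (hσint ψ h1 h2 h3)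
    (hνint ψ h1 h2 h3)
  have hgrowth : ∀ c d : ℝ, 0 ≤ c → 0 ≤ d →
      (∀ a b, FracCC.extendK K a b ≤ c * |a| ^ q + d * |b| ^ q) → ∀ T, IsCompact T →
      ν'.real T ≤ S₀ * (c * μ'.real T ^ (q / 2) + d * σ'.real T ^ (q / 2)) := by
    intro c d hc hd hcd T hT
    obtain ⟨ψ, h1, h2, h3, h4⟩ := FracCC.exists_smooth_seq hT
    exact le_of_tendsto_of_tendsto' (h4 ν' q hq)
      (((((h4 μ' 2 two_pos).rpow_const (p := q / 2) (Or.inr (by positivity))).const_mul c).add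
        (((h4 σ' 2 two_pos).rpow_const (p := q / 2) (Or.inr (by positivity))).const_mul d)).const_mul S₀)
      fun n => (hlim' (ψ n) (h1 n) (h2 n) (h3 n)).2.2.2.2 c d hc hd hcd
  obtain ⟨D, hDc, hDν, hDpos, hDS⟩ : ∃ D : Set (FracCC.RN N), D.Countable ∧ ν'.restrict D = ν' ∧
      (∀ x ∈ D, 0 < μ'.real {x} ∧ 0 < σ'.real {x} ∧ 0 < ν'.real {x}) ∧
      ∀ x ∈ D, FracCC.sobolevK N s K * ν'.real {x} ^ (2 / q) ≤ μ'.real {x} + σ'.real {x} := by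
    refine FracCC.exists_countable_atoms hq2 ?_ ?_ ?_
    · intro T hT
      obtain ⟨ψ, h1, h2, h3, h4⟩ := FracCC.exists_smooth_seq hT
      exact le_of_tendsto_of_tendsto'
        (((h4 ν' q hq).rpow_const (Or.inr (by positivity))).const_mul _)
        ((h4 μ' 2 two_pos).add (h4 σ' 2 two_pos))
        fun n => (hlim' (ψ n) (h1 n) (h2 n) (h3 n)).2.2.2.1
    · intro ε hε
      obtain ⟨C, hC0, hC⟩ := hK.exists_extendK_le_left hq (ε := ε / (S₀ + 1)) (by positivity)
      refine ⟨S₀ * C, by positivity, fun T hT => (hgrowth C (ε / (S₀ + 1)) hC0 (by positivity)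
        (fun a b => (hC a b).trans_eq (add_comm _ _)) T hT).trans ?_⟩
      have h5 : S₀ * (ε / (S₀ + 1)) ≤ ε := by
        rw [mul_div_assoc', div_le_iff₀ (by positivity)]
        nlinarith
      have h6 : 0 ≤ σ'.real T ^ (q / 2) := Real.rpow_nonneg measureReal_nonneg _
      nlinarith [mul_le_mul_of_nonneg_right h5 h6]
    · intro ε hε
      obtain ⟨C, hC0, hC⟩ := hK.exists_extendK_le_right hq (ε := ε / (S₀ + 1)) (by positivity)
      refine ⟨S₀ * C, by positivity, fun T hT => (hgrowth (ε / (S₀ + 1)) C (by positivity) hC0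
        hC T hT).trans ?_⟩
      have h5 : S₀ * (ε / (S₀ + 1)) ≤ ε := by
        rw [mul_div_assoc', div_le_iff₀ (by positivity)]
        nlinarith
      have h6 : 0 ≤ μ'.real T ^ (q / 2) := Real.rpow_nonneg measureReal_nonneg _
      nlinarith [mul_le_mul_of_nonneg_right h5 h6]
  refine ⟨D, hDc.to_subtype, fun x => x, fun x => μ'.real {(x : FracCC.RN N)},
    fun x => σ'.real {(x : FracCC.RN N)}, fun x => ν'.real {(x : FracCC.RN N)},
    Subtype.val_injective, fun i => hDpos i i.2, ?_, ?_, ?_, fun i => hDS i i.2⟩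
  · rw [FracCC.atomicMeasure_eq_restrict ν' hDc, hDν]
    exact hνeq
  · rw [FracCC.atomicMeasure_eq_restrict μ' hDc]
    conv_rhs => rw [hμeq]
    exact add_le_add le_rfl Measure.restrict_le_self
  · rw [FracCC.atomicMeasure_eq_restrict σ' hDc]
    conv_rhs => rw [hσeq]
    exact add_le_add le_rfl Measure.restrict_le_self
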